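/- Let $G$ be a compact connected semisimple Lie group with Lie algebra $\mathfrak g$ and Killing form $B$, let $\theta\neq\mathrm{Id}$ be a Lie algebra automorphism of $\mathfrak g$ with $\theta^2=\mathrm{Id}$, let $\mathfrak h$ and $\mathfrak p$ be its $+1$ and $-1$ eigenspaces, and let $H$ be the analytic subgroup of $G$ with Lie algebra $\mathfrak h$. Assume $\operatorname{rank}G=\operatorname{rank}H$ and let $\mathfrak t\subset\mathfrak h$ be the Lie algebra of a common maximal torus, i.e. a maximal abelian subalgebra of $\mathfrak g$ contained in $\mathfrak h$. For $\alpha\in\mathfrak t_{\mathbb C}^*$ put $\mathfrak g_\alpha=\{\xi\in\mathfrak g_{\mathbb C}: [X,\xi]=\alpha(X)\xi\text{ for all }X\in\mathfrak t\}$. Fix a system $\Delta^+$ of positive roots of $(\mathfrak g_{\mathbb C},\mathfrak t_{\mathbb C})$ and let $\alpha_1,\dots,\alpha_m$ be an enumeration, without repetition, of $\Delta^+_{\mathfrak p}=\{\alpha\in\Delta^+:\mathfrak g_\alpha\subset\mathfrak p_{\mathbb C}\}$. Give $\mathfrak p$ the inner product $\langle\cdot,\cdot\rangle=-B$, let $\mathrm{Cl}(\mathfrak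 p)$ be its Clifford algebra with $v\cdot v=-\langle v,v\rangle$, and let $\psi:\mathrm{Spin}(\mathfrak p)\to \mathrm{SO}(\mathfrak p)$, $\psi(x)v=xvx^{-1}$. Assume that $\mathrm{Ad}:H\to \mathrm{SO}(\mathfrak p)$ lifts to a Lie group homomorphism $\bar\rho:H\to\mathrm{Spin}(\mathfrak p)$, i.e. $\psi\circ\bar\rho=\mathrm{Ad}$. Let $\sigma$ be an irreducible complex representation of $\mathrm{Cl}(\mathfrak p)\otimes\mathbb C$ on $S$, and let $\chi=\sigma\circ\bar\rho:H\to\mathrm{GL}(S)$ be the spinor representation of $H$. The weights of a representation of $H$ are those $\lambda\in\mathfrak t_{\mathbb C}^*$ for which its differential at the identity has a nonzero weight space. Then $\dim\mathfrak p=2m$, and the weights of $\chi$ are $$\tilde\lambda_\varepsilon=\tfrac12\sum_{k=1}^m\varepsilon_k\alpha_k,\qquad \varepsilon=(\varepsilon_1,\dots,\varepsilon_m)\in\{\pm1\}^m .$$ The multiplicity of each weight $\tilde\lambda_\varepsilon$ of $\chi$ is the number of $\varepsilon'\in\{\pm1\}^m$ with $\tilde\lambda_{\varepsilon'}=\tilde\lambda_\varepsilon$.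 Moreover, for an orthonormal basis $e=(e_1,\dots,e_{2m})$ of $\mathfrak p$, let $S^\pm$ be the $\pm1$ eigenspaces of $\sigma(i^m e_1\cdots e_{2m})$ (they depend only on the orientation of $e$). Then $S=S^+\oplus S^-$, and $S^\pm$ are invariant under $\chi(H)$; let $\chi^\pm$ be the restrictions of $\chi$ to $S^\pm$ (the half spinor representations). Let $E^+$ be the set of $\varepsilon\in\{\pm1\}^m$ with an even number of entries $-1$, and $E^-$ its complement. There is an orthonormal basis $e$ with the same orientation as a basis $f$ of $\mathfrak p$ such that $f_{2k-1}+i f_{2k}\in\mathfrak g_{\alpha_k}$ for $k=1,\dots,m$. For every orthonormal basis $e$ with this orientation, the weights of $\chi^+$ are $\{\tilde\lambda_\varepsilon:\varepsilon\in E^+\}$ and the weights of $\chi^-$ are $\{\tilde\lambda_\varepsilon:\varepsilon\in E^-\}$; for every orthonormal basis with the opposite orientation, $E^+$ and $E^-$ are interchanged. -/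

import Mathlib

open scoped Manifold ContDiff TensorProduct

noncomputable section

namespace SymmetricSpin

/-! ### Lie algebra data: symmetric pairs, roots, positive systems -/

section LieAlg

variable {L : Type*} [LieRing L] [LieAlgebra ℝ L]

/-- The `+1` eigenspace `𝔥` of an automorphism `θ` of a real Lie algebra. -/
def fixedSubalgebra (θ : L ≃ₗ⁅ℝ⁆ L) : LieSubalgebra ℝ L where
  carrier := {X | θ X = X}
  add_mem' {X Y} hX hY := (map_add θ X Y).trans (congrArg₂ _ hX hY)
  zero_mem' := map_zero θ
  smul_mem' c X hX := (map_smul θ c X).trans (congrArg _ hX)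
  lie_mem' {X Y} hX hY := (LieEquiv.map_lie θ X Y).trans (congrArg₂ _ hX hY)

/-- The `-1` eigenspace `𝔭` of an automorphism `θ` of a real Lie algebra. -/
def minusSubspace (θ : L ≃ₗ⁅ℝ⁆ L) : Submodule ℝ L where
  carrier := {X | θ X = -X}
  add_mem' {X Y} hX hY :=
    (map_add θ X Y).trans ((congrArg₂ _ hX hY).trans (neg_add X Y).symm)
  zero_mem' := (map_zero θ).trans neg_zero.symm
  smul_mem' c X hX := (map_smul θ c X).trans ((congrArg _ hX).trans (smul_neg c X))

/-- The bilinear form `⟨X, Y⟩ = -B(X, Y)` on a subspace, where `B` is the Killing form. -/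
def innerForm (V : Submodule ℝ L) : LinearMap.BilinForm ℝ V :=
  -(LinearMap.BilinForm.restrict (killingForm ℝ L) V)

/-- The quadratic form `q(X) = ⟨X, X⟩ = -B(X, X)` on a subspace. -/
def normForm (V : Submodule ℝ L) : QuadraticForm ℝ V :=
  LinearMap.BilinMap.toQuadraticMap (innerForm V)

/-- The Clifford algebra of `(V, q)` with the convention `v * v = -q(v)`. -/
abbrev Cl (V : Submodule ℝ L) : Type _ := CliffordAlgebra (-(normForm V))

/-- The complexified Clifford algebra. -/
abbrev ComplexCl (V : Submodule ℝ L) : Type _ := ℂ ⊗[ℝ] Cl V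

/-- The spin group of `(V, q)`, inside the Clifford algebra. -/
abbrev Spin (V : Submodule ℝ L) : Type _ := spinGroup (-(normForm V))

/-- A maximal abelian subalgebra. -/
def IsMaximalAbelian (𝔱 : LieSubalgebra ℝ L) : Prop :=
  Maximal (fun 𝔞 : LieSubalgebra ℝ L => IsLieAbelian 𝔞) 𝔱

/-- The simultaneous eigenspace `𝔤_α = {ξ ∈ 𝔤_ℂ | [X, ξ] = α(X) ξ for all X ∈ 𝔱}`. An element of
`(𝔱_ℂ)^*` is given here by its restriction to `𝔱`, a real linear map `𝔱 → ℂ`. -/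
def rootSpace (𝔱 : LieSubalgebra ℝ L) (α : 𝔱 →ₗ[ℝ] ℂ) : Submodule ℂ (ℂ ⊗[ℝ] L) :=
  ⨅ X : 𝔱, Module.End.eigenspace
    (LieAlgebra.ad ℂ (ℂ ⊗[ℝ] L) ((1 : ℂ) ⊗ₜ[ℝ] (X : L))) (α X)

/-- The roots of `𝔤_ℂ` with respect to `𝔱_ℂ`. -/
def roots (𝔱 : LieSubalgebra ℝ L) : Set (𝔱 →ₗ[ℝ] ℂ) :=
  {α | α ≠ 0 ∧ rootSpace 𝔱 α ≠ ⊥}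

/-- A choice of positive roots: exactly one of each pair `±α`, closed under sums that are roots. -/
structure IsPositiveSystem (𝔱 : LieSubalgebra ℝ L) (P : Set (𝔱 →ₗ[ℝ] ℂ)) : Prop where
  subset_roots : P ⊆ roots 𝔱
  mem_or_neg_mem : ∀ α ∈ roots 𝔱, α ∈ P ∨ -α ∈ P
  not_both : ∀ α ∈ P, -α ∉ P
  add_mem : ∀ α ∈ P, ∀ β ∈ P, α + β ∈ roots 𝔱 → α + β ∈ P

/-- The positive roots whose root space lies in the complexification of `V` (for `V = 𝔭` this is
`Δ_𝔭^+`). -/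
def positiveRootsIn (𝔱 : LieSubalgebra ℝ L) (P : Set (𝔱 →ₗ[ℝ] ℂ)) (V : Submodule ℝ L) :
    Set (𝔱 →ₗ[ℝ] ℂ) :=
  {α | α ∈ P ∧ rootSpace 𝔱 α ≤ V.baseChange ℂ}

/-- The functional `½ ∑ ε_k α_k`. -/
def signedHalfSum {𝔱 : LieSubalgebra ℝ L} {m : ℕ} (α : Fin m → (𝔱 →ₗ[ℝ] ℂ))
    (ε : Fin m → ℤˣ) : 𝔱 →ₗ[ℝ] ℂ :=
  (1 / 2 : ℝ) • ∑ k, (((ε k : ℤˣ) : ℤ) : ℝ) • α k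

/-- Orthonormality with respect to `⟨·, ·⟩`. -/
def IsOrthonormal {V : Submodule ℝ L} {n : ℕ} (e : Module.Basis (Fin n) ℝ V) : Prop :=
  ∀ i j, innerForm V (e i) (e j) = if i = j then 1 else 0

/-- The basis `e` of `V` has the orientation determined by the functionals `α₁, …, α_m`: it is
oriented like a basis `f` with `f_{2k-1} + i f_{2k} ∈ 𝔤_{α_k}` for all `k` (indices from `1`). -/
def IsRootOriented {𝔱 : LieSubalgebra ℝ L} {V : Submodule ℝ L} {m : ℕ}
    (α : Fin m → (𝔱 →ₗ[ℝ] ℂ)) (e : Module.Basis (Fin (2 * m)) ℝ V) : Prop :=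
  ∃ f : Module.Basis (Fin (2 * m)) ℝ V,
    (∀ k : Fin m,
      (1 : ℂ) ⊗ₜ[ℝ] ((f ⟨2 * k, by omega⟩ : V) : L)
        + Complex.I ⊗ₜ[ℝ] ((f ⟨2 * k + 1, by omega⟩ : V) : L) ∈ rootSpace 𝔱 (α k)) ∧
    f.orientation = e.orientation

/-- The complex volume element `i^m e₁ ⋯ e_{2m}` of a basis. -/
def volumeElement {V : Submodule ℝ L} {m : ℕ} (e : Module.Basis (Fin (2 * m)) ℝ V) :
    ComplexCl V :=
  (Complex.I ^ m) ⊗ₜ[ℝ]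
    (List.ofFn fun j : Fin (2 * m) => CliffordAlgebra.ι (-(normForm V)) (e j)).prod

end LieAlg

/-- Sign vectors with an even number of entries `-1`. -/
def evenSigns (m : ℕ) : Set (Fin m → ℤˣ) :=
  {ε | Even (Finset.univ.filter fun k => ε k = -1).card}

/-! ### Lie groups -/

section LieGrp

variable {E : Type*} [NormedAddCommGroup E] [NormedSpace ℝ E] [FiniteDimensional ℝ E]
  {G : Type*} [TopologicalSpace G] [ChartedSpace E G] [Group G]
  {F : Type*} [NormedAddCommGroup F] [NormedSpace ℝ F] [FiniteDimensional ℝ F]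
  {H : Type*} [TopologicalSpace H] [ChartedSpace F H] [Group H]

instance lieGroupMinSmoothness [LieGroup 𝓘(ℝ, E) ∞ G] :
    LieGroup 𝓘(ℝ, E) (minSmoothness ℝ 3) G :=
  LieGroup.of_le (n := ∞) (by simpa using ENat.LEInfty.out)

/-- The adjoint representation: the differential at `1` of conjugation by `g`. -/
def Ad (g : G) : GroupLieAlgebra 𝓘(ℝ, E) G → GroupLieAlgebra 𝓘(ℝ, E) G :=
  fun X => (mfderiv 𝓘(ℝ, E) 𝓘(ℝ, E) (fun x : G => g * x * g⁻¹) 1 : E →L[ℝ] E) X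

/-- The differential at `1` of a group homomorphism between Lie groups. -/
def homDifferential (j : H →* G) : GroupLieAlgebra 𝓘(ℝ, F) H → GroupLieAlgebra 𝓘(ℝ, E) G :=
  fun X => (mfderiv 𝓘(ℝ, F) 𝓘(ℝ, E) j 1 : F →L[ℝ] E) X

/-- `j : H → G` is (the inclusion of) the analytic subgroup of `G` with Lie algebra `𝔥`: `H` is a
connected Lie group and `j` is an injective immersive homomorphism with `j_*(Lie H) = 𝔥`. -/
structure IsAnalyticSubgroup [LieGroup 𝓘(ℝ, E) ∞ G] [LieGroup 𝓘(ℝ, F) ∞ H]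
    (j : H →* G) (𝔥 : LieSubalgebra ℝ (GroupLieAlgebra 𝓘(ℝ, E) G)) : Prop where
  connected : ConnectedSpace H
  smooth : ContMDiff 𝓘(ℝ, F) 𝓘(ℝ, E) ∞ j
  injective : Function.Injective j
  immersive : Function.Injective (homDifferential (E := E) (F := F) j)
  range_eq : Set.range (homDifferential (E := E) (F := F) j) = (𝔥 : Set _)

/-- `ρ : H → Spin(𝔭)` is a Lie group homomorphism that lifts `Ad : H → SO(𝔭)` through the covering
`ψ(x) v = x v x⁻¹`. Smoothness into the finite-dimensional algebra `Cl(𝔭)` is tested on linear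
functionals. -/
structure IsSpinLift [LieGroup 𝓘(ℝ, E) ∞ G] (j : H →* G)
    (𝔭 : Submodule ℝ (GroupLieAlgebra 𝓘(ℝ, E) G)) (ρ : H →* Spin 𝔭) : Prop where
  smooth : ∀ f : Cl 𝔭 →ₗ[ℝ] ℝ, ContMDiff 𝓘(ℝ, F) 𝓘(ℝ, ℝ) ∞ fun h => f (ρ h : Cl 𝔭)
  lifts : ∀ (h : H) (X : 𝔭), ∃ Y : 𝔭, Ad (E := E) (j h) X = Y ∧
    (ρ h : Cl 𝔭) * CliffordAlgebra.ι (-(normForm 𝔭)) X * ((ρ h)⁻¹ : Spin 𝔭)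
      = CliffordAlgebra.ι (-(normForm 𝔭)) Y

variable {S : Type*} [NormedAddCommGroup S] [NormedSpace ℂ S]

/-- Irreducibility of a representation of a complex algebra on `S`. -/
def IsIrreducibleRep {A : Type*} [Ring A] [Algebra ℂ A] (σ : A →ₐ[ℂ] (S →L[ℂ] S)) : Prop :=
  Nontrivial S ∧
    ∀ W : Submodule ℂ S, (∀ a, ∀ w ∈ W, σ a w ∈ W) → W = ⊥ ∨ W = ⊤

/-- The representation `χ = σ ∘ ρ` of `H` obtained from a representation `σ` of the complexified
Clifford algebra and a homomorphism `ρ` to the spin group. -/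
def spinorRep {L : Type*} [LieRing L] [LieAlgebra ℝ L] {V : Submodule ℝ L}
    (σ : ComplexCl V →ₐ[ℂ] (S →L[ℂ] S)) (ρ : H →* Spin V) : H →* (S →L[ℂ] S) where
  toFun h := σ ((1 : ℂ) ⊗ₜ[ℝ] (ρ h : Cl V))
  map_one' := by
    rw [map_one, OneMemClass.coe_one, ← Algebra.TensorProduct.one_def, map_one]
  map_mul' x y := by
    rw [map_mul, Submonoid.coe_mul, ← map_mul, Algebra.TensorProduct.tmul_mul_tmul, one_mul]

/-- The `c`-eigenspace in `S` of the action of an element `a`. -/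
def actionEigenspace {A : Type*} [Ring A] [Algebra ℂ A] (σ : A →ₐ[ℂ] (S →L[ℂ] S)) (a : A)
    (c : ℂ) : Submodule ℂ S :=
  Module.End.eigenspace ((σ a : S →L[ℂ] S) : Module.End ℂ S) c

/-- The restriction of a representation of `H` to an invariant subspace. -/
def restrictRep (χ : H →* (S →L[ℂ] S)) (W : Submodule ℂ S)
    (hW : ∀ h, ∀ w ∈ W, χ h w ∈ W) : H →* (W →L[ℂ] W) where
  toFun h := ((χ h).comp W.subtypeL).codRestrict W fun w => hW h w w.2
  map_one' := by ext w; simp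
  map_mul' x y := by
    ext w
    exact DFunLike.congr_fun (map_mul χ x y) (w : S)

/-- The differential at `1` of a representation of the Lie group `H`. -/
def repDifferential (χ : H →* (S →L[ℂ] S)) :
    GroupLieAlgebra 𝓘(ℝ, F) H → (S →L[ℂ] S) :=
  fun X => (mfderiv 𝓘(ℝ, F) 𝓘(ℝ, S →L[ℂ] S) χ 1 : F →L[ℝ] (S →L[ℂ] S)) X

/-- The weight space `{s ∈ S | χ_*(X) s = μ(X) s for all X ∈ 𝔱}`, where `𝔱` is a subalgebra of
`j_*(Lie H)`. -/
def weightSpace [LieGroup 𝓘(ℝ, E) ∞ G] (j : H →* G)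
    (𝔱 : LieSubalgebra ℝ (GroupLieAlgebra 𝓘(ℝ, E) G)) (χ : H →* (S →L[ℂ] S))
    (μ : 𝔱 →ₗ[ℝ] ℂ) : Submodule ℂ S :=
  ⨅ (X : GroupLieAlgebra 𝓘(ℝ, F) H) (Y : 𝔱)
    (_ : homDifferential (E := E) (F := F) j X = (Y : GroupLieAlgebra 𝓘(ℝ, E) G)),
    Module.End.eigenspace ((repDifferential (F := F) χ X : S →L[ℂ] S) : Module.End ℂ S) (μ Y)

/-- The weights of a representation of `H`. -/
def weights [LieGroup 𝓘(ℝ, E) ∞ G] (j : H →* G)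
    (𝔱 : LieSubalgebra ℝ (GroupLieAlgebra 𝓘(ℝ, E) G)) (χ : H →* (S →L[ℂ] S)) :
    Set (𝔱 →ₗ[ℝ] ℂ) :=
  {μ | weightSpace (F := F) j 𝔱 χ μ ≠ ⊥}

end LieGrp

end SymmetricSpin

end

/-! The infinitesimal picture. Since $G$ is compact and semisimple, $-B$ is positive definite, so
$\mathfrak t_{\mathbb C}$ is a Cartan subalgebra, the roots are imaginary on $\mathfrak t$, and root
spaces are complex lines. The involution fixes $\mathfrak t$ pointwise, hence acts on each root line
by $\pm1$; the lines with $-1$ make up $\mathfrak p_{\mathbb C}$, and conjugation exchanges the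
lines of $\alpha$ and $-\alpha$. The real and imaginary parts of one vector in each $\mathfrak
g_{\alpha_k}$ therefore form an orthogonal basis of $\mathfrak p$ (`exists_isRootBasis`), in which
$\operatorname{ad}Y$, $Y\in\mathfrak t$, rotates the $k$-th plane with speed
$\operatorname{Im}\alpha_k(Y)$.

An element of the Lie algebra of the spin group is determined by its commutators with vectors.
Differentiating $\psi\circ\bar\rho=\mathrm{Ad}$ gives
$\bar\rho_*(Y)=-\frac12\sum_k\operatorname{Im}\alpha_k(Y)\,e_{2k-1}e_{2k}$ in the normalized root
basis (`weakDifferential_spinLift`). On an irreducible Clifford module the commuting involutions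
$i\,e_{2k-1}e_{2k}$ have a joint eigenbasis indexed by all sign vectors
(`IsCliffordFamily.exists_basis`). On the vector with signs $\varepsilon$, $\bar\rho_*(Y)$ acts by
$\frac12\sum_k\varepsilon_k\alpha_k(Y)$, which gives the weights and multiplicities.

The complex volume element is the product of these involutions, so it acts by
$\prod_k\varepsilon_k$, and its eigenspaces separate even and odd sign vectors. It commutes with the
even Clifford algebra, hence with the spin group, and changes by the determinant under a change of
orthonormal basis, so only the orientation matters. -/

section

open Filter Topology

/-! ### Left invariant vector fields and the Lie bracket in a chart -/

section

variable {E : Type*} [NormedAddCommGroup E] [NormedSpace ℝ E]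
  {F : Type*} [NormedAddCommGroup F] [NormedSpace ℝ F]
  {M : Type*} [TopologicalSpace M] [ChartedSpace E M]
  {N : Type*} [TopologicalSpace N] [ChartedSpace F N]

/-- The derivative of a map between manifolds without boundary, computed in the preferred charts. -/
theorem mfderiv_eq_fderiv_extChartAt {f : M → N} {x : M} {y : N}
    (hf : MDifferentiableAt 𝓘(ℝ, E) 𝓘(ℝ, F) f x) (hy : f x = y) :
    (mfderiv 𝓘(ℝ, E) 𝓘(ℝ, F) f x : E →L[ℝ] F) =
      fderiv ℝ (extChartAt 𝓘(ℝ, F) y ∘ f ∘ (extChartAt 𝓘(ℝ, E) x).symm)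
        (extChartAt 𝓘(ℝ, E) x x) := by
  subst hy
  have key : ∀ D : E →L[ℝ] F,
      HasFDerivWithinAt (extChartAt 𝓘(ℝ, F) (f x) ∘ f ∘ (extChartAt 𝓘(ℝ, E) x).symm) D
        (Set.range 𝓘(ℝ, E)) (extChartAt 𝓘(ℝ, E) x x) →
      D = fderiv ℝ (extChartAt 𝓘(ℝ, F) (f x) ∘ f ∘ (extChartAt 𝓘(ℝ, E) x).symm)
        (extChartAt 𝓘(ℝ, E) x x) := by
    intro D hD
    rw [modelWithCornersSelf_coe, Set.range_id, hasFDerivWithinAt_univ] at hD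
    exact hD.fderiv.symm
  exact key _ hf.hasMFDerivAt.2

theorem contDiffAt_extChartAt_comp {n : WithTop ℕ∞} [IsManifold 𝓘(ℝ, E) n M] [IsManifold 𝓘(ℝ, F) n N]
    {f : M → N} {x : M} {y : N}
    (hf : ContMDiffAt 𝓘(ℝ, E) 𝓘(ℝ, F) n f x) (hy : f x = y) :
    ContDiffAt ℝ n (extChartAt 𝓘(ℝ, F) y ∘ f ∘ (extChartAt 𝓘(ℝ, E) x).symm)
        (extChartAt 𝓘(ℝ, E) x x) := by
  subst hy
  have := (contMDiffAt_iff.1 hf).2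
  rwa [modelWithCornersSelf_coe, Set.range_id, contDiffWithinAt_univ] at this

end

/-- The bracket and the adjoint action for a product `μ` on a neighbourhood of `c` in a vector
space: if `D₁μ(c, x) (A x Y) = D₂μ(x, c) Y`, then the derivative of `x ↦ A x Y` at the neutral
element `c` is the Lie bracket of left invariant vector fields. -/
theorem hasFDerivAt_adjoint_of_product {E : Type*} [NormedAddCommGroup E] [NormedSpace ℝ E]
    [CompleteSpace E]
    {μ : E × E → E} {c : E} (hμ : ContDiffAt ℝ 2 μ (c, c))
    (hl : ∀ᶠ x in 𝓝 c, μ (c, x) = x) (hr : ∀ᶠ x in 𝓝 c, μ (x, c) = x) {A : E → E} {Y : E}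
    (hA : ∀ᶠ x in 𝓝 c, fderiv ℝ (fun y => μ (y, x)) c (A x) = fderiv ℝ (fun y => μ (x, y)) c Y) :
    ∃ A' : E →L[ℝ] E, HasFDerivAt A A' c ∧ A c = Y ∧ ∀ X, A' X =
      VectorField.lieBracket ℝ (fun x => fderiv ℝ (fun y => μ (x, y)) c X)
        (fun x => fderiv ℝ (fun y => μ (x, y)) c Y) c := by
  have hd : ∀ᶠ p in 𝓝 (c, c), DifferentiableAt ℝ μ p := by
    filter_upwards [hμ.eventually (by simp)] with p hp using hp.differentiableAt (by simp)
  have h1 : ∀ᶠ x in 𝓝 c, ∀ Z, fderiv ℝ (fun y => μ (y, x)) c Z = fderiv ℝ μ (c, x) (Z, 0) := by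
    have : Tendsto (fun x : E => (c, x)) (𝓝 c) (𝓝 (c, c)) := (Continuous.prodMk_right c).tendsto c
    filter_upwards [this.eventually hd] with x hx Z
    have := HasFDerivAt.comp (g := μ) (f := fun y => (y, x)) c hx.hasFDerivAt
      (hasFDerivAt_prodMk_left c x)
    rw [show (fun y => μ (y, x)) = μ ∘ fun y => (y, x) from rfl, this.fderiv]
    simp
  have h2 : ∀ᶠ x in 𝓝 c, ∀ Z, fderiv ℝ (fun y => μ (x, y)) c Z = fderiv ℝ μ (x, c) (0, Z) := by
    have : Tendsto (fun x : E => (x, c)) (𝓝 c) (𝓝 (c, c)) := (Continuous.prodMk_left c).tendsto c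
    filter_upwards [this.eventually hd] with x hx Z
    have := HasFDerivAt.comp (g := μ) (f := fun y => (x, y)) c hx.hasFDerivAt
      (hasFDerivAt_prodMk_right x c)
    rw [show (fun y => μ (x, y)) = μ ∘ fun y => (x, y) from rfl, this.fderiv]
    simp
  have hD : HasFDerivAt (fderiv ℝ μ) (fderiv ℝ (fderiv ℝ μ) (c, c)) (c, c) :=
    ((hμ.fderiv_right (m := 1) (by norm_num)).differentiableAt (by simp)).hasFDerivAt
  have hsymm : IsSymmSndFDerivAt ℝ μ (c, c) := hμ.isSymmSndFDerivAt (by simp)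
  set D := fderiv ℝ (fderiv ℝ μ) (c, c) with hDdef
  -- the second factor
  have hV : ∀ Z, HasFDerivAt (fun x => fderiv ℝ (fun y => μ (x, y)) c Z)
      ((ContinuousLinearMap.apply ℝ E ((0, Z) : E × E)).comp
        (D.comp (ContinuousLinearMap.inl ℝ E E))) c := by
    intro Z
    have := ((ContinuousLinearMap.apply ℝ E ((0, Z) : E × E)).hasFDerivAt).comp c
      (HasFDerivAt.comp (f := fun x => (x, c)) c hD (hasFDerivAt_prodMk_left c c))
    exact this.congr_of_eventuallyEq (h2.mono fun x hx => hx Z)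
  have hV0 : ∀ Z, fderiv ℝ (fun y => μ (c, y)) c Z = Z := by
    intro Z
    rw [Filter.EventuallyEq.fderiv_eq (f := fun y => y) hl]
    simp
  have hR0 : ∀ Z, fderiv ℝ (fun y => μ (y, c)) c Z = Z := by
    intro Z
    rw [Filter.EventuallyEq.fderiv_eq (f := fun y => y) hr]
    simp
  -- the right translations
  let R : E → E →L[ℝ] E := fun x => (fderiv ℝ μ (c, x)).comp (ContinuousLinearMap.inl ℝ E E)
  have hRd : HasFDerivAt R ((ContinuousLinearMap.compL ℝ E (E × E) E).flip
      (ContinuousLinearMap.inl ℝ E E) ∘L (D.comp (ContinuousLinearMap.inr ℝ E E))) c :=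
    (((ContinuousLinearMap.compL ℝ E (E × E) E).flip
      (ContinuousLinearMap.inl ℝ E E)).hasFDerivAt).comp c
      (HasFDerivAt.comp (f := fun x => (c, x)) c hD (hasFDerivAt_prodMk_right c c))
  have hRc : R c = ContinuousLinearMap.id ℝ E := by
    ext Z
    have := h1.self_of_nhds Z
    rw [hR0] at this
    simpa [R] using this.symm
  have hinv : ContDiffAt ℝ 1 ContinuousLinearMap.inverse (R c) := by
    rw [hRc]
    exact contDiffAt_map_inverse (ContinuousLinearEquiv.refl ℝ E)
  have hRinv : ∀ᶠ x in 𝓝 c, (R x).IsInvertible := by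
    have h0 := ContinuousLinearEquiv.nhds (ContinuousLinearEquiv.refl ℝ E)
    have : Tendsto R (𝓝 c) (𝓝 ((ContinuousLinearEquiv.refl ℝ E : E ≃L[ℝ] E) : E →L[ℝ] E)) := by
      have := hRd.continuousAt.tendsto
      rwa [hRc] at this
    exact (this.eventually h0).mono fun x hx => hx
  -- Differentiability of `A` is not assumed. It follows from writing `A` as the inverse of `R`
  -- applied to a differentiable field, which is possible near `c` because `R c` is the identity.
  have hAeq : A =ᶠ[𝓝 c] fun x => (R x).inverse (fderiv ℝ (fun y => μ (x, y)) c Y) := by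
    filter_upwards [hRinv, hA, h1] with x hx hAx h1x
    rw [← hAx, h1x]
    have : fderiv ℝ μ (c, x) (A x, 0) = R x (A x) := by simp [R]
    rw [this]
    obtain ⟨e, he⟩ := hx
    rw [← he]; simp
  have hAd : DifferentiableAt ℝ A c := by
    refine DifferentiableAt.congr_of_eventuallyEq ?_ hAeq
    exact ((hinv.differentiableAt (by simp)).comp c hRd.differentiableAt).clm_apply
      (hV Y).differentiableAt
  have hAc : A c = Y := by
    have := hA.self_of_nhds
    rwa [hR0, hV0] at this
  refine ⟨fderiv ℝ A c, hAd.hasFDerivAt, hAc, fun X => ?_⟩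
  -- Leibniz rule for `R x (A x)`, which near `c` is the left invariant field of `Y`. In the
  -- direction `X` it reads `A' X + D (0, X) (Y, 0) = D (X, 0) (0, Y)`.
  have hprod := hRd.clm_apply hAd.hasFDerivAt
  have heq : (fun x => R x (A x)) =ᶠ[𝓝 c] fun x => fderiv ℝ (fun y => μ (x, y)) c Y := by
    filter_upwards [hA, h1] with x hAx h1x
    rw [← hAx, h1x]
    simp [R]
  have hder := (hprod.congr_of_eventuallyEq heq.symm).unique (hV Y)
  have hX := DFunLike.congr_fun hder X
  simp only [add_apply, ContinuousLinearMap.comp_apply,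
    ContinuousLinearMap.flip_apply, hRc, hAc, ContinuousLinearMap.compL_apply,
    ContinuousLinearMap.id_apply, ContinuousLinearMap.inl_apply, ContinuousLinearMap.inr_apply,
    ContinuousLinearMap.apply_apply] at hX
  rw [VectorField.lieBracket, (hV Y).fderiv, (hV X).fderiv, hV0, hV0]
  simp only [ContinuousLinearMap.comp_apply, ContinuousLinearMap.inl_apply,
    ContinuousLinearMap.apply_apply]
  -- Symmetry of the second derivative of `μ` turns the term coming from `R` into the derivative of
  -- the left invariant field of `X` in the direction `Y`.
  rw [← hX, hsymm (Y, 0) (0, X)]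
  abel

section LieGroup

variable {E : Type*} [NormedAddCommGroup E] [NormedSpace ℝ E]
  {G : Type*} [TopologicalSpace G] [ChartedSpace E G] [Group G]

variable (E) in
/-- Multiplication of a Lie group in the preferred chart at `1`. -/
noncomputable def chartMul (G : Type*) [TopologicalSpace G] [ChartedSpace E G] [Group G] (p : E × E) : E :=
  extChartAt 𝓘(ℝ, E) (1 : G)
    ((extChartAt 𝓘(ℝ, E) (1 : G)).symm p.1 * (extChartAt 𝓘(ℝ, E) (1 : G)).symm p.2)

variable (E) in
/-- Conjugation in a Lie group in the preferred chart at `1`. -/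
noncomputable def chartConj {G : Type*} [TopologicalSpace G] [ChartedSpace E G] [Group G] (g : G) (u : E) : E :=
  extChartAt 𝓘(ℝ, E) (1 : G) (g * (extChartAt 𝓘(ℝ, E) (1 : G)).symm u * g⁻¹)

/-- Left invariant vector fields in the preferred chart at `1`. -/
theorem mpullbackWithin_mulInvariantVectorField [LieGroup 𝓘(ℝ, E) ∞ G]
    (Y : GroupLieAlgebra 𝓘(ℝ, E) G) {x : E} (hx : x ∈ (extChartAt 𝓘(ℝ, E) (1 : G)).target) :
    (VectorField.mpullbackWithin 𝓘(ℝ, E) 𝓘(ℝ, E) (extChartAt 𝓘(ℝ, E) (1 : G)).symm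
      (mulInvariantVectorField Y) (Set.range 𝓘(ℝ, E)) x : E) =
    fderiv ℝ (fun y => chartMul E G (x, y)) (extChartAt 𝓘(ℝ, E) (1 : G) 1) (Y : E) := by
  have : IsManifold 𝓘(ℝ, E) 1 G := IsManifold.of_le (n := ∞) (by norm_num)
  set g : G := (extChartAt 𝓘(ℝ, E) (1 : G)).symm x with hg
  have hgs : g ∈ (chartAt E (1 : G)).source := by
    have := (extChartAt 𝓘(ℝ, E) (1 : G)).map_target hx
    rwa [extChartAt_source] at this
  -- Pulling back by the inverse chart thus means applying the derivative of the chart, which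
  -- composes with that of left translation by `g`.
  have hinv : (mfderiv[Set.range 𝓘(ℝ, E)] (extChartAt 𝓘(ℝ, E) (1 : G)).symm x).inverse =
      mfderiv 𝓘(ℝ, E) 𝓘(ℝ, E) (extChartAt 𝓘(ℝ, E) (1 : G)) g :=
    ContinuousLinearMap.inverse_eq (mfderivWithin_extChartAt_symm_comp_mfderiv_extChartAt hx)
      (mfderiv_extChartAt_comp_mfderivWithin_extChartAt_symm hx)
  rw [VectorField.mpullbackWithin_apply, hinv]
  have h1 : HasMFDerivAt 𝓘(ℝ, E) 𝓘(ℝ, E) (extChartAt 𝓘(ℝ, E) (1 : G)) (g * 1)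
      (mfderiv 𝓘(ℝ, E) 𝓘(ℝ, E) (extChartAt 𝓘(ℝ, E) (1 : G)) g : E →L[ℝ] E) := by
    rw [mul_one]
    exact ((contMDiffAt_extChartAt' (n := 1) hgs).mdifferentiableAt (by simp)).hasMFDerivAt
  have h2 : MDifferentiableAt 𝓘(ℝ, E) 𝓘(ℝ, E) (fun y : G => g * y) 1 :=
    (contMDiff_mul_left (I := 𝓘(ℝ, E)) (n := ∞)).contMDiffAt.mdifferentiableAt (by simp)
  have h3 := HasMFDerivAt.comp (1 : G) h1 h2.hasMFDerivAt
  have h4 := mfderiv_eq_fderiv_extChartAt h3.mdifferentiableAt rfl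
  rw [h3.mfderiv] at h4
  exact DFunLike.congr_fun h4 Y

/-- The bracket of left invariant fields on the manifold is computed in the preferred chart at `1`.
The derivative of this chart at `1` is the identity of the model space, so nothing has to be
transported back. -/
theorem lie_eq_lieBracket_chartMul [LieGroup 𝓘(ℝ, E) ∞ G] [CompleteSpace E]
    (X Y : GroupLieAlgebra 𝓘(ℝ, E) G) :
    (⁅X, Y⁆ : GroupLieAlgebra 𝓘(ℝ, E) G) =
      VectorField.lieBracket ℝ
        (fun x => fderiv ℝ (fun y => chartMul E G (x, y)) (extChartAt 𝓘(ℝ, E) (1 : G) 1) (X : E))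
        (fun x => fderiv ℝ (fun y => chartMul E G (x, y)) (extChartAt 𝓘(ℝ, E) (1 : G) 1) (Y : E))
        (extChartAt 𝓘(ℝ, E) (1 : G) 1) := by
  have : IsManifold 𝓘(ℝ, E) 1 G := IsManifold.of_le (n := ∞) (by norm_num)
  have key : ∀ (D : E →L[ℝ] E) (V W : E → E) (s : Set E) (c : E),
      D = ContinuousLinearMap.id ℝ E → s = Set.univ →
      D.inverse (VectorField.lieBracketWithin ℝ V W s c) = VectorField.lieBracket ℝ V W c := by
    rintro D V W s c rfl rfl
    rw [ContinuousLinearMap.inverse_id, VectorField.lieBracketWithin_univ,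
      ContinuousLinearMap.id_apply]
  refine (key _ _ _ ((extChartAt 𝓘(ℝ, E) (1 : G)).symm ⁻¹' Set.univ ∩ Set.range 𝓘(ℝ, E)) _
    mfderiv_extChartAt_self (by simp)).trans ?_
  refine Filter.EventuallyEq.lieBracket_vectorField_eq ?_ ?_
  · filter_upwards [extChartAt_target_mem_nhds (I := 𝓘(ℝ, E)) (1 : G)] with u hu
    exact mpullbackWithin_mulInvariantVectorField X hu
  · filter_upwards [extChartAt_target_mem_nhds (I := 𝓘(ℝ, E)) (1 : G)] with u hu
    exact mpullbackWithin_mulInvariantVectorField Y hu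

end LieGroup

end

/-! ### The adjoint representation and its differential -/

section

open Filter Topology SymmetricSpin

section

variable {E : Type*} [NormedAddCommGroup E] [NormedSpace ℝ E]
  {F : Type*} [NormedAddCommGroup F] [NormedSpace ℝ F]
  {M : Type*} [TopologicalSpace M] [ChartedSpace E M]
  {N : Type*} [TopologicalSpace N] [ChartedSpace F N]

/-- The curve through `x` that is a straight line with direction `X` in the preferred chart. -/
noncomputable def chartCurve (x : M) (X : E) (t : ℝ) : M :=
  (extChartAt 𝓘(ℝ, E) x).symm (extChartAt 𝓘(ℝ, E) x x + t • X)

theorem chartCurve_zero (x : M) (X : E) : chartCurve x X 0 = x := by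
  simp [chartCurve]

theorem continuousAt_chartCurve (x : M) (X : E) : ContinuousAt (chartCurve x X) 0 := by
  refine ContinuousAt.comp (g := (extChartAt 𝓘(ℝ, E) x).symm)
    (f := fun t : ℝ => extChartAt 𝓘(ℝ, E) x x + t • X) ?_ (by fun_prop)
  simpa using continuousAt_extChartAt_symm (I := 𝓘(ℝ, E)) x

/-- Only first derivatives at `0` are ever needed, so straight lines in a chart replace
one-parameter subgroups and no exponential map enters. -/
theorem hasDerivAt_extChartAt_comp_chartCurve {f : M → N} {x : M} {y : N}
    (hf : MDifferentiableAt 𝓘(ℝ, E) 𝓘(ℝ, F) f x) (hy : f x = y) (X : E) :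
    HasDerivAt (fun t => extChartAt 𝓘(ℝ, F) y (f (chartCurve x X t)))
      ((mfderiv 𝓘(ℝ, E) 𝓘(ℝ, F) f x : E →L[ℝ] F) X) 0 := by
  rw [mfderiv_eq_fderiv_extChartAt hf hy]
  subst hy
  have h1 : DifferentiableAt ℝ (extChartAt 𝓘(ℝ, F) (f x) ∘ f ∘ (extChartAt 𝓘(ℝ, E) x).symm)
      (extChartAt 𝓘(ℝ, E) x x) := by
    have := (mdifferentiableAt_iff f x).1 hf |>.2
    rwa [modelWithCornersSelf_coe, Set.range_id, differentiableWithinAt_univ] at this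
  have h2 : HasDerivAt (fun t : ℝ => extChartAt 𝓘(ℝ, E) x x + t • X) X 0 := by
    simpa using ((hasDerivAt_id (0 : ℝ)).smul_const X).const_add (extChartAt 𝓘(ℝ, E) x x)
  have h1' : HasFDerivAt (extChartAt 𝓘(ℝ, F) (f x) ∘ f ∘ (extChartAt 𝓘(ℝ, E) x).symm)
      (fderiv ℝ (extChartAt 𝓘(ℝ, F) (f x) ∘ f ∘ (extChartAt 𝓘(ℝ, E) x).symm)
        (extChartAt 𝓘(ℝ, E) x x)) (extChartAt 𝓘(ℝ, E) x x + (0 : ℝ) • X) := by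
    simpa using h1.hasFDerivAt
  exact h1'.comp_hasDerivAt 0 h2

/-- The derivative of a vector valued function along `chartCurve`. -/
theorem hasDerivAt_comp_chartCurve {f : M → F} {x : M}
    (hf : MDifferentiableAt 𝓘(ℝ, E) 𝓘(ℝ, F) f x) (X : E) :
    HasDerivAt (fun t => f (chartCurve x X t))
      ((mfderiv 𝓘(ℝ, E) 𝓘(ℝ, F) f x : E →L[ℝ] F) X) 0 := by
  have := hasDerivAt_extChartAt_comp_chartCurve hf rfl X
  rwa [extChartAt_model_space_eq_id] at this

end

section LieGroup

variable {E : Type*} [NormedAddCommGroup E] [NormedSpace ℝ E]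
  {G : Type*} [TopologicalSpace G] [ChartedSpace E G] [Group G]

variable (E) in
/-- The adjoint action of a Lie group, as a linear map of the model space. -/
noncomputable def adjointMap (g : G) : E →L[ℝ] E :=
  fderiv ℝ (chartConj (E := E) g) (extChartAt 𝓘(ℝ, E) (1 : G) 1)

variable (G) in
/-- The bracket of the Lie algebra of a Lie group, with values in the model space. -/
noncomputable def modelLie (X Y : GroupLieAlgebra 𝓘(ℝ, E) G) : E :=
  (⁅X, Y⁆ : GroupLieAlgebra 𝓘(ℝ, E) G)

theorem chartConj_self (g : G) :
    chartConj (E := E) g (extChartAt 𝓘(ℝ, E) (1 : G) 1) = extChartAt 𝓘(ℝ, E) (1 : G) 1 := by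
  simp [chartConj]

theorem chartMul_left (x : E) (hx : x ∈ (extChartAt 𝓘(ℝ, E) (1 : G)).target) :
    chartMul E G (extChartAt 𝓘(ℝ, E) (1 : G) 1, x) = x := by
  have := (extChartAt 𝓘(ℝ, E) (1 : G)).right_inv hx
  rw [chartMul, extChartAt_to_inv, one_mul, this]

theorem chartMul_right (x : E) (hx : x ∈ (extChartAt 𝓘(ℝ, E) (1 : G)).target) :
    chartMul E G (x, extChartAt 𝓘(ℝ, E) (1 : G) 1) = x := by
  have := (extChartAt 𝓘(ℝ, E) (1 : G)).right_inv hx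
  rw [chartMul, extChartAt_to_inv, mul_one, this]

variable [LieGroup 𝓘(ℝ, E) ∞ G]

theorem contMDiff_conj (g : G) :
    ContMDiff 𝓘(ℝ, E) 𝓘(ℝ, E) ∞ fun x : G => g * x * g⁻¹ :=
  (contMDiff_mul_right (I := 𝓘(ℝ, E)) (n := ∞) (a := g⁻¹)).comp
    (contMDiff_mul_left (I := 𝓘(ℝ, E)) (n := ∞) (a := g))

theorem differentiableAt_chartConj (g : G) :
    DifferentiableAt ℝ (chartConj (E := E) g) (extChartAt 𝓘(ℝ, E) (1 : G) 1) :=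
  (contDiffAt_extChartAt_comp (n := ∞) (contMDiff_conj (E := E) g).contMDiffAt
    (by simp : g * 1 * g⁻¹ = 1)).differentiableAt (by simp)

theorem Ad_eq_adjointMap (g : G) (Y : GroupLieAlgebra 𝓘(ℝ, E) G) :
    Ad (E := E) g Y = adjointMap E g Y :=
  DFunLike.congr_fun (mfderiv_eq_fderiv_extChartAt
    ((contMDiff_conj (E := E) g).contMDiffAt.mdifferentiableAt (by simp))
    (by simp : g * 1 * g⁻¹ = 1)) Y

/-- Conjugation fixes `1`, so by continuity it keeps a neighbourhood of `1` inside the chart domain,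
where the chart can be undone. -/
theorem eventually_symm_chartConj (g : G) :
    ∀ᶠ u in 𝓝 (extChartAt 𝓘(ℝ, E) (1 : G) 1),
      (extChartAt 𝓘(ℝ, E) (1 : G)).symm (chartConj (E := E) g u) =
        g * (extChartAt 𝓘(ℝ, E) (1 : G)).symm u * g⁻¹ := by
  have h1 : ContinuousAt (fun u : E => g * (extChartAt 𝓘(ℝ, E) (1 : G)).symm u * g⁻¹)
      (extChartAt 𝓘(ℝ, E) (1 : G) 1) :=
    ContinuousAt.comp (g := fun x : G => g * x * g⁻¹)
      (contMDiff_conj (E := E) g).continuous.continuousAt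
      (continuousAt_extChartAt_symm (I := 𝓘(ℝ, E)) (1 : G))
  have h2 : (extChartAt 𝓘(ℝ, E) (1 : G)).source ∈
      𝓝 (g * (extChartAt 𝓘(ℝ, E) (1 : G)).symm (extChartAt 𝓘(ℝ, E) (1 : G) 1) * g⁻¹) := by
    have : g * (extChartAt 𝓘(ℝ, E) (1 : G)).symm (extChartAt 𝓘(ℝ, E) (1 : G) 1) * g⁻¹ = 1 := by
      simp
    rw [this]
    exact extChartAt_source_mem_nhds (I := 𝓘(ℝ, E)) (1 : G)
  filter_upwards [h1.eventually h2] with u hu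
  exact (extChartAt 𝓘(ℝ, E) (1 : G)).left_inv hu

theorem adjointMap_mul (g h : G) (Y : E) :
    adjointMap E (g * h) Y = adjointMap E g (adjointMap E h Y) := by
  simp only [adjointMap]
  have h1 : chartConj (E := E) (g * h) =ᶠ[𝓝 (extChartAt 𝓘(ℝ, E) (1 : G) 1)]
      chartConj (E := E) g ∘ chartConj (E := E) h := by
    filter_upwards [eventually_symm_chartConj (E := E) h] with u hu
    simp only [Function.comp_apply]
    conv_rhs => rw [chartConj, hu]
    simp [chartConj, mul_assoc]
  rw [h1.fderiv_eq, fderiv_comp _ (by rw [chartConj_self]; exact differentiableAt_chartConj g)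
    (differentiableAt_chartConj h), chartConj_self]
  rfl

theorem contDiffAt_chartMul :
    ContDiffAt ℝ ∞ (chartMul E G) (extChartAt 𝓘(ℝ, E) (1 : G) 1, extChartAt 𝓘(ℝ, E) (1 : G) 1) := by
  have h0 : ContMDiffAt 𝓘(ℝ, E) 𝓘(ℝ, E) ∞ (extChartAt 𝓘(ℝ, E) (1 : G)).symm
      (extChartAt 𝓘(ℝ, E) (1 : G) 1) :=
    (contMDiffOn_extChartAt_symm (1 : G)).contMDiffAt (extChartAt_target_mem_nhds (1 : G))
  rw [← contMDiffAt_iff_contDiffAt]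
  have h1 : ContMDiffAt 𝓘(ℝ, E × E) 𝓘(ℝ, E) ∞
      (fun p : E × E => (extChartAt 𝓘(ℝ, E) (1 : G)).symm p.1)
      (extChartAt 𝓘(ℝ, E) (1 : G) 1, extChartAt 𝓘(ℝ, E) (1 : G) 1) :=
    ContMDiffAt.comp (I' := 𝓘(ℝ, E)) (g := (extChartAt 𝓘(ℝ, E) (1 : G)).symm) (f := Prod.fst) _ h0
      contDiffAt_fst.contMDiffAt
  have h2 : ContMDiffAt 𝓘(ℝ, E × E) 𝓘(ℝ, E) ∞
      (fun p : E × E => (extChartAt 𝓘(ℝ, E) (1 : G)).symm p.2)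
      (extChartAt 𝓘(ℝ, E) (1 : G) 1, extChartAt 𝓘(ℝ, E) (1 : G) 1) :=
    ContMDiffAt.comp (I' := 𝓘(ℝ, E)) (g := (extChartAt 𝓘(ℝ, E) (1 : G)).symm) (f := Prod.snd) _ h0
      contDiffAt_snd.contMDiffAt
  have h3 := h1.mul h2
  refine ContMDiffAt.comp (I' := 𝓘(ℝ, E)) (g := extChartAt 𝓘(ℝ, E) (1 : G)) _ ?_ h3
  simpa using contMDiffAt_extChartAt (I := 𝓘(ℝ, E)) (n := ∞) (x := (1 : G))

/-- The differential of the adjoint representation is the Lie bracket. -/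
theorem hasFDerivAt_adjointMap [CompleteSpace E] (Y : E) :
    ∃ A' : E →L[ℝ] E,
      HasFDerivAt (fun x : E => adjointMap E ((extChartAt 𝓘(ℝ, E) (1 : G)).symm x) Y) A'
        (extChartAt 𝓘(ℝ, E) (1 : G) 1) ∧
      adjointMap E (1 : G) Y = Y ∧ ∀ X : E, A' X = modelLie G X Y := by
  have htgt := extChartAt_target_mem_nhds (I := 𝓘(ℝ, E)) (1 : G)
  have hμ : ContDiffAt ℝ 2 (chartMul E G)
    (extChartAt 𝓘(ℝ, E) (1 : G) 1, extChartAt 𝓘(ℝ, E) (1 : G) 1) :=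
    contDiffAt_chartMul.of_le (ENat.LEInfty.out)
  have hd : ∀ᶠ p in 𝓝 (extChartAt 𝓘(ℝ, E) (1 : G) 1, extChartAt 𝓘(ℝ, E) (1 : G) 1),
      DifferentiableAt ℝ (chartMul E G) p := by
    filter_upwards [hμ.eventually (by simp)] with p hp using hp.differentiableAt (by simp)
  have htend : Tendsto (fun x : E => (extChartAt 𝓘(ℝ, E) (1 : G) 1, x))
    (𝓝 (extChartAt 𝓘(ℝ, E) (1 : G) 1)) (𝓝 (extChartAt 𝓘(ℝ, E) (1 : G) 1, extChartAt 𝓘(ℝ, E) (1 : G) 1)) :=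
    (Continuous.prodMk_right _).tendsto _
  obtain ⟨A', h1, h2, h3⟩ := hasFDerivAt_adjoint_of_product (μ := chartMul E G)
    (c := extChartAt 𝓘(ℝ, E) (1 : G) 1) (Y := Y)
    (A := fun x : E => adjointMap E ((extChartAt 𝓘(ℝ, E) (1 : G)).symm x) Y)
    hμ
    (by filter_upwards [htgt] with x hx using chartMul_left x hx)
    (by filter_upwards [htgt] with x hx using chartMul_right x hx) (by
      filter_upwards [htend.eventually hd, htgt] with x hx hxt
      set g : G := (extChartAt 𝓘(ℝ, E) (1 : G)).symm x with hg
      rw [adjointMap]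
      -- This is $gh=(ghg^{-1})g$ in the chart. Its derivative in $h$ at the neutral element is the
      -- hypothesis relating left and right translations.
      have e1 : (fun y => chartMul E G (x, y)) =ᶠ[𝓝 (extChartAt 𝓘(ℝ, E) (1 : G) 1)]
          (fun y => chartMul E G (y, x)) ∘ chartConj (E := E) g := by
        filter_upwards [eventually_symm_chartConj (E := E) g] with u hu
        simp only [Function.comp_apply, chartMul]
        rw [hu, ← hg]
        simp
      have hx' : DifferentiableAt ℝ (fun y => chartMul E G (y, x))
          (chartConj (E := E) g (extChartAt 𝓘(ℝ, E) (1 : G) 1)) := by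
        rw [chartConj_self]
        exact DifferentiableAt.comp (g := chartMul E G) (f := fun y : E => (y, x))
          (extChartAt 𝓘(ℝ, E) (1 : G) 1) hx (by fun_prop)
      rw [e1.fderiv_eq, fderiv_comp _ hx' (differentiableAt_chartConj g), chartConj_self]
      rfl)
  refine ⟨A', h1, ?_, fun X => (h3 X).trans (lie_eq_lieBracket_chartMul (G := G) X Y).symm⟩
  have : (extChartAt 𝓘(ℝ, E) (1 : G)).symm (extChartAt 𝓘(ℝ, E) (1 : G) 1) = 1 :=
    extChartAt_to_inv (1 : G)
  simp only [this] at h2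
  exact h2

/-- At `1` this follows from differentiability in the chart;
$\mathrm{Ad}(x)=\mathrm{Ad}(g)\,\mathrm{Ad}(g^{-1}x)$ carries it to every other point. -/
theorem continuous_adjointMap [CompleteSpace E] (Y : E) : Continuous fun g : G => adjointMap E g Y := by
  have htg : IsTopologicalGroup G := topologicalGroup_of_lieGroup 𝓘(ℝ, E) ∞
  have h1 : ∀ Y : E, ContinuousAt (fun g : G => adjointMap E g Y) 1 := by
    intro Y
    obtain ⟨A', hA', -⟩ := hasFDerivAt_adjointMap (G := G) Y
    have := ContinuousAt.comp (f := extChartAt 𝓘(ℝ, E) (1 : G)) (x := (1 : G)) hA'.continuousAt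
      (continuousAt_extChartAt (1 : G))
    refine this.congr ?_
    filter_upwards [extChartAt_source_mem_nhds (I := 𝓘(ℝ, E)) (1 : G)] with g hg
    simp only [Function.comp_apply]
    rw [(extChartAt 𝓘(ℝ, E) (1 : G)).left_inv hg]
  rw [continuous_iff_continuousAt]
  intro g
  have h2 : (fun x : G => adjointMap E x Y) = fun x : G =>
      adjointMap E g (adjointMap E (g⁻¹ * x) Y) := by
    ext x
    rw [← adjointMap_mul, mul_inv_cancel_left]
  rw [h2]
  refine (adjointMap E g).continuous.continuousAt.comp ?_
  refine ContinuousAt.comp (g := fun x : G => adjointMap E x Y) (f := fun x => g⁻¹ * x) ?_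
    (by fun_prop)
  rw [inv_mul_cancel]
  exact h1 Y

variable {F : Type*} [NormedAddCommGroup F] [NormedSpace ℝ F]
  {H : Type*} [TopologicalSpace H] [ChartedSpace F H] [Group H]

/-- The derivative of `Ad ∘ j` along a curve through the neutral element. -/
theorem hasDerivAt_adjointMap_comp_chartCurve [CompleteSpace E] (j : H →* G)
    (hj : MDifferentiableAt 𝓘(ℝ, F) 𝓘(ℝ, E) j 1) (X : F) (Y : E) :
    HasDerivAt (fun t => adjointMap E (j (chartCurve 1 X t)) Y)
      (modelLie G (homDifferential (E := E) (F := F) j X) Y) 0 := by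
  obtain ⟨A', hA', -, hA⟩ := hasFDerivAt_adjointMap (G := G) Y
  have h1 := hasDerivAt_extChartAt_comp_chartCurve hj (map_one j) X
  have h0 : extChartAt 𝓘(ℝ, E) (1 : G) (j (chartCurve 1 X 0)) = extChartAt 𝓘(ℝ, E) (1 : G) 1 := by
    rw [chartCurve_zero, map_one]
  have h2 := HasFDerivAt.comp_hasDerivAt_of_eq (0 : ℝ) hA' h1 h0.symm
  have h3 := h2.congr_of_eventuallyEq (f₁ := fun t => adjointMap E (j (chartCurve 1 X t)) Y) (by
    have hc : ContinuousAt (fun t => j (chartCurve 1 X t)) 0 :=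
      ContinuousAt.comp (g := j) (by rw [chartCurve_zero]; exact hj.continuousAt)
        (continuousAt_chartCurve (1 : H) X)
    have hs : (extChartAt 𝓘(ℝ, E) (1 : G)).source ∈ 𝓝 (j (chartCurve 1 X 0)) := by
      rw [chartCurve_zero, map_one]
      exact extChartAt_source_mem_nhds (1 : G)
    filter_upwards [hc.eventually hs] with t ht
    simp only [Function.comp_apply]
    rw [(extChartAt 𝓘(ℝ, E) (1 : G)).left_inv ht])
  have h4 := hA (homDifferential (E := E) (F := F) j X)
  rw [← h4]
  exact h3

end LieGroup

end

/-! ### Negative definiteness of the Killing form -/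

section

open Filter Topology SymmetricSpin

section

variable {V : Type*} [AddCommGroup V] [Module ℝ V] [FiniteDimensional ℝ V]

/-- The square of an endomorphism that is skew for an inner product has nonpositive trace, and
trace zero only if the endomorphism vanishes. -/
theorem trace_mul_self_neg_of_skew (Q : LinearMap.BilinForm ℝ V) (hsymm : ∀ x y, Q x y = Q y x)
    (hpos : ∀ x, x ≠ 0 → 0 < Q x x) (T : Module.End ℝ V) (hT : ∀ x y, Q (T x) y = -Q x (T y))
    (hT0 : T ≠ 0) : LinearMap.trace ℝ V (T * T) < 0 := by
  let core : InnerProductSpace.Core ℝ V :=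
    { inner := fun x y => Q x y
      conj_inner_symm := fun x y => by simpa using hsymm y x
      re_inner_nonneg := fun x => by
        by_cases hx : x = 0
        · simp [hx]
        · exact (hpos x hx).le
      add_left := fun x y z => by simp
      smul_left := fun x y r => by simp
      definite := fun x hx => by
        by_contra h
        exact (hpos x h).ne' hx }
  let : NormedAddCommGroup V := core.toNormedAddCommGroup
  let : InnerProductSpace ℝ V := InnerProductSpace.ofCore core.toCore
  have hin : ∀ x y : V, inner ℝ x y = Q x y := fun x y => rfl
  let b := stdOrthonormalBasis ℝ V
  -- For skew `T` the diagonal coefficient $\langle b_i,T^2b_i\rangle$ is $-|Tb_i|^2$.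
  have htr : LinearMap.trace ℝ V (T * T) = ∑ i, -Q (T (b i)) (T (b i)) := by
    rw [LinearMap.trace_eq_sum_inner (T * T) b]
    refine Finset.sum_congr rfl fun i _ => ?_
    rw [hin, Module.End.mul_apply, hT, neg_neg]
  rw [htr]
  have hle : ∀ i, -Q (T (b i)) (T (b i)) ≤ 0 := by
    intro i
    by_cases hx : T (b i) = 0
    · simp [hx]
    · exact neg_nonpos.2 (hpos _ hx).le
  obtain ⟨i, hi⟩ : ∃ i, T (b i) ≠ 0 := by
    by_contra! h
    exact hT0 (b.toBasis.ext fun i => by simpa using h i)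
  exact Finset.sum_neg' (fun i _ => hle i) ⟨i, Finset.mem_univ i, neg_neg_of_pos (hpos _ hi)⟩

end

/-- If a Lie algebra with trivial centre has an invariant inner product, then its Killing form is
negative definite. -/
theorem killingForm_neg_of_invariant {L : Type*} [LieRing L] [LieAlgebra ℝ L]
    [FiniteDimensional ℝ L] (hcenter : ∀ X : L, (∀ Y : L, ⁅X, Y⁆ = 0) → X = 0)
    (Q : LinearMap.BilinForm ℝ L) (hsymm : ∀ x y, Q x y = Q y x)
    (hpos : ∀ x, x ≠ 0 → 0 < Q x x) (hinv : ∀ X Y Z : L, Q ⁅X, Y⁆ Z = -Q Y ⁅X, Z⁆)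
    (X : L) (hX : X ≠ 0) : killingForm ℝ L X X < 0 := by
  rw [killingForm_apply_apply]
  refine trace_mul_self_neg_of_skew Q hsymm hpos (LieAlgebra.ad ℝ L X) (hinv X) fun h => hX ?_
  exact hcenter X fun Y => by simpa using DFunLike.congr_fun h Y

section LieGroup

variable {E : Type*} [NormedAddCommGroup E] [NormedSpace ℝ E] [FiniteDimensional ℝ E]
  {G : Type*} [TopologicalSpace G] [ChartedSpace E G] [Group G] [LieGroup 𝓘(ℝ, E) ∞ G]

/-- A compact Lie group has an inner product on its Lie algebra that is invariant under the
adjoint action. -/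
theorem exists_invariant_inner [T2Space G] [CompactSpace G] :
    ∃ Q : LinearMap.BilinForm ℝ E, (∀ x y, Q x y = Q y x) ∧ (∀ x, x ≠ 0 → 0 < Q x x) ∧
      ∀ (g : G) (x y : E), Q (adjointMap E g x) (adjointMap E g y) = Q x y := by
  have htg : IsTopologicalGroup G := topologicalGroup_of_lieGroup 𝓘(ℝ, E) ∞
  let : MeasurableSpace G := borel G
  have : BorelSpace G := ⟨rfl⟩
  let μ : MeasureTheory.Measure G := MeasureTheory.Measure.haar
  let e : E ≃L[ℝ] EuclideanSpace ℝ (Fin (Module.finrank ℝ E)) := toEuclidean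
  -- An arbitrary Euclidean inner product is averaged over Haar measure. With the inverse of `g`
  -- here, replacing `x, y` by their images under $\mathrm{Ad}(g_0)$ is a left translation by
  -- $g_0^{-1}$ of the integrand.
  let f : E → E → G → ℝ := fun x y g =>
    inner ℝ (e (adjointMap E g⁻¹ x)) (e (adjointMap E g⁻¹ y))
  have hcont : ∀ x y, Continuous (f x y) := fun x y =>
    ((e.continuous.comp ((continuous_adjointMap x).comp continuous_inv)).inner
      (e.continuous.comp ((continuous_adjointMap y).comp continuous_inv)))
  have hint : ∀ x y, MeasureTheory.Integrable (f x y) μ := fun x y =>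
    (hcont x y).integrable_of_hasCompactSupport (HasCompactSupport.of_compactSpace _)
  let Q : LinearMap.BilinForm ℝ E := LinearMap.mk₂ ℝ (fun x y => ∫ g, f x y g ∂μ)
    (fun x x' y => by
      rw [← MeasureTheory.integral_add (hint _ _) (hint _ _)]
      simp only [f, map_add, inner_add_left])
    (fun c x y => by
      rw [smul_eq_mul, ← MeasureTheory.integral_const_mul]
      simp only [f, map_smul, real_inner_smul_left])
    (fun x y y' => by
      rw [← MeasureTheory.integral_add (hint _ _) (hint _ _)]
      simp only [f, map_add, inner_add_right])
    (fun c x y => by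
      rw [smul_eq_mul, ← MeasureTheory.integral_const_mul]
      simp only [f, map_smul, real_inner_smul_right])
  have hQ : ∀ x y, Q x y = ∫ g, f x y g ∂μ := fun x y => rfl
  refine ⟨Q, fun x y => ?_, fun x hx => ?_, fun g x y => ?_⟩
  · simp only [hQ, f, real_inner_comm]
  · rw [hQ]
    refine (hcont x x).integral_pos_of_hasCompactSupport_nonneg_nonzero
      (HasCompactSupport.of_compactSpace _) (fun g => real_inner_self_nonneg) (x := 1) ?_
    have h1 : adjointMap E (1 : G)⁻¹ x = x := by
      rw [inv_one]
      obtain ⟨-, -, h, -⟩ := hasFDerivAt_adjointMap (G := G) x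
      exact h
    simp only [f, h1]
    simpa using hx
  · rw [hQ, hQ, ← MeasureTheory.integral_mul_left_eq_self (f x y) g⁻¹]
    refine MeasureTheory.integral_congr_ae (Filter.Eventually.of_forall fun h => ?_)
    simp only [f, mul_inv_rev, inv_inv, adjointMap_mul]

/-- The Killing form of a compact semisimple Lie group is negative definite. -/
theorem killingForm_groupLieAlgebra_neg [T2Space G] [CompactSpace G]
    [LieAlgebra.IsSemisimple ℝ (GroupLieAlgebra 𝓘(ℝ, E) G)]
    (X : GroupLieAlgebra 𝓘(ℝ, E) G) (hX : X ≠ 0) :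
    killingForm ℝ (GroupLieAlgebra 𝓘(ℝ, E) G) X X < 0 := by
  have : FiniteDimensional ℝ (GroupLieAlgebra 𝓘(ℝ, E) G) := inferInstanceAs (FiniteDimensional ℝ E)
  obtain ⟨Q, hsymm, hpos, hQ⟩ := exists_invariant_inner (E := E) (G := G)
  have hskew : ∀ X Y Z : E,
      Q (modelLie G X Y) Z = -Q Y (modelLie G X Z) := by
    intro X Y Z
    let B : E →L[ℝ] E →L[ℝ] ℝ :=
      LinearMap.toContinuousLinearMap ((LinearMap.toContinuousLinearMap (𝕜 := ℝ)).toLinearMap ∘ₗ Q)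
    have hB : ∀ x y, B x y = Q x y := fun x y => rfl
    have hid : MDifferentiableAt 𝓘(ℝ, E) 𝓘(ℝ, E) (MonoidHom.id G) 1 := mdifferentiableAt_id
    have hX : homDifferential (E := E) (F := E) (MonoidHom.id G) X = X :=
      DFunLike.congr_fun (mfderiv_id (I := 𝓘(ℝ, E)) (x := (1 : G))) X
    have hu := fun W => hasDerivAt_adjointMap_comp_chartCurve (MonoidHom.id G) hid X W
    have hd := (B.hasFDerivAt.comp_hasDerivAt 0 (hu Y)).clm_apply (hu Z)
    -- Invariance makes `Q` constant along the curve; the vanishing derivative at `0` is skewness of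
    -- the bracket.
    have hc : (fun t : ℝ => (B ∘ fun t : ℝ =>
        adjointMap E ((MonoidHom.id G) (chartCurve (E := E) 1 X t)) Y) t
        (adjointMap E ((MonoidHom.id G) (chartCurve (E := E) 1 X t)) Z)) = fun _ => Q Y Z := by
      ext t
      simp only [Function.comp_apply, hB, hQ]
    rw [hc] at hd
    have h0 := hd.unique (hasDerivAt_const (0 : ℝ) (Q Y Z))
    have h1 : ∀ W : E, adjointMap E ((MonoidHom.id G) (chartCurve (E := E) 1 X 0)) W = W := by
      intro W
      obtain ⟨-, -, h, -⟩ := hasFDerivAt_adjointMap (G := G) W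
      rwa [chartCurve_zero]
    simp only [Function.comp_apply, h1, hB, hX] at h0
    linarith
  refine killingForm_neg_of_invariant (L := GroupLieAlgebra 𝓘(ℝ, E) G) ?_ Q hsymm hpos hskew X hX
  intro X hX
  have hc : X ∈ LieAlgebra.center ℝ (GroupLieAlgebra 𝓘(ℝ, E) G) := by
    rw [LieModule.mem_maxTrivSubmodule]
    intro Y
    rw [← lie_skew, hX, neg_zero]
  rw [LieAlgebra.center_eq_bot] at hc
  simpa using hc

end LieGroup

end

/-! ### Clifford algebras: contractions, central elements, products of orthogonal bases -/

section

open CliffordAlgebra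

section Clifford

variable {M : Type*} [AddCommGroup M] [Module ℝ M]

instance finite_cliffordAlgebra [FiniteDimensional ℝ M] (Q : QuadraticForm ℝ M) :
    Module.Finite ℝ (CliffordAlgebra Q) :=
  have : Module.Finite ℝ (ExteriorAlgebra ℝ M) :=
    Module.Finite.of_basis (Module.finBasis ℝ M).ExteriorAlgebra
  Module.Finite.equiv (equivExterior Q).symm

/-- The Euler operator of the exterior algebra. -/
noncomputable def eulerOperator {n : ℕ} (b : Module.Basis (Fin n) ℝ M) :
    ExteriorAlgebra ℝ M →ₗ[ℝ] ExteriorAlgebra ℝ M :=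
  ∑ i, LinearMap.mulLeft ℝ (ExteriorAlgebra.ι ℝ (b i)) ∘ₗ
    contractLeft (Q := (0 : QuadraticForm ℝ M)) (b.coord i)

theorem eulerOperator_apply {n : ℕ} (b : Module.Basis (Fin n) ℝ M) (x : ExteriorAlgebra ℝ M) :
    eulerOperator b x = ∑ i, ExteriorAlgebra.ι ℝ (b i) *
      contractLeft (Q := (0 : QuadraticForm ℝ M)) (b.coord i) x := by
  simp [eulerOperator]

/-- Contraction is an antiderivation and vectors anticommute, so each summand yields a coordinate of
`v` times `x` and a copy of itself behind `v`. Hence multiplication by a vector raises the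
eigenvalue by one: the operator counts degree. -/
theorem eulerOperator_ι_mul {n : ℕ} (b : Module.Basis (Fin n) ℝ M) (v : M)
    (x : ExteriorAlgebra ℝ M) :
    eulerOperator b (ExteriorAlgebra.ι ℝ v * x) =
      ExteriorAlgebra.ι ℝ v * x + ExteriorAlgebra.ι ℝ v * eulerOperator b x := by
  have hanti : ∀ i, ExteriorAlgebra.ι ℝ (b i) * ExteriorAlgebra.ι ℝ v =
      -(ExteriorAlgebra.ι ℝ v * ExteriorAlgebra.ι ℝ (b i)) := fun i =>
    eq_neg_of_add_eq_zero_left (ExteriorAlgebra.ι_add_mul_swap _ _)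
  have hv : ∑ i, b.repr v i • ExteriorAlgebra.ι ℝ (b i) = ExteriorAlgebra.ι ℝ v := by
    conv_rhs => rw [← b.sum_repr v]
    simp only [map_sum, map_smul]
  simp only [eulerOperator_apply]
  rw [Finset.mul_sum]
  conv_rhs => rw [← hv]
  rw [Finset.sum_mul, hv, ← Finset.sum_add_distrib]
  refine Finset.sum_congr rfl fun i _ => ?_
  have h := contractLeft_ι_mul (Q := (0 : QuadraticForm ℝ M)) (b.coord i) v x
  rw [show ExteriorAlgebra.ι ℝ v = ι (0 : QuadraticForm ℝ M) v from rfl] at *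
  rw [h, mul_sub, ← mul_assoc, hanti]
  simp [mul_assoc]

theorem eulerOperator_of_mem {n : ℕ} (b : Module.Basis (Fin n) ℝ M) (k : ℕ)
    (x : ExteriorAlgebra ℝ M) (hx : x ∈ ⋀[ℝ]^k M) : eulerOperator b x = (k : ℝ) • x := by
  induction hx using Submodule.pow_induction_on_left' with
  | algebraMap r =>
    simp only [eulerOperator_apply]
    simp [show (algebraMap ℝ (ExteriorAlgebra ℝ M) r) =
      algebraMap ℝ (CliffordAlgebra (0 : QuadraticForm ℝ M)) r from rfl]
  | add x y i hx hy ihx ihy => simp [ihx, ihy]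
  | mem_mul m hm i x hx ih =>
    obtain ⟨v, rfl⟩ := hm
    rw [eulerOperator_ι_mul, ih]
    push_cast
    rw [add_smul, one_smul, mul_smul_comm, add_comm]

/-- An element of the exterior algebra killed by all contractions is a scalar. -/
theorem ExteriorAlgebra.eq_algebraMap_of_contractLeft_eq_zero [FiniteDimensional ℝ M]
    (x : ExteriorAlgebra ℝ M)
    (hx : ∀ d : Module.Dual ℝ M, contractLeft (Q := (0 : QuadraticForm ℝ M)) d x = 0) :
    ∃ r : ℝ, x = algebraMap ℝ _ r := by
  classical
  let b := Module.finBasis ℝ M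
  have hN : ∀ y : ExteriorAlgebra ℝ M, ∀ k : ℕ,
      ((DirectSum.decompose (fun n : ℕ => ⋀[ℝ]^n M) (eulerOperator b y)) k : ExteriorAlgebra ℝ M)
        = (k : ℝ) • ((DirectSum.decompose (fun n : ℕ => ⋀[ℝ]^n M) y) k : ExteriorAlgebra ℝ M) := by
    intro y k
    induction y using DirectSum.Decomposition.inductionOn (fun n : ℕ => ⋀[ℝ]^n M) with
    | zero => simp
    | @homogeneous i m =>
      rw [eulerOperator_of_mem b i m m.2, DirectSum.decompose_smul, DirectSum.smul_apply]
      by_cases h : i = k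
      · subst h; simp
      · have h2 := DirectSum.decompose_of_mem_ne (fun n : ℕ => ⋀[ℝ]^n M) m.2 h
        rw [Submodule.coe_smul, h2, smul_zero, smul_zero]
    | add y z hy hz => simp [hy, hz]
  have h0 : eulerOperator b x = 0 := by simp [eulerOperator_apply, hx]
  -- The Euler operator is built from contractions, so it kills `x`; yet it multiplies the degree
  -- `k` part by `k`, which is invertible for `k ≠ 0`.
  have hk : ∀ k : ℕ, k ≠ 0 →
      ((DirectSum.decompose (fun n : ℕ => ⋀[ℝ]^n M) x) k : ExteriorAlgebra ℝ M) = 0 := by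
    intro k hk
    have := hN x k
    rw [h0, DirectSum.decompose_zero] at this
    exact (smul_eq_zero.1 this.symm).resolve_left (by exact_mod_cast hk)
  have hx0 : x = ((DirectSum.decompose (fun n : ℕ => ⋀[ℝ]^n M) x) 0 : ExteriorAlgebra ℝ M) := by
    conv_lhs => rw [← DirectSum.sum_support_decompose (fun n : ℕ => ⋀[ℝ]^n M) x]
    refine Finset.sum_eq_single 0 (fun k _ h => hk k h) fun h => ?_
    simpa using h
  have hmem := ((DirectSum.decompose (fun n : ℕ => ⋀[ℝ]^n M) x) 0).2
  rw [← hx0] at hmem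
  have hmem' : x ∈ (1 : Submodule ℝ (ExteriorAlgebra ℝ M)) := by simpa [exteriorPower] using hmem
  obtain ⟨r, hr⟩ := Submodule.mem_one.1 hmem'
  exact ⟨r, hr.symm⟩

variable {Q : QuadraticForm ℝ M}

/-- An element of a Clifford algebra killed by all contractions is a scalar. -/
theorem CliffordAlgebra.eq_algebraMap_of_contractLeft_eq_zero [FiniteDimensional ℝ M]
    (x : CliffordAlgebra Q) (hx : ∀ d : Module.Dual ℝ M, contractLeft d x = 0) :
    ∃ r : ℝ, x = algebraMap ℝ _ r := by
  obtain ⟨r, hr⟩ := ExteriorAlgebra.eq_algebraMap_of_contractLeft_eq_zero (equivExterior Q x)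
    fun d => by
      -- The linear isomorphism with the exterior algebra commutes with contractions and fixes
      -- scalars, so the exterior case transfers.
      have := changeForm_contractLeft (changeForm.associated_neg_proof (Q := Q)) d x
      rw [hx, map_zero] at this
      exact this.symm
  refine ⟨r, (equivExterior Q).injective ?_⟩
  rw [hr]
  exact (changeForm_algebraMap (changeForm.associated_neg_proof (Q := Q)) r).symm

/-- Both sides vanish on scalars and obey the same twisted Leibniz rule, and on vectors the identity
is the Clifford relation. Thus a graded commutator with a vector is a contraction, which turns
centrality into the vanishing of contractions. -/
theorem CliffordAlgebra.ι_mul_sub_involute_mul_ι (v : M) (x : CliffordAlgebra Q) :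
    ι Q v * x - involute x * ι Q v = contractLeft (QuadraticMap.polarBilin Q v) x := by
  induction x using CliffordAlgebra.left_induction with
  | algebraMap r => simp [Algebra.commutes]
  | add x y hx hy =>
    rw [map_add, map_add, ← hx, ← hy]
    noncomm_ring
  | ι_mul y a hy =>
    rw [contractLeft_ι_mul, ← hy, map_mul, involute_ι]
    have h := ι_mul_ι_add_swap (Q := Q) v a
    have h2 : QuadraticMap.polarBilin Q v a • y = (ι Q v * ι Q a + ι Q a * ι Q v) * y := by
      rw [h, Algebra.smul_def]; rfl
    rw [h2]
    noncomm_ring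

/-- An even element of a nondegenerate Clifford algebra that commutes with all vectors is a
scalar. -/
theorem CliffordAlgebra.eq_algebraMap_of_commute [FiniteDimensional ℝ M]
    (hQ : ∀ d : Module.Dual ℝ M, ∃ v, QuadraticMap.polarBilin Q v = d)
    (x : CliffordAlgebra Q) (heven : involute x = x) (hx : ∀ v, ι Q v * x = x * ι Q v) :
    ∃ r : ℝ, x = algebraMap ℝ _ r := by
  refine CliffordAlgebra.eq_algebraMap_of_contractLeft_eq_zero x fun d => ?_
  obtain ⟨v, rfl⟩ := hQ d
  rw [← ι_mul_sub_involute_mul_ι, heven, hx, sub_self]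

theorem CliffordAlgebra.contractLeft_list_prod (d : Module.Dual ℝ M) (l : List M)
    (hl : ∀ v ∈ l, d v = 0) : contractLeft d (l.map (ι Q)).prod = 0 := by
  induction l with
  | nil => simp
  | cons v l ih =>
    rw [List.map_cons, List.prod_cons, contractLeft_ι_mul, hl v (by simp),
      ih fun w hw => hl w (by simp [hw])]
    simp

/-- Clifford and exterior multiplication by a vector differ by a contraction, which kills products
of vectors orthogonal to it. -/
theorem CliffordAlgebra.equivExterior_list_prod (l : List M)
    (hl : l.Pairwise fun v w => QuadraticMap.polar Q v w = 0) :
    equivExterior Q (l.map (ι Q)).prod = (l.map (ExteriorAlgebra.ι ℝ)).prod := by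
  induction l with
  | nil => exact changeForm_one (changeForm.associated_neg_proof (Q := Q))
  | cons v l ih =>
    rw [List.pairwise_cons] at hl
    have h := changeForm_ι_mul (changeForm.associated_neg_proof (Q := Q)) v (l.map (ι Q)).prod
    rw [List.map_cons, List.prod_cons, List.map_cons, List.prod_cons]
    refine h.trans ?_
    have ih' : changeForm (changeForm.associated_neg_proof (Q := Q)) (l.map (ι Q)).prod =
      (l.map (ι (0 : QuadraticForm ℝ M))).prod := ih hl.2
    rw [ih', contractLeft_list_prod _ l, sub_zero]
    intro w hw
    have := hl.1 w hw
    simp [QuadraticMap.associated_apply, QuadraticMap.polar] at this ⊢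
    linarith

/-- The product of the vectors of an orthogonal basis in the Clifford algebra changes by the
determinant. -/
theorem CliffordAlgebra.prod_ofFn_ι_eq_det_smul {n : ℕ} (e f : Module.Basis (Fin n) ℝ M)
    (he : ∀ i j, i ≠ j → QuadraticMap.polar Q (e i) (e j) = 0)
    (hf : ∀ i j, i ≠ j → QuadraticMap.polar Q (f i) (f j) = 0) :
    (List.ofFn fun i => ι Q (f i)).prod = e.det f • (List.ofFn fun i => ι Q (e i)).prod := by
  have key : ∀ g : Module.Basis (Fin n) ℝ M,
      (∀ i j, i ≠ j → QuadraticMap.polar Q (g i) (g j) = 0) →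
      equivExterior Q (List.ofFn fun i => ι Q (g i)).prod = ExteriorAlgebra.ιMulti ℝ n g := by
    intro g hg
    rw [ExteriorAlgebra.ιMulti_apply]
    have := equivExterior_list_prod (Q := Q) (List.ofFn g) (by
      rw [List.pairwise_ofFn]
      intro i j hij
      exact hg i j hij.ne)
    rw [List.map_ofFn, List.map_ofFn] at this
    exact this
  apply (equivExterior Q).injective
  rw [map_smul, key e he, key f hf]
  -- Composed with a linear functional, the exterior product is a scalar alternating form in top
  -- degree, hence a multiple of the determinant.
  refine sub_eq_zero.1 ((Module.forall_dual_apply_eq_zero_iff ℝ _).1 fun φ => ?_)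
  have := DFunLike.congr_fun (AlternatingMap.eq_smul_basis_det e
    (φ.compAlternatingMap (ExteriorAlgebra.ιMulti ℝ n))) (f : Fin n → M)
  rw [map_sub, map_smul, sub_eq_zero]
  simpa [mul_comm] using this

end Clifford

end

/-! ### Irreducible modules over the Clifford relations -/

section

section Fock

variable {S : Type*} [AddCommGroup S] [Module ℂ S]

/-- Eigenvectors of an operator that is diagonal in a basis. -/
theorem Module.Basis.apply_eq_smul_iff_of_diagonal {ι : Type*} (s : Module.Basis ι ℂ S)
    {D : Module.End ℂ S} {c : ι → ℂ} (hD : ∀ i, D (s i) = c i • s i) (x : S) (d : ℂ) :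
    D x = d • x ↔ ∀ i, s.repr x i ≠ 0 → c i = d := by
  have h : ∀ i, s.repr (D x) i = c i * s.repr x i := by
    intro i
    have h1 : (Finsupp.lapply i ∘ₗ s.repr.toLinearMap ∘ₗ D) =
        c i • (Finsupp.lapply i ∘ₗ s.repr.toLinearMap) := by
      refine s.ext fun j => ?_
      by_cases hij : j = i
      · subst hij; simp [hD]
      · simp [hD, hij]
    simpa using DFunLike.congr_fun h1 x
  constructor
  · intro hx i hi
    have := h i
    rw [hx, map_smul] at this
    simpa using mul_right_cancel₀ hi this.symm
  · intro hx
    refine s.repr.injective (Finsupp.ext fun i => ?_)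
    rw [h, map_smul, Finsupp.smul_apply, smul_eq_mul]
    by_cases hi : s.repr x i = 0
    · simp [hi]
    · rw [hx i hi]

/-- The dimension of a simultaneous eigenspace of a family that is diagonal in a basis. -/
theorem Module.Basis.finrank_of_simultaneous_eigenspace {ι T : Type*} [Finite ι]
    (s : Module.Basis ι ℂ S)
    {D : T → Module.End ℂ S} {c : ι → T → ℂ} (hD : ∀ t i, D t (s i) = c i t • s i)
    (μ : T → ℂ) (W : Submodule ℂ S) (hW : ∀ x, x ∈ W ↔ ∀ t, D t x = μ t • x) :
    Module.finrank ℂ W = Set.ncard {i | c i = μ} := by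
  have hspan : W = Submodule.span ℂ (Set.range fun i : {i | c i = μ} => s i) := by
    ext x
    rw [hW]
    have hr : (Set.range fun i : {i | c i = μ} => s i) = s '' {i | c i = μ} := by
      ext y; simp
    rw [hr, s.mem_span_image]
    simp only [s.apply_eq_smul_iff_of_diagonal (hD _)]
    constructor
    · intro h i hi
      exact funext fun t => h t i (by simpa using hi)
    · intro h t i hi
      exact congrFun (h (by simpa using hi) : c i = μ) t
  have := Fintype.ofFinite {i | c i = μ}
  have hli : LinearIndependent ℂ fun i : {i | c i = μ} => s i :=
    s.linearIndependent.comp _ Subtype.val_injective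
  rw [hspan, finrank_span_eq_card hli, ← Nat.card_eq_fintype_card, Nat.card_coe_set_eq]

variable {m : ℕ}

/-- The relations satisfied by the Clifford multiplications with the two halves of an orthonormal
basis of an even dimensional space. -/
structure IsCliffordFamily (a b : Fin m → Module.End ℂ S) : Prop where
  sq_left : ∀ k, a k * a k = -1
  sq_right : ∀ k, b k * b k = -1
  anti_left : ∀ k l, k ≠ l → a k * a l = -(a l * a k)
  anti_right : ∀ k l, k ≠ l → b k * b l = -(b l * b k)
  anti : ∀ k l, a k * b l = -(b l * a k)

namespace IsCliffordFamily

variable {a b : Fin m → Module.End ℂ S}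

/-- The operators `i a_k b_k`. -/
noncomputable def sign (a b : Fin m → Module.End ℂ S) (k : Fin m) : Module.End ℂ S :=
  Complex.I • (a k * b k)

theorem sign_mul_self (h : IsCliffordFamily a b) (k : Fin m) : sign a b k * sign a b k = 1 := by
  have h1 : a k * b k * (a k * b k) = -1 := by
    calc a k * b k * (a k * b k) = a k * (b k * a k) * b k := by noncomm_ring
      _ = -((a k * a k) * (b k * b k)) := by
        rw [← neg_eq_iff_eq_neg.2 (h.anti k k)]; noncomm_ring
      _ = -1 := by rw [h.sq_left, h.sq_right]; noncomm_ring
  rw [sign, smul_mul_smul_comm, h1, Complex.I_mul_I]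
  simp

/-- Together with `mul_sign_of_ne` this says that `a k` maps a joint eigenvector to one whose `k`-th
sign alone is reversed. -/
theorem mul_sign_self (h : IsCliffordFamily a b) (k : Fin m) :
    a k * sign a b k = -(sign a b k * a k) := by
  rw [sign, mul_smul_comm, smul_mul_assoc, mul_assoc (a k) (b k) (a k),
    ← neg_eq_iff_eq_neg.2 (h.anti k k)]
  simp

theorem mul_sign_of_ne (h : IsCliffordFamily a b) {k l : Fin m} (hkl : k ≠ l) :
    a k * sign a b l = sign a b l * a k := by
  rw [sign, mul_smul_comm, smul_mul_assoc, mul_assoc (a l) (b l) (a k),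
    ← neg_eq_iff_eq_neg.2 (h.anti k l), ← mul_assoc, h.anti_left k l hkl]
  congr 1
  noncomm_ring

theorem mul_sign_right_self (h : IsCliffordFamily a b) (k : Fin m) :
    b k * sign a b k = -(sign a b k * b k) := by
  rw [sign, mul_smul_comm, smul_mul_assoc, ← mul_assoc,
    ← neg_eq_iff_eq_neg.2 (h.anti k k)]
  simp

theorem mul_sign_right_of_ne (h : IsCliffordFamily a b) {k l : Fin m} (hkl : k ≠ l) :
    b k * sign a b l = sign a b l * b k := by
  rw [sign, mul_smul_comm, smul_mul_assoc, ← mul_assoc,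
    ← neg_eq_iff_eq_neg.2 (h.anti l k), mul_assoc, h.anti_right l k hkl.symm]
  congr 1
  noncomm_ring

theorem commute_sign (h : IsCliffordFamily a b) (k l : Fin m) :
    Commute (sign a b k) (sign a b l) := by
  by_cases hkl : k = l
  · rw [hkl]
  · have h1 : Commute (a k) (sign a b l) := h.mul_sign_of_ne hkl
    have h2 : Commute (b k) (sign a b l) := h.mul_sign_right_of_ne hkl
    exact (h1.mul_left h2).smul_left _

/-- For an involution `J` and `s ≠ 0`, either `s + J s` is a nonzero `+1` eigenvector or `J s = -s`.
Commutation preserves the eigenvalues already arranged, so one involution can be treated at a time,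
with no finiteness of `S`. -/
theorem exists_joint_eigenvector [Nontrivial S] (h : IsCliffordFamily a b) :
    ∃ (ε : Fin m → ℤˣ) (s : S), s ≠ 0 ∧ ∀ k, sign a b k s = ((ε k : ℤ) : ℂ) • s := by
  suffices H : ∀ K : Finset (Fin m), ∃ (ε : Fin m → ℤˣ) (s : S), s ≠ 0 ∧
      ∀ k ∈ K, sign a b k s = ((ε k : ℤ) : ℂ) • s by
    obtain ⟨ε, s, hs, hk⟩ := H Finset.univ
    exact ⟨ε, s, hs, fun k => hk k (Finset.mem_univ k)⟩
  intro K
  induction K using Finset.induction_on with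
  | empty =>
    obtain ⟨s, hs⟩ := exists_ne (0 : S)
    exact ⟨1, s, hs, by simp⟩
  | insert l K hl ih =>
    obtain ⟨ε, s, hs, hk⟩ := ih
    have hJJ : sign a b l (sign a b l s) = s := by
      have := DFunLike.congr_fun (h.sign_mul_self l) s
      simpa using this
    by_cases h0 : s + sign a b l s = 0
    · refine ⟨Function.update ε l (-1), s, hs, fun k hkK => ?_⟩
      by_cases hkl : k = l
      · subst hkl
        simp only [Function.update_self, Units.val_neg, Units.val_one, Int.cast_neg, Int.cast_one,
          neg_smul, one_smul]
        exact eq_neg_of_add_eq_zero_right h0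
      · rw [Function.update_of_ne hkl]
        exact hk k ((Finset.mem_insert.1 hkK).resolve_left hkl)
    · refine ⟨Function.update ε l 1, s + sign a b l s, h0, fun k hkK => ?_⟩
      by_cases hkl : k = l
      · subst hkl
        simp [hJJ, add_comm]
      · rw [Function.update_of_ne hkl]
        have hc := DFunLike.congr_fun (h.commute_sign k l).eq s
        have hks := hk k ((Finset.mem_insert.1 hkK).resolve_left hkl)
        simp only [Module.End.mul_apply] at hc
        rw [map_add, hc, hks, map_smul, smul_add]

/-- From one joint eigenvector with signs `ε₀`, the vector for `ε` arises by applying `a l` at every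
place `l` where `ε` and `ε₀` differ. In the induction `K` is the set of places where a difference is
allowed; values of `v` at other sign vectors are irrelevant. -/
theorem exists_flip_family [Nontrivial S] (h : IsCliffordFamily a b) :
    ∃ v : (Fin m → ℤˣ) → S, (∀ ε, v ε ≠ 0) ∧
      (∀ ε k, sign a b k (v ε) = ((ε k : ℤ) : ℂ) • v ε) ∧
      ∀ ε k, ∃ c : ℂ, a k (v ε) = c • v (Function.update ε k (-ε k)) := by
  obtain ⟨ε₀, s₀, hs₀, hk₀⟩ := h.exists_joint_eigenvector
  suffices H : ∀ K : Finset (Fin m), ∃ v : (Fin m → ℤˣ) → S,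
      ∀ ε : Fin m → ℤˣ, (∀ k ∉ K, ε k = ε₀ k) → v ε ≠ 0 ∧
      (∀ k, sign a b k (v ε) = ((ε k : ℤ) : ℂ) • v ε) ∧
      ∀ k ∈ K, ∃ c : ℂ, a k (v ε) = c • v (Function.update ε k (-ε k)) by
    obtain ⟨v, hv⟩ := H Finset.univ
    exact ⟨v, fun ε => (hv ε (by simp)).1, fun ε => (hv ε (by simp)).2.1,
      fun ε k => (hv ε (by simp)).2.2 k (Finset.mem_univ k)⟩
  intro K
  induction K using Finset.induction_on with
  | empty =>
    refine ⟨fun _ => s₀, fun ε hε => ⟨hs₀, fun k => ?_, by simp⟩⟩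
    rw [hε k (by simp)]
    exact hk₀ k
  | insert l K hl ih =>
    obtain ⟨v, hv⟩ := ih
    have hsq : ∀ k x, a k (a k x) = -x := fun k x => by
      simpa using DFunLike.congr_fun (h.sq_left k) x
    have hunit : ∀ u w : ℤˣ, u ≠ w → u = -w := by decide
    -- the vector attached to a sign vector that differs from the reference one at `l`
    let w : (Fin m → ℤˣ) → S := fun ε =>
      if ε l = ε₀ l then v ε else a l (v (Function.update ε l (ε₀ l)))
    have hw : ∀ ε, ε l = ε₀ l → w ε = v ε := fun ε h => if_pos h
    have hw' : ∀ ε, ε l ≠ ε₀ l → w ε = a l (v (Function.update ε l (ε₀ l))) :=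
      fun ε h => if_neg h
    refine ⟨w, fun ε hε => ?_⟩
    by_cases hεl : ε l = ε₀ l
    · have hεK : ∀ k ∉ K, ε k = ε₀ k := by
        intro k hk
        by_cases hkl : k = l
        · rw [hkl, hεl]
        · exact hε k (by simp [hkl, hk])
      obtain ⟨h1, h2, h3⟩ := hv ε hεK
      rw [hw ε hεl]
      refine ⟨h1, h2, fun k hk => ?_⟩
      by_cases hkl : k = l
      · subst hkl
        -- Flipping `k` away from `ε₀` is the definition of `w`, so the constant is `1`.
        refine ⟨1, ?_⟩
        rw [hw' _ (by rw [Function.update_self, hεl]; exact neg_units_ne_self _)]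
        rw [one_smul, Function.update_idem, ← hεl, Function.update_eq_self]
      · obtain ⟨c, hc⟩ := h3 k ((Finset.mem_insert.1 hk).resolve_left hkl)
        refine ⟨c, ?_⟩
        rw [hc, hw _ (by rw [Function.update_of_ne (Ne.symm hkl), hεl])]
    · set ε' := Function.update ε l (ε₀ l) with hε'
      have hε'K : ∀ k ∉ K, ε' k = ε₀ k := by
        intro k hk
        by_cases hkl : k = l
        · rw [hkl, hε', Function.update_self]
        · rw [hε', Function.update_of_ne hkl]
          exact hε k (by simp [hkl, hk])
      obtain ⟨h1, h2, h3⟩ := hv ε' hε'K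
      rw [hw' ε hεl]
      have hε'l : ε' l = ε₀ l := by rw [hε', Function.update_self]
      have hneg : ε l = -ε₀ l := hunit _ _ hεl
      refine ⟨fun h0 => h1 ?_, fun k => ?_, fun k hk => ?_⟩
      · have := hsq l (v ε')
        rw [h0, map_zero] at this
        exact neg_eq_zero.1 this.symm
      · by_cases hkl : k = l
        · subst hkl
          have := DFunLike.congr_fun (h.mul_sign_self k) (v ε')
          simp only [Module.End.mul_apply, LinearMap.neg_apply] at this
          rw [← neg_eq_iff_eq_neg.2 this, h2, hε'l, hneg, map_smul]
          simp [hε']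
        · have := DFunLike.congr_fun (h.mul_sign_of_ne (Ne.symm hkl)) (v ε')
          simp only [Module.End.mul_apply] at this
          rw [← this, h2, map_smul, hε', Function.update_of_ne hkl]
      · by_cases hkl : k = l
        · subst hkl
          -- Flipping back applies `a k` twice, and its square is `-1`.
          refine ⟨-1, ?_⟩
          have he : Function.update ε k (-ε k) = ε' := by rw [hε', hneg, neg_neg]
          rw [hsq, he, hw _ hε'l]
          simp [hε']
        · obtain ⟨c, hc⟩ := h3 k ((Finset.mem_insert.1 hk).resolve_left hkl)
          -- The sign comes from moving `a k` past `a l`.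
          refine ⟨-c, ?_⟩
          have := DFunLike.congr_fun (h.anti_left k l hkl) (v ε')
          simp only [Module.End.mul_apply, LinearMap.neg_apply] at this
          rw [this, hc, hw' _ (by rwa [Function.update_of_ne (Ne.symm hkl)]), map_smul,
            Function.update_comm hkl, neg_smul, hε', Function.update_of_ne hkl]

/-- An irreducible representation of the Clifford relations has a basis of joint eigenvectors
indexed by all sign vectors. -/
theorem exists_basis [Nontrivial S] (h : IsCliffordFamily a b)
    (hirr : ∀ W : Submodule ℂ S, (∀ k, ∀ w ∈ W, a k w ∈ W ∧ b k w ∈ W) → W = ⊥ ∨ W = ⊤) :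
    ∃ s : Module.Basis (Fin m → ℤˣ) ℂ S,
      ∀ ε k, sign a b k (s ε) = ((ε k : ℤ) : ℂ) • s ε := by
  obtain ⟨v, hv0, hv, hflip⟩ := h.exists_flip_family
  have hind : LinearIndependent ℂ v := by
    -- Distinct sign vectors are distinct joint eigenvalues of commuting operators, whence linear
    -- independence.
    have h1 : iSupIndep fun χ : Fin m → ℂ => ⨅ k, (sign a b k).maxGenEigenspace (χ k) :=
      Module.End.independent_iInf_maxGenEigenspace_of_forall_mapsTo (sign a b) fun i j φ =>
        Module.End.mapsTo_maxGenEigenspace_of_comm (h.commute_sign j i) φ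
    have hinj : Function.Injective fun (ε : Fin m → ℤˣ) (k : Fin m) => ((ε k : ℤ) : ℂ) := by
      intro ε ε' hε
      ext k
      have := congrFun hε k
      simpa using this
    refine (h1.comp hinj).linearIndependent _ (fun ε => ?_) hv0
    simp only [Function.comp_apply, Submodule.mem_iInf]
    intro k
    exact Module.End.mem_maxGenEigenspace _ _ _ |>.2 ⟨1, by simp [hv ε k]⟩
  have hspan : Submodule.span ℂ (Set.range v) = ⊤ := by
    have ha : ∀ k, ∀ w ∈ Submodule.span ℂ (Set.range v), a k w ∈ Submodule.span ℂ (Set.range v) := by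
      intro k w hw
      induction hw using Submodule.span_induction with
      | mem x hx =>
        obtain ⟨ε, rfl⟩ := hx
        obtain ⟨c, hc⟩ := hflip ε k
        rw [hc]
        exact Submodule.smul_mem _ _ (Submodule.subset_span ⟨_, rfl⟩)
      | zero => simp
      | add x y _ _ hx hy => rw [map_add]; exact Submodule.add_mem _ hx hy
      | smul c x _ hx => rw [map_smul]; exact Submodule.smul_mem _ _ hx
    have hJ : ∀ k, ∀ w ∈ Submodule.span ℂ (Set.range v),
        sign a b k w ∈ Submodule.span ℂ (Set.range v) := by
      intro k w hw
      induction hw using Submodule.span_induction with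
      | mem x hx =>
        obtain ⟨ε, rfl⟩ := hx
        rw [hv]
        exact Submodule.smul_mem _ _ (Submodule.subset_span ⟨_, rfl⟩)
      | zero => simp
      | add x y _ _ hx hy => rw [map_add]; exact Submodule.add_mem _ hx hy
      | smul c x _ hx => rw [map_smul]; exact Submodule.smul_mem _ _ hx
    -- `b k` is recovered from `a k` and the `k`-th involution, so the span is invariant under the
    -- whole family and irreducibility makes it everything.
    have hb : ∀ k, b k = Complex.I • (a k * sign a b k) := by
      intro k
      rw [sign, mul_smul_comm, ← mul_assoc, h.sq_left, smul_smul, Complex.I_mul_I]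
      simp
    refine (hirr _ fun k w hw => ⟨ha k w hw, ?_⟩).resolve_left fun hbot => ?_
    · rw [hb k]
      exact Submodule.smul_mem _ _ (ha k _ (hJ k w hw))
    · rw [Submodule.span_eq_bot] at hbot
      exact hv0 1 (hbot _ ⟨1, rfl⟩)
  exact ⟨Module.Basis.mk hind hspan.ge, fun ε k => by
    rw [Module.Basis.mk_apply]; exact hv ε k⟩

end IsCliffordFamily

end Fock

end

/-! ### Complexification of the Lie algebra and the Cartan subalgebra -/

section

open SymmetricSpin

section Complexification

variable {L : Type*} [AddCommGroup L] [Module ℝ L]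

/-- The real part of an element of the complexification. -/
noncomputable def reT : ℂ ⊗[ℝ] L →ₗ[ℝ] L :=
  (TensorProduct.lid ℝ L).toLinearMap ∘ₗ Complex.reLm.rTensor L

/-- The imaginary part of an element of the complexification. -/
noncomputable def imT : ℂ ⊗[ℝ] L →ₗ[ℝ] L :=
  (TensorProduct.lid ℝ L).toLinearMap ∘ₗ Complex.imLm.rTensor L

@[simp] theorem reT_tmul (z : ℂ) (u : L) : reT (z ⊗ₜ[ℝ] u) = z.re • u := by simp [reT]
@[simp] theorem imT_tmul (z : ℂ) (u : L) : imT (z ⊗ₜ[ℝ] u) = z.im • u := by simp [imT]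

/-- The element `u + i v` of the complexification. -/
noncomputable def mkT (u v : L) : ℂ ⊗[ℝ] L := (1 : ℂ) ⊗ₜ[ℝ] u + Complex.I ⊗ₜ[ℝ] v

@[simp] theorem reT_mkT (u v : L) : reT (mkT u v) = u := by simp [mkT]
@[simp] theorem imT_mkT (u v : L) : imT (mkT u v) = v := by simp [mkT]

theorem mkT_reT_imT (x : ℂ ⊗[ℝ] L) : mkT (reT x) (imT x) = x := by
  induction x using TensorProduct.induction_on with
  | zero => simp [mkT]
  | tmul z u =>
    rw [mkT, reT_tmul, imT_tmul, ← TensorProduct.smul_tmul, ← TensorProduct.smul_tmul,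
      ← TensorProduct.add_tmul]
    congr 1
    conv_rhs => rw [← Complex.re_add_im z]
    simp
  | add x y hx hy =>
    conv_rhs => rw [← hx, ← hy]
    simp only [mkT, map_add, TensorProduct.tmul_add]
    abel

theorem ext_reT_imT {x y : ℂ ⊗[ℝ] L} (h1 : reT x = reT y) (h2 : imT x = imT y) : x = y := by
  rw [← mkT_reT_imT x, ← mkT_reT_imT y, h1, h2]

@[simp] theorem reT_smul_complex (z : ℂ) (x : ℂ ⊗[ℝ] L) :
    reT (z • x) = z.re • reT x - z.im • imT x := by
  induction x using TensorProduct.induction_on with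
  | zero => simp
  | tmul w u => simp [TensorProduct.smul_tmul', sub_smul, mul_smul]
  | add x y hx hy => simp only [smul_add, map_add, hx, hy]; abel

@[simp] theorem imT_smul_complex (z : ℂ) (x : ℂ ⊗[ℝ] L) :
    imT (z • x) = z.re • imT x + z.im • reT x := by
  induction x using TensorProduct.induction_on with
  | zero => simp
  | tmul w u => simp [TensorProduct.smul_tmul', add_smul, mul_smul]
  | add x y hx hy => simp only [smul_add, map_add, hx, hy]; abel

/-- The complexification of a real subspace, described by real and imaginary parts. -/
noncomputable def complexSubmodule (U : Submodule ℝ L) : Submodule ℂ (ℂ ⊗[ℝ] L) where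
  carrier := {x | reT x ∈ U ∧ imT x ∈ U}
  add_mem' {x y} hx hy := by
    simp only [Set.mem_ofPred_eq, map_add]
    exact ⟨U.add_mem hx.1 hy.1, U.add_mem hx.2 hy.2⟩
  zero_mem' := by simp
  smul_mem' c x hx := by
    simp only [Set.mem_ofPred_eq, reT_smul_complex, imT_smul_complex]
    exact ⟨U.sub_mem (U.smul_mem _ hx.1) (U.smul_mem _ hx.2),
      U.add_mem (U.smul_mem _ hx.2) (U.smul_mem _ hx.1)⟩

theorem mem_complexSubmodule {U : Submodule ℝ L} {x : ℂ ⊗[ℝ] L} :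
    x ∈ complexSubmodule U ↔ reT x ∈ U ∧ imT x ∈ U := Iff.rfl

theorem baseChange_eq_complexSubmodule (U : Submodule ℝ L) :
    U.baseChange ℂ = complexSubmodule U := by
  apply le_antisymm
  · rw [Submodule.baseChange_eq_span, Submodule.span_le]
    rintro _ ⟨u, hu, rfl⟩
    rw [SetLike.mem_coe, mem_complexSubmodule]
    simpa using hu
  · intro x hx
    rw [← mkT_reT_imT x]
    exact Submodule.add_mem _ (Submodule.tmul_mem_baseChange_of_mem _ hx.1)
      (Submodule.tmul_mem_baseChange_of_mem _ hx.2)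

end Complexification

section Lie

variable {L : Type*} [LieRing L] [LieAlgebra ℝ L]

theorem reT_lie (x y : ℂ ⊗[ℝ] L) : reT ⁅x, y⁆ = ⁅reT x, reT y⁆ - ⁅imT x, imT y⁆ := by
  rw [← mkT_reT_imT x, ← mkT_reT_imT y]
  simp only [mkT, lie_add, add_lie, LieAlgebra.ExtendScalars.bracket_tmul, map_add, reT_tmul,
    imT_tmul]
  simp [sub_eq_add_neg]

theorem imT_lie (x y : ℂ ⊗[ℝ] L) : imT ⁅x, y⁆ = ⁅reT x, imT y⁆ + ⁅imT x, reT y⁆ := by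
  rw [← mkT_reT_imT x, ← mkT_reT_imT y]
  simp [mkT, add_comm]

theorem mem_rootSpace_iff {𝔱 : LieSubalgebra ℝ L} {α : 𝔱 →ₗ[ℝ] ℂ} {x : ℂ ⊗[ℝ] L} :
    x ∈ SymmetricSpin.rootSpace 𝔱 α ↔ ∀ X : 𝔱, ⁅(1 : ℂ) ⊗ₜ[ℝ] (X : L), x⁆ = α X • x := by
  simp [SymmetricSpin.rootSpace, Submodule.mem_iInf]

theorem mem_rootSpace_iff_re_im {𝔱 : LieSubalgebra ℝ L} {α : 𝔱 →ₗ[ℝ] ℂ} {x : ℂ ⊗[ℝ] L} :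
    x ∈ SymmetricSpin.rootSpace 𝔱 α ↔ ∀ X : 𝔱,
      ⁅(X : L), reT x⁆ = (α X).re • reT x - (α X).im • imT x ∧
      ⁅(X : L), imT x⁆ = (α X).re • imT x + (α X).im • reT x := by
  rw [mem_rootSpace_iff]
  refine forall_congr' fun X => ⟨fun h => ?_, fun h => ext_reT_imT ?_ ?_⟩
  · have h1 := congrArg reT h
    have h2 := congrArg imT h
    rw [reT_lie, reT_smul_complex] at h1
    rw [imT_lie, imT_smul_complex] at h2
    simp only [reT_tmul, imT_tmul, Complex.one_re, Complex.one_im, one_smul, zero_smul, zero_lie,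
      sub_zero, add_zero] at h1 h2
    exact ⟨h1, h2⟩
  · rw [reT_lie, reT_smul_complex]; simpa using h.1
  · rw [imT_lie, imT_smul_complex]; simpa using h.2

/-- Adjoining a centralizing element to `𝔱` gives an abelian subalgebra, which maximality forces
back into `𝔱`. -/
theorem mem_of_isMaximalAbelian {𝔱 : LieSubalgebra ℝ L} (h𝔱 : IsMaximalAbelian 𝔱) {u : L}
    (hu : ∀ X ∈ 𝔱, ⁅X, u⁆ = 0) : u ∈ 𝔱 := by
  have hab : ∀ x ∈ 𝔱, ∀ y ∈ 𝔱, ⁅x, y⁆ = 0 := fun x hx y hy => by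
    have := h𝔱.prop
    have h0 : ⁅(⟨x, hx⟩ : 𝔱), (⟨y, hy⟩ : 𝔱)⁆ = 0 := trivial_lie_zero _ _ _ _
    exact congrArg Subtype.val h0
  have hcomm : ∀ x ∈ 𝔱.toSubmodule ⊔ Submodule.span ℝ {u},
      ∀ y ∈ 𝔱.toSubmodule ⊔ Submodule.span ℝ {u}, ⁅x, y⁆ = 0 := by
    intro x hx y hy
    obtain ⟨a, ha, b, hb, rfl⟩ := Submodule.mem_sup.1 hx
    obtain ⟨c, hc, d, hd, rfl⟩ := Submodule.mem_sup.1 hy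
    obtain ⟨r, rfl⟩ := Submodule.mem_span_singleton.1 hb
    obtain ⟨s, rfl⟩ := Submodule.mem_span_singleton.1 hd
    have h1 : ⁅u, c⁆ = 0 := by rw [← lie_skew, hu c hc, neg_zero]
    simp [hab a ha c hc, hu a ha, h1]
  let 𝔞 : LieSubalgebra ℝ L :=
    { 𝔱.toSubmodule ⊔ Submodule.span ℝ {u} with
      lie_mem' := fun {x y} hx hy => by
        have h0 := hcomm x hx y hy
        change ⁅x, y⁆ ∈ 𝔱.toSubmodule ⊔ Submodule.span ℝ {u}
        rw [h0]
        exact Submodule.zero_mem _ }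
  have h𝔞 : IsLieAbelian 𝔞 :=
    ⟨fun x y => Subtype.ext (hcomm x x.2 y y.2)⟩
  have hle : 𝔱 ≤ 𝔞 := fun x hx =>
    Submodule.mem_sup_left (T := Submodule.span ℝ {u}) (S := 𝔱.toSubmodule) hx
  exact h𝔱.le_of_ge h𝔞 hle
    (Submodule.mem_sup_right (T := Submodule.span ℝ {u}) (S := 𝔱.toSubmodule)
      (Submodule.mem_span_singleton_self u))

theorem lie_eq_zero_of_isMaximalAbelian {𝔱 : LieSubalgebra ℝ L} (h𝔱 : IsMaximalAbelian 𝔱) {x y : L}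
    (hx : x ∈ 𝔱) (hy : y ∈ 𝔱) : ⁅x, y⁆ = 0 := by
  have := h𝔱.prop
  have h0 : ⁅(⟨x, hx⟩ : 𝔱), (⟨y, hy⟩ : 𝔱)⁆ = 0 := trivial_lie_zero _ _ _ _
  exact congrArg Subtype.val h0

/-- The complexification of a subalgebra. -/
noncomputable def complexTorus (𝔱 : LieSubalgebra ℝ L) :
    LieSubalgebra ℂ (ℂ ⊗[ℝ] L) :=
  { complexSubmodule 𝔱.toSubmodule with
    lie_mem' := fun {x y} hx hy => by
      change reT ⁅x, y⁆ ∈ 𝔱 ∧ imT ⁅x, y⁆ ∈ 𝔱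
      exact ⟨by rw [reT_lie]; exact 𝔱.sub_mem (𝔱.lie_mem hx.1 hy.1) (𝔱.lie_mem hx.2 hy.2),
        by rw [imT_lie]; exact 𝔱.add_mem (𝔱.lie_mem hx.1 hy.2) (𝔱.lie_mem hx.2 hy.1)⟩ }

theorem mem_complexTorus {𝔱 : LieSubalgebra ℝ L} {x : ℂ ⊗[ℝ] L} :
    x ∈ complexTorus 𝔱 ↔ reT x ∈ 𝔱 ∧ imT x ∈ 𝔱 := Iff.rfl

theorem isLieAbelian_complexTorus {𝔱 : LieSubalgebra ℝ L} (h𝔱 : IsMaximalAbelian 𝔱) :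
    IsLieAbelian (complexTorus 𝔱) := by
  refine ⟨fun x y => Subtype.ext (ext_reT_imT ?_ ?_)⟩
  · have := reT_lie (x : ℂ ⊗[ℝ] L) y
    rw [lie_eq_zero_of_isMaximalAbelian h𝔱 x.2.1 y.2.1,
      lie_eq_zero_of_isMaximalAbelian h𝔱 x.2.2 y.2.2] at this
    simpa using this
  · have := imT_lie (x : ℂ ⊗[ℝ] L) y
    rw [lie_eq_zero_of_isMaximalAbelian h𝔱 x.2.1 y.2.2,
      lie_eq_zero_of_isMaximalAbelian h𝔱 x.2.2 y.2.1] at this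
    simpa using this

theorem killingForm_lie_skew (X u v : L) :
    killingForm ℝ L ⁅X, u⁆ v = -killingForm ℝ L u ⁅X, v⁆ := by
  rw [← lie_skew X u, map_neg, LinearMap.neg_apply]
  congr 1
  exact LieModule.traceForm_apply_lie_apply ℝ L L u X v

theorem killingForm_symm (u v : L) : killingForm ℝ L u v = killingForm ℝ L v u :=
  LieModule.traceForm_comm ℝ L L u v

/-- $\operatorname{ad}X$ is skew for a definite form: $B([X,u],[X,u])=-B(u,[X,[X,u]])=0$. -/
theorem lie_eq_zero_of_lie_lie_eq_zero (hneg : ∀ X : L, X ≠ 0 → killingForm ℝ L X X < 0) {X u : L}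
    (h : ⁅X, ⁅X, u⁆⁆ = 0) : ⁅X, u⁆ = 0 := by
  by_contra h0
  have h1 := hneg _ h0
  rw [killingForm_lie_skew, h, map_zero, neg_zero] at h1
  exact lt_irrefl _ h1

/-- If `u` normalizes `𝔱`, then $[X,[X,u]]=0$ for `X` in `𝔱`, so `u` centralizes `𝔱` and lies in it.
For a complex element this is applied to its real and imaginary parts. -/
theorem isCartanSubalgebra_complexTorus (hneg : ∀ X : L, X ≠ 0 → killingForm ℝ L X X < 0)
    {𝔱 : LieSubalgebra ℝ L} (h𝔱 : IsMaximalAbelian 𝔱) :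
    (complexTorus 𝔱).IsCartanSubalgebra where
  nilpotent := by
    have := isLieAbelian_complexTorus h𝔱
    infer_instance
  self_normalizing := by
    refine le_antisymm (fun x hx => ?_) (LieSubalgebra.le_normalizer _)
    rw [LieSubalgebra.mem_normalizer_iff] at hx
    have key : ∀ X ∈ 𝔱, ⁅reT x, X⁆ ∈ 𝔱 ∧ ⁅imT x, X⁆ ∈ 𝔱 := by
      intro X hX
      have h := hx ((1 : ℂ) ⊗ₜ[ℝ] X) (by rw [mem_complexTorus]; simpa using hX)
      rw [mem_complexTorus, reT_lie, imT_lie] at h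
      simpa using h
    have hc : ∀ u : L, (∀ X ∈ 𝔱, ⁅u, X⁆ ∈ 𝔱) → u ∈ 𝔱 := by
      intro u hu
      refine mem_of_isMaximalAbelian h𝔱 fun X hX => lie_eq_zero_of_lie_lie_eq_zero hneg ?_
      rw [← lie_skew X u, lie_neg, lie_eq_zero_of_isMaximalAbelian h𝔱 hX (hu X hX), neg_zero]
    exact ⟨hc _ fun X hX => (key X hX).1, hc _ fun X hX => (key X hX).2⟩

/-- The Killing form commutes with extension of scalars. Pairing a radical element with real vectors
puts its real and imaginary parts in the radical of a definite form. -/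
theorem isKilling_complexification [FiniteDimensional ℝ L]
    (hneg : ∀ X : L, X ≠ 0 → killingForm ℝ L X X < 0) :
    LieAlgebra.IsKilling ℂ (ℂ ⊗[ℝ] L) where
  killingCompl_top_eq_bot := by
    rw [eq_bot_iff]
    intro x hx
    rw [LieIdeal.mem_killingCompl] at hx
    have hB : ∀ u v : L, killingForm ℂ (ℂ ⊗[ℝ] L) ((1 : ℂ) ⊗ₜ[ℝ] u) ((1 : ℂ) ⊗ₜ[ℝ] v) =
        (killingForm ℝ L u v : ℂ) := by
      intro u v
      have h := LieModule.traceForm_baseChange ℝ L L ℂ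
      have h2 := DFunLike.congr_fun (DFunLike.congr_fun h ((1 : ℂ) ⊗ₜ[ℝ] u)) ((1 : ℂ) ⊗ₜ[ℝ] v)
      rw [killingForm]
      refine h2.trans ?_
      simp
    have hx2 : ∀ w : L, (killingForm ℝ L w (reT x) : ℂ) +
        Complex.I * (killingForm ℝ L w (imT x) : ℂ) = 0 := by
      intro w
      have h := hx ((1 : ℂ) ⊗ₜ[ℝ] w) (LieSubmodule.mem_top _)
      rw [← mkT_reT_imT x, mkT, map_add, hB,
        show Complex.I ⊗ₜ[ℝ] imT x = Complex.I • ((1 : ℂ) ⊗ₜ[ℝ] imT x) by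
          rw [TensorProduct.smul_tmul', smul_eq_mul, mul_one], map_smul, hB] at h
      exact h
    have hz : ∀ w : L, killingForm ℝ L w (reT x) = 0 ∧ killingForm ℝ L w (imT x) = 0 := by
      intro w
      have h := hx2 w
      rw [Complex.ext_iff] at h
      simpa using h
    have h0 : ∀ u : L, killingForm ℝ L u u = 0 → u = 0 := fun u hu => by
      by_contra h
      exact (hneg u h).ne hu
    rw [LieSubmodule.mem_bot]
    exact ext_reT_imT (by rw [map_zero]; exact h0 _ (hz _).1)
      (by rw [map_zero]; exact h0 _ (hz _).2)

end Lie

end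

/-! ### Roots and root spaces relative to the real torus -/

section

open SymmetricSpin

section Roots

variable {L : Type*} [LieRing L] [LieAlgebra ℝ L] {𝔱 : LieSubalgebra ℝ L}

/-- The complex linear extension of a functional on `𝔱`, as a function on the complexification. -/
noncomputable def extendFunctional (β : 𝔱 →ₗ[ℝ] ℂ) (h : complexTorus 𝔱) : ℂ :=
  β ⟨reT (h : ℂ ⊗[ℝ] L), h.2.1⟩ + Complex.I * β ⟨imT (h : ℂ ⊗[ℝ] L), h.2.2⟩

/-- The inclusion of a subalgebra into its complexification. -/
noncomputable def toComplexTorus (X : 𝔱) : complexTorus 𝔱 :=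
  ⟨(1 : ℂ) ⊗ₜ[ℝ] (X : L), by rw [mem_complexTorus]; simp⟩

theorem extendFunctional_toComplexTorus (β : 𝔱 →ₗ[ℝ] ℂ) (X : 𝔱) :
    extendFunctional β (toComplexTorus X) = β X := by
  have h1 : (⟨reT ((toComplexTorus X : complexTorus 𝔱) : ℂ ⊗[ℝ] L), (toComplexTorus X).2.1⟩ : 𝔱) = X :=
    Subtype.ext (by simp [toComplexTorus])
  have h2 : (⟨imT ((toComplexTorus X : complexTorus 𝔱) : ℂ ⊗[ℝ] L), (toComplexTorus X).2.2⟩ : 𝔱) = 0 :=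
    Subtype.ext (by simp [toComplexTorus])
  rw [extendFunctional, h1, h2, map_zero, mul_zero, add_zero]

theorem lie_of_mem_rootSpace {β : 𝔱 →ₗ[ℝ] ℂ} {x : ℂ ⊗[ℝ] L}
    (hx : x ∈ SymmetricSpin.rootSpace 𝔱 β) (h : complexTorus 𝔱) :
    ⁅(h : ℂ ⊗[ℝ] L), x⁆ = extendFunctional β h • x := by
  rw [mem_rootSpace_iff] at hx
  have h1 : (h : ℂ ⊗[ℝ] L) = (1 : ℂ) ⊗ₜ[ℝ] (reT (h : ℂ ⊗[ℝ] L)) +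
      Complex.I • ((1 : ℂ) ⊗ₜ[ℝ] (imT (h : ℂ ⊗[ℝ] L))) := by
    conv_lhs => rw [← mkT_reT_imT (h : ℂ ⊗[ℝ] L), mkT]
    rw [TensorProduct.smul_tmul', smul_eq_mul, mul_one]
  have h2 : ⁅Complex.I • ((1 : ℂ) ⊗ₜ[ℝ] (imT (h : ℂ ⊗[ℝ] L))), x⁆ =
      Complex.I • ⁅(1 : ℂ) ⊗ₜ[ℝ] (imT (h : ℂ ⊗[ℝ] L)), x⁆ :=
    ext_reT_imT (by simp [reT_lie, imT_lie]) (by simp [reT_lie, imT_lie])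
  conv_lhs => rw [h1]
  rw [add_lie, h2, hx ⟨_, h.2.1⟩, hx ⟨_, h.2.2⟩, smul_smul, ← add_smul, extendFunctional]

theorem rootSpace_zero_le (h𝔱 : IsMaximalAbelian 𝔱) {x : ℂ ⊗[ℝ] L}
    (hx : x ∈ SymmetricSpin.rootSpace 𝔱 0) : reT x ∈ 𝔱 ∧ imT x ∈ 𝔱 := by
  rw [mem_rootSpace_iff_re_im] at hx
  exact ⟨mem_of_isMaximalAbelian h𝔱 fun X hX => by simpa using (hx ⟨X, hX⟩).1,
    mem_of_isMaximalAbelian h𝔱 fun X hX => by simpa using (hx ⟨X, hX⟩).2⟩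

/-- Roots of an algebra with negative definite Killing form are imaginary. -/
theorem re_eq_zero_of_rootSpace_ne_bot (hneg : ∀ X : L, X ≠ 0 → killingForm ℝ L X X < 0)
    {β : 𝔱 →ₗ[ℝ] ℂ} (hβ : SymmetricSpin.rootSpace 𝔱 β ≠ ⊥) (X : 𝔱) : (β X).re = 0 := by
  obtain ⟨x, hx, hx0⟩ := Submodule.exists_mem_ne_zero_of_ne_bot hβ
  obtain ⟨h1, h2⟩ := mem_rootSpace_iff_re_im.1 hx X
  have hskew : ∀ u : L, killingForm ℝ L ⁅(X : L), u⁆ u = 0 := by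
    intro u
    have := killingForm_lie_skew (X : L) u u
    rw [killingForm_symm u] at this
    linarith
  have e1 := hskew (reT x)
  have e2 := hskew (imT x)
  rw [h1] at e1
  rw [h2] at e2
  simp only [map_sub, map_add, map_smul, LinearMap.sub_apply, LinearMap.add_apply,
    LinearMap.smul_apply, smul_eq_mul] at e1 e2
  rw [killingForm_symm (imT x) (reT x)] at e1
  -- Skewness gives one relation for the real part of `x` and one for the imaginary part; adding
  -- them cancels the mixed terms and isolates the real part of `β X`.
  have hsum : (β X).re * (killingForm ℝ L (reT x) (reT x) + killingForm ℝ L (imT x) (imT x)) = 0 := by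
    linarith
  refine (mul_eq_zero.1 hsum).resolve_right ?_
  have hle : ∀ u : L, killingForm ℝ L u u ≤ 0 := fun u => by
    by_cases hu : u = 0
    · simp [hu]
    · exact (hneg u hu).le
  have hne : reT x ≠ 0 ∨ imT x ≠ 0 := by
    by_contra! h
    exact hx0 (ext_reT_imT (by simpa using h.1) (by simpa using h.2))
  rcases hne with h | h
  · have := hneg _ h; have := hle (imT x); linarith
  · have := hneg _ h; have := hle (reT x); linarith

/-- Complex conjugation exchanges the root spaces of opposite roots. -/
theorem conj_mem_rootSpace_neg (hneg : ∀ X : L, X ≠ 0 → killingForm ℝ L X X < 0)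
    {β : 𝔱 →ₗ[ℝ] ℂ} {x : ℂ ⊗[ℝ] L} (hx : x ∈ SymmetricSpin.rootSpace 𝔱 β) :
    mkT (reT x) (-imT x) ∈ SymmetricSpin.rootSpace 𝔱 (-β) := by
  -- Conjugation sends the eigenvalue to its complex conjugate, which is its negative because a
  -- functional with nonzero root space is imaginary.
  by_cases hβ : SymmetricSpin.rootSpace 𝔱 β = ⊥
  · rw [hβ, Submodule.mem_bot] at hx
    simp [hx, mkT]
  · rw [mem_rootSpace_iff_re_im] at hx ⊢
    intro X
    obtain ⟨h1, h2⟩ := hx X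
    have h0 := re_eq_zero_of_rootSpace_ne_bot hneg hβ X
    rw [reT_mkT, imT_mkT, lie_neg, h1, h2, LinearMap.neg_apply]
    simp [h0]

variable [FiniteDimensional ℝ L]

/-- The right side is a generalized weight space. The two agree because a Cartan subalgebra of a Lie
algebra with nondegenerate Killing form acts semisimply. -/
theorem rootSpace_eq_lieAlgebra_rootSpace (hneg : ∀ X : L, X ≠ 0 → killingForm ℝ L X X < 0)
    [(complexTorus 𝔱).IsCartanSubalgebra] (β : 𝔱 →ₗ[ℝ] ℂ) :
    SymmetricSpin.rootSpace 𝔱 β =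
      (LieAlgebra.rootSpace (complexTorus 𝔱) (extendFunctional β)).toSubmodule := by
  have := isKilling_complexification hneg
  ext x
  constructor
  · intro hx
    have : x ∈ LieModule.weightSpace (ℂ ⊗[ℝ] L) (extendFunctional β : complexTorus 𝔱 → ℂ) := by
      rw [LieModule.mem_weightSpace]
      exact fun h => lie_of_mem_rootSpace hx h
    exact LieModule.weightSpace_le_genWeightSpace _ _ this
  · intro hx
    rw [mem_rootSpace_iff]
    intro X
    have := LieAlgebra.IsKilling.lie_eq_smul_of_mem_rootSpace hx (toComplexTorus X)
    rw [extendFunctional_toComplexTorus] at this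
    exact this

/-- Root spaces are one dimensional. -/
theorem finrank_rootSpace_eq_one (hneg : ∀ X : L, X ≠ 0 → killingForm ℝ L X X < 0)
    (h𝔱 : IsMaximalAbelian 𝔱) {β : 𝔱 →ₗ[ℝ] ℂ} (hβ : β ∈ SymmetricSpin.roots 𝔱) :
    Module.finrank ℂ (SymmetricSpin.rootSpace 𝔱 β) = 1 := by
  have := isKilling_complexification hneg
  have := isCartanSubalgebra_complexTorus hneg h𝔱
  have hbot : LieModule.genWeightSpace (ℂ ⊗[ℝ] L) (extendFunctional β : complexTorus 𝔱 → ℂ) ≠ ⊥ := by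
    intro h
    apply hβ.2
    rw [rootSpace_eq_lieAlgebra_rootSpace hneg β]
    simpa using h
  let χ : LieModule.Weight ℂ (complexTorus 𝔱) (ℂ ⊗[ℝ] L) := ⟨extendFunctional β, hbot⟩
  have hχ : χ.IsNonZero := by
    intro h
    apply hβ.1
    ext X
    have h1 : extendFunctional β (toComplexTorus X) = 0 := congrFun h (toComplexTorus X)
    rwa [extendFunctional_toComplexTorus] at h1
  rw [rootSpace_eq_lieAlgebra_rootSpace hneg β]
  exact LieAlgebra.IsKilling.finrank_rootSpace_eq_one χ hχ

/-- Over `ℂ` the generalized weight spaces of the Cartan subalgebra fill the algebra, and each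
weight restricts to a real linear functional on `𝔱` with the corresponding eigenspace. -/
theorem iSup_rootSpace_eq_top (hneg : ∀ X : L, X ≠ 0 → killingForm ℝ L X X < 0)
    (h𝔱 : IsMaximalAbelian 𝔱) :
    ⨆ β : 𝔱 →ₗ[ℝ] ℂ, SymmetricSpin.rootSpace 𝔱 β = ⊤ := by
  have := isKilling_complexification hneg
  have := isCartanSubalgebra_complexTorus hneg h𝔱
  have htop := LieModule.iSup_genWeightSpace_eq_top' ℂ (complexTorus 𝔱) (ℂ ⊗[ℝ] L)
  have htop2 : (⨆ χ : LieModule.Weight ℂ (complexTorus 𝔱) (ℂ ⊗[ℝ] L),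
      (LieModule.genWeightSpace (ℂ ⊗[ℝ] L) χ).toSubmodule) = ⊤ := by
    rw [← LieSubmodule.iSup_toSubmodule, htop, LieSubmodule.top_toSubmodule]
  rw [eq_top_iff, ← htop2]
  refine iSup_le fun χ => ?_
  let β : 𝔱 →ₗ[ℝ] ℂ :=
    { toFun := fun X => χ (toComplexTorus X)
      map_add' := fun X Y => by
        have h1 : toComplexTorus (X + Y) = toComplexTorus X + toComplexTorus Y :=
          Subtype.ext (by simp [toComplexTorus, TensorProduct.tmul_add])
        rw [h1]
        exact map_add (LieModule.Weight.toLinear ℂ (complexTorus 𝔱) (ℂ ⊗[ℝ] L) χ) _ _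
      map_smul' := fun c X => by
        have h1 : toComplexTorus (c • X) = (c : ℂ) • toComplexTorus X :=
          Subtype.ext (by simp [toComplexTorus, TensorProduct.smul_tmul'])
        rw [h1]
        exact (map_smul (LieModule.Weight.toLinear ℂ (complexTorus 𝔱) (ℂ ⊗[ℝ] L) χ) _ _).trans
          (by simp) }
  refine le_trans ?_ (le_iSup _ β)
  intro x hx
  rw [mem_rootSpace_iff]
  intro X
  exact LieAlgebra.IsKilling.lie_eq_smul_of_mem_rootSpace (α := χ) hx (toComplexTorus X)

end Roots

end

/-! ### Root vectors as orthonormal pairs, and a basis of `𝔭` -/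

section

open SymmetricSpin

theorem fin_two_mul_cases {m : ℕ} (j : Fin (2 * m)) :
    ∃ k : Fin m, j = ⟨2 * k, by omega⟩ ∨ j = ⟨2 * k + 1, by omega⟩ := by
  refine ⟨⟨j / 2, by omega⟩, ?_⟩
  rcases Nat.mod_two_eq_zero_or_one j with h | h
  · left; ext; simp only; omega
  · right; ext; simp only; omega

section RootPairs

variable {L : Type*} [LieRing L] [LieAlgebra ℝ L] {𝔱 : LieSubalgebra ℝ L}

/-- The real form of the eigenvector equation: `β` being imaginary, `X` acts on the pair `u, v` as
an infinitesimal rotation. -/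
theorem lie_of_mkT_mem_rootSpace (hneg : ∀ X : L, X ≠ 0 → killingForm ℝ L X X < 0)
    {β : 𝔱 →ₗ[ℝ] ℂ} (hβ : β ∈ SymmetricSpin.roots 𝔱) {u v : L}
    (h : mkT u v ∈ SymmetricSpin.rootSpace 𝔱 β) (X : 𝔱) :
    ⁅(X : L), u⁆ = -((β X).im • v) ∧ ⁅(X : L), v⁆ = (β X).im • u := by
  have h0 := re_eq_zero_of_rootSpace_ne_bot hneg hβ.2 X
  have h1 := mem_rootSpace_iff_re_im.1 h X
  rw [reT_mkT, imT_mkT, h0] at h1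
  simpa using h1

theorem exists_im_ne_zero (hneg : ∀ X : L, X ≠ 0 → killingForm ℝ L X X < 0)
    {β : 𝔱 →ₗ[ℝ] ℂ} (hβ : β ∈ SymmetricSpin.roots 𝔱) : ∃ X, (β X).im ≠ 0 := by
  by_contra! h
  exact hβ.1 (LinearMap.ext fun X =>
    Complex.ext (re_eq_zero_of_rootSpace_ne_bot hneg hβ.2 X) (h X))

/-- For some `X` the rotation speed is nonzero, and a nonzero infinitesimal rotation that is skew
for `B` forces equal lengths and orthogonality. -/
theorem killingForm_root_pair (hneg : ∀ X : L, X ≠ 0 → killingForm ℝ L X X < 0)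
    {β : 𝔱 →ₗ[ℝ] ℂ} (hβ : β ∈ SymmetricSpin.roots 𝔱) {u v : L}
    (h : mkT u v ∈ SymmetricSpin.rootSpace 𝔱 β) :
    killingForm ℝ L u u = killingForm ℝ L v v ∧ killingForm ℝ L u v = 0 := by
  obtain ⟨X, hX⟩ := exists_im_ne_zero hneg hβ
  obtain ⟨h1, h2⟩ := lie_of_mkT_mem_rootSpace hneg hβ h X
  have e1 := killingForm_lie_skew (X : L) v u
  have e2 := killingForm_lie_skew (X : L) v v
  rw [h1, h2] at e1
  rw [h2, killingForm_symm v] at e2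
  simp only [map_smul, map_neg, LinearMap.smul_apply, smul_eq_mul] at e1 e2
  constructor
  · exact mul_left_cancel₀ hX (by linarith)
  · exact (mul_eq_zero.1 (show (β X).im * killingForm ℝ L u v = 0 by linarith)).resolve_left hX

/-- $(\operatorname{ad}X)^2$ is symmetric for the Killing form, so eigenvectors with different
eigenvalues are orthogonal. An `X` separating the squares exists because the product of two nonzero
linear forms is not identically zero. -/
theorem killingForm_eq_zero_of_ne {w w' : L} (a a' : 𝔱 →ₗ[ℝ] ℝ)
    (hw : ∀ X : 𝔱, ⁅(X : L), ⁅(X : L), w⁆⁆ = -((a X) ^ 2 • w))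
    (hw' : ∀ X : 𝔱, ⁅(X : L), ⁅(X : L), w'⁆⁆ = -((a' X) ^ 2 • w'))
    (h1 : a ≠ a') (h2 : a ≠ -a') : killingForm ℝ L w w' = 0 := by
  obtain ⟨X, hX⟩ : ∃ X, (a X) ^ 2 ≠ (a' X) ^ 2 := by
    obtain ⟨X, hX⟩ : ∃ X, a X - a' X ≠ 0 := by
      by_contra! h
      exact h1 (LinearMap.ext fun X => sub_eq_zero.1 (h X))
    obtain ⟨Y, hY⟩ : ∃ Y, a Y + a' Y ≠ 0 := by
      by_contra! h
      exact h2 (LinearMap.ext fun X => eq_neg_of_add_eq_zero_left (h X))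
    by_contra! h
    have h' : ∀ Z, (a Z - a' Z) * (a Z + a' Z) = 0 := fun Z => by linear_combination h Z
    have hX' := (mul_eq_zero.1 (h' X)).resolve_left hX
    have hY' := (mul_eq_zero.1 (h' Y)).resolve_right hY
    have := h' (X + Y)
    rw [map_add, map_add] at this
    rcases mul_eq_zero.1 this with h3 | h3
    · exact hX (by linarith)
    · exact hY (by linarith)
  have e1 := killingForm_lie_skew (X : L) ⁅(X : L), w⁆ w'
  have e2 := killingForm_lie_skew (X : L) w ⁅(X : L), w'⁆
  rw [hw] at e1
  rw [hw'] at e2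
  simp only [map_smul, map_neg, LinearMap.smul_apply, LinearMap.neg_apply, smul_eq_mul] at e1 e2
  have : ((a X) ^ 2 - (a' X) ^ 2) * killingForm ℝ L w w' = 0 := by linarith
  exact (mul_eq_zero.1 this).resolve_left (sub_ne_zero.2 hX)

/-- Vectors that are the real and imaginary parts of root vectors are orthogonal. -/
theorem killingForm_eq_zero_of_rootVectors (hneg : ∀ X : L, X ≠ 0 → killingForm ℝ L X X < 0)
    {m : ℕ} {α : Fin m → (𝔱 →ₗ[ℝ] ℂ)} (hroot : ∀ k, α k ∈ SymmetricSpin.roots 𝔱)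
    (hinj : Function.Injective α) (hopp : ∀ k l, α k ≠ -α l) {f : Fin (2 * m) → L}
    (hf : ∀ k : Fin m, mkT (f ⟨2 * k, by omega⟩) (f ⟨2 * k + 1, by omega⟩) ∈
      SymmetricSpin.rootSpace 𝔱 (α k)) {i j : Fin (2 * m)} (hij : i ≠ j) :
    killingForm ℝ L (f i) (f j) = 0 := by
  have hsq : ∀ k : Fin m, ∀ X : 𝔱,
      ⁅(X : L), ⁅(X : L), f ⟨2 * k, by omega⟩⁆⁆ =
        -(((Complex.imLm ∘ₗ α k) X) ^ 2 • f ⟨2 * k, by omega⟩) ∧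
      ⁅(X : L), ⁅(X : L), f ⟨2 * k + 1, by omega⟩⁆⁆ =
        -(((Complex.imLm ∘ₗ α k) X) ^ 2 • f ⟨2 * k + 1, by omega⟩) := by
    intro k X
    obtain ⟨h1, h2⟩ := lie_of_mkT_mem_rootSpace hneg (hroot k) (hf k) X
    constructor
    · rw [h1, lie_neg, lie_smul, h2, smul_smul]; simp [pow_two]
    · rw [h2, lie_smul, h1, smul_neg, smul_smul]; simp [pow_two]
  have him : ∀ k l : Fin m, k ≠ l →
      (Complex.imLm ∘ₗ α k ≠ Complex.imLm ∘ₗ α l) ∧ (Complex.imLm ∘ₗ α k ≠ -(Complex.imLm ∘ₗ α l)) := by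
    intro k l hkl
    have hre := fun k => re_eq_zero_of_rootSpace_ne_bot hneg (hroot k).2
    constructor
    · intro h
      exact hkl (hinj (LinearMap.ext fun X => Complex.ext (by rw [hre, hre])
        (DFunLike.congr_fun h X)))
    · intro h
      refine hopp k l (LinearMap.ext fun X => Complex.ext ?_ (DFunLike.congr_fun h X))
      rw [LinearMap.neg_apply, Complex.neg_re, hre, hre, neg_zero]
  obtain ⟨k, hk⟩ := fin_two_mul_cases i
  obtain ⟨l, hl⟩ := fin_two_mul_cases j
  by_cases hkl : k = l
  · subst hkl
    have hp := (killingForm_root_pair hneg (hroot k) (hf k)).2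
    rcases hk with rfl | rfl <;> rcases hl with rfl | rfl
    · exact absurd rfl hij
    · exact hp
    · rw [killingForm_symm]; exact hp
    · exact absurd rfl hij
  · obtain ⟨h1, h2⟩ := him k l hkl
    rcases hk with rfl | rfl <;> rcases hl with rfl | rfl
    · exact killingForm_eq_zero_of_ne _ _ (fun X => (hsq k X).1) (fun X => (hsq l X).1) h1 h2
    · exact killingForm_eq_zero_of_ne _ _ (fun X => (hsq k X).1) (fun X => (hsq l X).2) h1 h2
    · exact killingForm_eq_zero_of_ne _ _ (fun X => (hsq k X).2) (fun X => (hsq l X).1) h1 h2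
    · exact killingForm_eq_zero_of_ne _ _ (fun X => (hsq k X).2) (fun X => (hsq l X).2) h1 h2

end RootPairs

section RootBasis

variable {L : Type*} [LieRing L] [LieAlgebra ℝ L] {𝔱 : LieSubalgebra ℝ L}

/-- A basis of `V` whose consecutive pairs are the real and imaginary parts of root vectors. -/
def IsRootBasis {V : Submodule ℝ L} {m : ℕ} (α : Fin m → (𝔱 →ₗ[ℝ] ℂ))
    (f : Module.Basis (Fin (2 * m)) ℝ V) : Prop :=
  ∀ k : Fin m, mkT ((f ⟨2 * k, by omega⟩ : V) : L) ((f ⟨2 * k + 1, by omega⟩ : V) : L) ∈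
    SymmetricSpin.rootSpace 𝔱 (α k)

theorem innerForm_apply {V : Submodule ℝ L} (u v : V) :
    innerForm V u v = -killingForm ℝ L u v := rfl

/-- A root basis can be rescaled to an orthonormal one with the same orientation. -/
theorem IsRootBasis.exists_orthonormal (hneg : ∀ X : L, X ≠ 0 → killingForm ℝ L X X < 0)
    {V : Submodule ℝ L} {m : ℕ} {α : Fin m → (𝔱 →ₗ[ℝ] ℂ)}
    (hroot : ∀ k, α k ∈ SymmetricSpin.roots 𝔱)
    (hinj : Function.Injective α) (hopp : ∀ k l, α k ≠ -α l)
    {f : Module.Basis (Fin (2 * m)) ℝ V} (hf : IsRootBasis α f) :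
    ∃ e : Module.Basis (Fin (2 * m)) ℝ V, IsOrthonormal e ∧ IsRootBasis α e ∧
      f.orientation = e.orientation := by
  have hpos : ∀ j, 0 < -killingForm ℝ L (f j : L) (f j : L) := fun j =>
    neg_pos.2 (hneg _ fun h => f.ne_zero j (Subtype.ext h))
  have hsp : ∀ j, 0 < Real.sqrt (-killingForm ℝ L (f j : L) (f j : L)) := fun j =>
    Real.sqrt_pos.2 (hpos j)
  let w : Fin (2 * m) → ℝˣ := fun j =>
    Units.mk0 (Real.sqrt (-killingForm ℝ L (f j : L) (f j : L)))⁻¹ (inv_ne_zero (hsp j).ne')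
  have hw : ∀ j, ((w j : ℝˣ) : ℝ) = (Real.sqrt (-killingForm ℝ L (f j : L) (f j : L)))⁻¹ :=
    fun j => rfl
  have he : ∀ j, ((f.unitsSMul w j : V) : L) = (w j : ℝ) • (f j : L) := fun j => by
    rw [Module.Basis.unitsSMul_apply]; rfl
  refine ⟨f.unitsSMul w, fun i j => ?_, fun k => ?_, ?_⟩
  · rw [innerForm_apply, he, he]
    simp only [map_smul, LinearMap.smul_apply, smul_eq_mul]
    by_cases hij : i = j
    · subst hij
      rw [if_pos rfl, hw]
      have h1 := Real.mul_self_sqrt (hpos i).le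
      have h2 := (hsp i).ne'
      field_simp
      linarith
    · rw [if_neg hij, killingForm_eq_zero_of_rootVectors (f := fun j => (f j : L)) hneg hroot hinj
        hopp hf hij]
      simp
  · have hn := (killingForm_root_pair hneg (hroot k) (hf k)).1
    have h1 : (w ⟨2 * k + 1, by omega⟩ : ℝ) = w ⟨2 * k, by omega⟩ := by
      rw [hw, hw, hn]
    rw [he, he, h1]
    have h2 : mkT ((w ⟨2 * k, by omega⟩ : ℝ) • (f ⟨2 * k, by omega⟩ : L))
        ((w ⟨2 * k, by omega⟩ : ℝ) • (f ⟨2 * k + 1, by omega⟩ : L)) =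
        ((w ⟨2 * k, by omega⟩ : ℝ) : ℂ) •
          mkT (f ⟨2 * k, by omega⟩ : L) (f ⟨2 * k + 1, by omega⟩ : L) :=
      ext_reT_imT (by rw [reT_smul_complex, reT_mkT, reT_mkT, imT_mkT]; simp)
        (by rw [imT_smul_complex, reT_mkT, imT_mkT, imT_mkT]; simp)
    rw [h2]
    exact Submodule.smul_mem _ _ (hf k)
  · rw [Module.Basis.orientation_unitsSMul]
    refine (Module.Ray.units_smul_of_pos _ ?_ _).symm
    rw [Units.val_inv_eq_inv_val, inv_pos, Units.coe_prod]
    exact Finset.prod_pos fun j _ => inv_pos.2 (hsp j)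

variable [FiniteDimensional ℝ L]

/-- Independence is orthogonality. For spanning, let `U` be the span of the chosen real and
imaginary parts; the complexified map $\mathrm{id}-\theta$ sends every root space into $U_{\mathbb
C}$, hence $\mathfrak g$ into `U`, and it is multiplication by `2` on $\mathfrak p$. -/
theorem exists_isRootBasis (hneg : ∀ X : L, X ≠ 0 → killingForm ℝ L X X < 0)
    (h𝔱 : IsMaximalAbelian 𝔱) {θ : L ≃ₗ⁅ℝ⁆ L} (hθ : ∀ X, θ (θ X) = X)
    (h𝔱_le : 𝔱 ≤ fixedSubalgebra θ)
    {P : Set (𝔱 →ₗ[ℝ] ℂ)} (hP : IsPositiveSystem 𝔱 P)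
    {m : ℕ} {α : Fin m → (𝔱 →ₗ[ℝ] ℂ)} (hα : Function.Injective α)
    (hα_range : Set.range α = positiveRootsIn 𝔱 P (minusSubspace θ)) :
    ∃ f : Module.Basis (Fin (2 * m)) ℝ (minusSubspace θ), IsRootBasis α f := by
  have hαP : ∀ k, α k ∈ positiveRootsIn 𝔱 P (minusSubspace θ) := fun k =>
    hα_range ▸ Set.mem_range_self k
  have hroot : ∀ k, α k ∈ SymmetricSpin.roots 𝔱 := fun k => hP.subset_roots (hαP k).1
  have hopp : ∀ k l, α k ≠ -α l := fun k l h => hP.not_both _ (hαP l).1 (h ▸ (hαP k).1)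
  choose x hx hx0 using fun k => Submodule.exists_mem_ne_zero_of_ne_bot (hroot k).2
  have hxp : ∀ k, reT (x k) ∈ minusSubspace θ ∧ imT (x k) ∈ minusSubspace θ := by
    intro k
    have := (hαP k).2 (hx k)
    rwa [baseChange_eq_complexSubmodule] at this
  let g : Fin (2 * m) → minusSubspace θ := fun j =>
    if (j : ℕ) % 2 = 0 then ⟨reT (x ⟨j / 2, by omega⟩), (hxp _).1⟩
    else ⟨imT (x ⟨j / 2, by omega⟩), (hxp _).2⟩
  have hg0 : ∀ k : Fin m, (g ⟨2 * k, by omega⟩ : L) = reT (x k) := by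
    intro k
    simp [g]
  have hg1 : ∀ k : Fin m, (g ⟨2 * k + 1, by omega⟩ : L) = imT (x k) := by
    intro k
    have : (⟨(2 * (k : ℕ) + 1) / 2, by omega⟩ : Fin m) = k := Fin.ext (by simp only; omega)
    simp [g, this, Nat.add_mod]
  have hgroot : ∀ k : Fin m, mkT (g ⟨2 * k, by omega⟩ : L) (g ⟨2 * k + 1, by omega⟩ : L) ∈
      SymmetricSpin.rootSpace 𝔱 (α k) := fun k => by
    rw [hg0, hg1, mkT_reT_imT]; exact hx k
  have horth : ∀ i j, i ≠ j → killingForm ℝ L (g i : L) (g j : L) = 0 := fun i j hij =>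
    killingForm_eq_zero_of_rootVectors (f := fun j => (g j : L)) hneg hroot hα hopp hgroot hij
  have hne : ∀ j, killingForm ℝ L (g j : L) (g j : L) ≠ 0 := by
    intro j
    obtain ⟨k, hk⟩ := fin_two_mul_cases j
    have hp := (killingForm_root_pair hneg (hroot k) (hgroot k)).1
    have hor : (g ⟨2 * k, by omega⟩ : L) ≠ 0 ∨ (g ⟨2 * k + 1, by omega⟩ : L) ≠ 0 := by
      by_contra! h
      rw [hg0, hg1] at h
      exact hx0 k (ext_reT_imT (by simpa using h.1) (by simpa using h.2))
    have hlt : killingForm ℝ L (g ⟨2 * k, by omega⟩ : L) (g ⟨2 * k, by omega⟩ : L) ≠ 0 := by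
      rcases hor with h | h
      · exact (hneg _ h).ne
      · rw [hp]; exact (hneg _ h).ne
    rcases hk with rfl | rfl
    · exact hlt
    · rwa [← hp]
  have hind : LinearIndependent ℝ g := by
    rw [Fintype.linearIndependent_iff]
    intro c hc j
    have h1 : killingForm ℝ L ((∑ i, c i • g i : minusSubspace θ) : L) (g j : L) = 0 := by
      rw [hc]; simp
    rw [Submodule.coe_sum, map_sum, LinearMap.sum_apply, Finset.sum_eq_single j] at h1
    · simpa [hne j] using h1
    · intro i _ hij
      simp [horth i j hij]
    · simp
  let U : Submodule ℝ L := (Submodule.span ℝ (Set.range g)).map (minusSubspace θ).subtype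
  have hgU : ∀ j, (g j : L) ∈ U := fun j =>
    Submodule.mem_map_of_mem (f := (minusSubspace θ).subtype) (Submodule.subset_span ⟨j, rfl⟩)
  have hxU : ∀ k, x k ∈ complexSubmodule U := fun k =>
    ⟨by rw [← hg0]; exact hgU _, by rw [← hg1]; exact hgU _⟩
  let q : L →ₗ[ℝ] L := LinearMap.id - (θ : L →ₗ[ℝ] L)
  have hq : ∀ u, q u = u - θ u := fun u => rfl
  let W : Submodule ℂ (ℂ ⊗[ℝ] L) := complexSubmodule (U.comap q)
  have hθrs : ∀ β : 𝔱 →ₗ[ℝ] ℂ, ∀ y ∈ SymmetricSpin.rootSpace 𝔱 β,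
      mkT (θ (reT y)) (θ (imT y)) ∈ SymmetricSpin.rootSpace 𝔱 β := by
    intro β y hy
    rw [mem_rootSpace_iff_re_im] at hy ⊢
    intro X
    have hX : θ (X : L) = X := h𝔱_le X.2
    obtain ⟨h1, h2⟩ := hy X
    rw [reT_mkT, imT_mkT]
    constructor
    · conv_lhs => rw [← hX]
      rw [← LieEquiv.map_lie, h1, map_sub, map_smul, map_smul]
    · conv_lhs => rw [← hX]
      rw [← LieEquiv.map_lie, h2, map_add, map_smul, map_smul]
  have hW : ∀ β : 𝔱 →ₗ[ℝ] ℂ, SymmetricSpin.rootSpace 𝔱 β ≤ W := by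
    intro β
    by_cases hβ0 : β = 0
    · subst hβ0
      intro y hy
      obtain ⟨h1, h2⟩ := rootSpace_zero_le h𝔱 hy
      have h1' : θ (reT y) = reT y := h𝔱_le h1
      have h2' : θ (imT y) = imT y := h𝔱_le h2
      refine ⟨?_, ?_⟩
      · rw [Submodule.mem_comap, hq, h1', sub_self]; exact U.zero_mem
      · rw [Submodule.mem_comap, hq, h2', sub_self]; exact U.zero_mem
    by_cases hβ1 : SymmetricSpin.rootSpace 𝔱 β = ⊥
    · rw [hβ1]; exact bot_le
    have hβ : β ∈ SymmetricSpin.roots 𝔱 := ⟨hβ0, hβ1⟩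
    have hdim := finrank_rootSpace_eq_one hneg h𝔱 hβ
    obtain ⟨y, hy, hy0⟩ := Submodule.exists_mem_ne_zero_of_ne_bot hβ1
    -- On a complex line any nonzero vector generates; this makes $\theta$ act on the root space by
    -- a scalar `c`, and $\theta^2=\mathrm{Id}$ gives $c^2=1$.
    have hgen : ∀ {γ : 𝔱 →ₗ[ℝ] ℂ}, γ ∈ SymmetricSpin.roots 𝔱 → ∀ {y z : ℂ ⊗[ℝ] L},
        y ∈ SymmetricSpin.rootSpace 𝔱 γ → y ≠ 0 → z ∈ SymmetricSpin.rootSpace 𝔱 γ →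
        ∃ c : ℂ, c • y = z := by
      intro γ hγ y z hy hy0 hz
      obtain ⟨c, hc⟩ := exists_smul_eq_of_finrank_eq_one (finrank_rootSpace_eq_one hneg h𝔱 hγ)
        (x := (⟨y, hy⟩ : SymmetricSpin.rootSpace 𝔱 γ))
        (fun h => hy0 (congrArg Subtype.val h)) ⟨z, hz⟩
      exact ⟨c, congrArg Subtype.val hc⟩
    suffices hyW : y ∈ W by
      intro z hz
      obtain ⟨c, rfl⟩ := hgen hβ hy hy0 hz
      exact W.smul_mem _ hyW
    obtain ⟨c, hc⟩ := hgen hβ hy hy0 (hθrs β y hy)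
    have hre : θ (reT y) = c.re • reT y - c.im • imT y := by
      simpa using (congrArg reT hc).symm
    have him : θ (imT y) = c.re • imT y + c.im • reT y := by
      simpa using (congrArg imT hc).symm
    have hcc : (c * c) • y = y := by
      rw [mul_smul]
      refine ext_reT_imT ?_ ?_
      · have := hθ (reT y)
        rw [hre, map_sub, map_smul, map_smul, hre, him] at this
        rw [reT_smul_complex, imT_smul_complex, reT_smul_complex]
        exact this
      · have := hθ (imT y)
        rw [him, map_add, map_smul, map_smul, hre, him] at this
        rw [imT_smul_complex, imT_smul_complex, reT_smul_complex]
        exact this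
    have hc1 : c * c = 1 := by
      have : (c * c - 1) • y = 0 := by rw [sub_smul, one_smul, hcc, sub_self]
      exact sub_eq_zero.1 ((smul_eq_zero.1 this).resolve_right hy0)
    rcases mul_self_eq_one_iff.1 hc1 with rfl | rfl
    · have h1 : θ (reT y) = reT y := by simpa using hre
      have h2 : θ (imT y) = imT y := by simpa using him
      refine ⟨?_, ?_⟩
      · rw [Submodule.mem_comap, hq, h1, sub_self]; exact U.zero_mem
      · rw [Submodule.mem_comap, hq, h2, sub_self]; exact U.zero_mem
    · have h1 : θ (reT y) = -reT y := by simpa using hre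
      have h2 : θ (imT y) = -imT y := by simpa using him
      have hminus : ∀ {γ : 𝔱 →ₗ[ℝ] ℂ}, γ ∈ SymmetricSpin.roots 𝔱 → ∀ {y : ℂ ⊗[ℝ] L},
          y ∈ SymmetricSpin.rootSpace 𝔱 γ → y ≠ 0 → θ (reT y) = -reT y → θ (imT y) = -imT y →
          γ ∈ P → y ∈ complexSubmodule U := by
        intro γ hγ y hy hy0 h1 h2 hγP
        have hle : SymmetricSpin.rootSpace 𝔱 γ ≤ (minusSubspace θ).baseChange ℂ := by
          intro z hz
          obtain ⟨c, rfl⟩ := hgen hγ hy hy0 hz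
          refine Submodule.smul_mem _ _ ?_
          rw [baseChange_eq_complexSubmodule]
          exact ⟨h1, h2⟩
        have hmem : γ ∈ Set.range α := by rw [hα_range]; exact ⟨hγP, hle⟩
        obtain ⟨k, rfl⟩ := hmem
        obtain ⟨c, rfl⟩ := hgen hγ (hx k) (hx0 k) hy
        exact Submodule.smul_mem _ _ (hxU k)
      have hyU : reT y ∈ U ∧ imT y ∈ U := by
        rcases hP.mem_or_neg_mem β hβ with hβP | hβP
        · exact hminus hβ hy hy0 h1 h2 hβP
        · have hconj0 : mkT (reT y) (-imT y) ≠ 0 := by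
            intro h
            have e1 := congrArg reT h
            have e2 := congrArg imT h
            rw [reT_mkT, map_zero] at e1
            rw [imT_mkT, map_zero, neg_eq_zero] at e2
            exact hy0 (ext_reT_imT (by simpa using e1) (by simpa using e2))
          have := hminus (hP.subset_roots hβP) (conj_mem_rootSpace_neg hneg hy) hconj0
            (by rw [reT_mkT, h1]) (by rw [imT_mkT, map_neg, h2]) hβP
          rw [mem_complexSubmodule, reT_mkT, imT_mkT] at this
          exact ⟨this.1, by simpa using U.neg_mem this.2⟩
      refine ⟨?_, ?_⟩
      · rw [Submodule.mem_comap, hq, h1, sub_neg_eq_add]; exact U.add_mem hyU.1 hyU.1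
      · rw [Submodule.mem_comap, hq, h2, sub_neg_eq_add]; exact U.add_mem hyU.2 hyU.2
  have htop : W = ⊤ := by
    rw [eq_top_iff, ← iSup_rootSpace_eq_top hneg h𝔱]
    exact iSup_le hW
  have hspan : Submodule.span ℝ (Set.range g) = ⊤ := by
    rw [eq_top_iff]
    rintro ⟨w, hw⟩ -
    have hmem : mkT w 0 ∈ W := htop ▸ Submodule.mem_top
    have h1 := hmem.1
    rw [reT_mkT, Submodule.mem_comap, hq, show θ w = -w from hw, sub_neg_eq_add, ← two_smul ℝ] at h1
    have h2 : w ∈ U := by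
      have := U.smul_mem (2⁻¹ : ℝ) h1
      rwa [smul_smul, inv_mul_cancel₀ two_ne_zero, one_smul] at this
    obtain ⟨w', hw', hww⟩ := h2
    have : w' = ⟨w, hw⟩ := Subtype.ext hww
    rwa [← this]
  refine ⟨Module.Basis.mk hind hspan.ge, fun k => ?_⟩
  rw [Module.Basis.mk_apply, Module.Basis.mk_apply]
  exact hgroot k

end RootBasis

end

/-! ### The differential of the lift to the spin group -/

section

open SymmetricSpin

section WeakDeriv

variable {V V' V'' : Type*} [AddCommGroup V] [Module ℝ V] [AddCommGroup V'] [Module ℝ V']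
  [AddCommGroup V''] [Module ℝ V'']

/-- The curve `c` has derivative `c'` at `0`, tested on linear functionals. -/
def HasWeakDeriv (c : ℝ → V) (c' : V) : Prop :=
  ∀ f : V →ₗ[ℝ] ℝ, HasDerivAt (fun t => f (c t)) (f c') 0

theorem HasWeakDeriv.map {c : ℝ → V} {c' : V} (h : HasWeakDeriv c c') (T : V →ₗ[ℝ] V') :
    HasWeakDeriv (fun t => T (c t)) (T c') := fun f => h (f ∘ₗ T)

theorem HasWeakDeriv.unique {c : ℝ → V} {c₁ c₂ : V} (h₁ : HasWeakDeriv c c₁)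
    (h₂ : HasWeakDeriv c c₂) : c₁ = c₂ := by
  rw [← sub_eq_zero, ← Module.forall_dual_apply_eq_zero_iff ℝ]
  intro f
  rw [map_sub, sub_eq_zero]
  exact (h₁ f).unique (h₂ f)

theorem HasWeakDeriv.const (v : V) : HasWeakDeriv (fun _ : ℝ => v) 0 := fun f => by
  rw [map_zero]; exact hasDerivAt_const _ _

/-- Testing on functionals avoids choosing a norm on the Clifford algebra. The Leibniz rule is the
scalar product rule after expanding the first argument in a basis. -/
theorem HasWeakDeriv.bilin [FiniteDimensional ℝ V] {c : ℝ → V} {c' : V} {d : ℝ → V'} {d' : V'}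
    (hc : HasWeakDeriv c c') (hd : HasWeakDeriv d d') (B : V →ₗ[ℝ] V' →ₗ[ℝ] V'') :
    HasWeakDeriv (fun t => B (c t) (d t)) (B c' (d 0) + B (c 0) d') := by
  intro f
  let b := Module.finBasis ℝ V
  have hexp : ∀ (x : V) (y : V'), f (B x y) = ∑ i, b.coord i x * f (B (b i) y) := by
    intro x y
    conv_lhs => rw [← b.sum_repr x]
    simp only [map_sum, map_smul, LinearMap.sum_apply, LinearMap.smul_apply, smul_eq_mul,
      Module.Basis.coord_apply]
  rw [map_add, hexp, hexp, ← Finset.sum_add_distrib]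
  simp only [hexp (c _)]
  refine HasDerivAt.fun_sum fun i _ => ?_
  exact (hc (b.coord i)).mul (hd (f ∘ₗ B (b i)))

theorem HasDerivAt.hasWeakDeriv {V : Type*} [NormedAddCommGroup V] [NormedSpace ℝ V]
    [FiniteDimensional ℝ V] {c : ℝ → V} {c' : V} (h : HasDerivAt c c' 0) : HasWeakDeriv c c' :=
  fun f => (LinearMap.toContinuousLinearMap f).hasFDerivAt.comp_hasDerivAt 0 h

theorem HasWeakDeriv.of_subtype {p : Submodule ℝ V} {c : ℝ → p} {c' : p}
    (h : HasWeakDeriv (fun t => (c t : V)) c') : HasWeakDeriv c c' := by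
  intro f
  obtain ⟨g, hg⟩ := f.exists_extend
  rw [← hg]
  exact h g

end WeakDeriv

section CliffordDeriv

open CliffordAlgebra

variable {M : Type*} [AddCommGroup M] [Module ℝ M] {Q : QuadraticForm ℝ M}

/-- The element of the Clifford algebra that acts on the vectors as an infinitesimal rotation in
the planes of consecutive pairs. -/
noncomputable def rotationElement (Q : QuadraticForm ℝ M) {m : ℕ} (e : Fin (2 * m) → M)
    (a : Fin m → ℝ) : CliffordAlgebra Q :=
  (-(1 / 2) : ℝ) • ∑ k : Fin m, a k • (ι Q (e ⟨2 * k, by omega⟩) * ι Q (e ⟨2 * k + 1, by omega⟩))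

theorem involute_rotationElement {m : ℕ} (e : Fin (2 * m) → M) (a : Fin m → ℝ) :
    involute (rotationElement Q e a) = rotationElement Q e a := by
  simp [rotationElement]

theorem star_rotationElement {m : ℕ} {e : Fin (2 * m) → M}
    (he : ∀ i j, i ≠ j → ι Q (e i) * ι Q (e j) = -(ι Q (e j) * ι Q (e i))) (a : Fin m → ℝ) :
    star (rotationElement Q e a) = -rotationElement Q e a := by
  rw [rotationElement, CliffordAlgebra.star_smul, star_sum, ← smul_neg, ← Finset.sum_neg_distrib]
  congr 1
  refine Finset.sum_congr rfl fun k _ => ?_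
  rw [CliffordAlgebra.star_smul, star_mul, star_ι, star_ι, neg_mul_neg, he _ _ (by simp), smul_neg]

/-- A pair $e_{2k}e_{2k+1}$ commutes with every other basis vector, as two signs cancel, while
$[e_{2k}e_{2k+1},e_{2k}]=2e_{2k+1}$ and $[e_{2k}e_{2k+1},e_{2k+1}]=-2e_{2k}$. The factor $-\frac12$
absorbs this doubling. -/
theorem rotationElement_commutator {m : ℕ} (e : Module.Basis (Fin (2 * m)) ℝ M)
    (hsq : ∀ i, ι Q (e i) * ι Q (e i) = -1)
    (he : ∀ i j, i ≠ j → ι Q (e i) * ι Q (e j) = -(ι Q (e j) * ι Q (e i))) (a : Fin m → ℝ)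
    (D : M →ₗ[ℝ] M) (hD : ∀ k : Fin m,
      D (e ⟨2 * k, by omega⟩) = -(a k • e ⟨2 * k + 1, by omega⟩) ∧
      D (e ⟨2 * k + 1, by omega⟩) = a k • e ⟨2 * k, by omega⟩) (v : M) :
    rotationElement Q e a * ι Q v - ι Q v * rotationElement Q e a = ι Q (D v) := by
  suffices h : (LinearMap.mulLeft ℝ (rotationElement Q e a) -
      LinearMap.mulRight ℝ (rotationElement Q e a)) ∘ₗ ι Q = ι Q ∘ₗ D from
    DFunLike.congr_fun h v
  refine e.ext fun j => ?_
  change rotationElement Q e a * ι Q (e j) - ι Q (e j) * rotationElement Q e a = ι Q (D (e j))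
  have hexp : rotationElement Q e a * ι Q (e j) - ι Q (e j) * rotationElement Q e a =
      (-(1 / 2) : ℝ) • ∑ k : Fin m, a k •
        (ι Q (e ⟨2 * k, by omega⟩) * ι Q (e ⟨2 * k + 1, by omega⟩) * ι Q (e j) -
          ι Q (e j) * (ι Q (e ⟨2 * k, by omega⟩) * ι Q (e ⟨2 * k + 1, by omega⟩))) := by
    simp only [rotationElement, smul_mul_assoc, mul_smul_comm, Finset.sum_mul, Finset.mul_sum,
      smul_sub, Finset.sum_sub_distrib]
  obtain ⟨k, hk⟩ := fin_two_mul_cases j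
  rw [hexp, Finset.sum_eq_single k]
  · have h1 := hsq ⟨2 * k, by omega⟩
    have h2 := hsq ⟨2 * k + 1, by omega⟩
    have h3 := he ⟨2 * k, by omega⟩ ⟨2 * k + 1, by omega⟩ (by simp)
    obtain ⟨hD1, hD2⟩ := hD k
    rcases hk with rfl | rfl
    · rw [hD1, map_neg, map_smul, ← mul_assoc, h1, h3, neg_mul, mul_assoc, h1]
      simp only [neg_mul, one_mul, mul_neg, mul_one]
      module
    · rw [hD2, map_smul, ← mul_assoc, mul_assoc, h2, ← neg_eq_iff_eq_neg.2 h3, neg_mul, mul_assoc, h2]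
      simp only [mul_neg, mul_one]
      module
  · intro l _ hlk
    have hl : ∀ i : Fin (2 * m), ((i : ℕ) = 2 * l ∨ (i : ℕ) = 2 * l + 1) → i ≠ j := by
      rintro i hi rfl
      refine hlk (Fin.ext ?_)
      rcases hk with hk | hk <;> rw [Fin.ext_iff] at hk <;> simp only at hk <;> omega
    rw [mul_assoc, he _ j (hl _ (Or.inr rfl)), mul_neg, ← mul_assoc, he _ j (hl _ (Or.inl rfl)),
      neg_mul, neg_neg, mul_assoc, sub_self, smul_zero]
  · simp

variable [FiniteDimensional ℝ M]

/-- An even skew element of the Clifford algebra is determined by its commutators with vectors. -/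
theorem CliffordAlgebra.eq_of_commutator_eq
    (hQ : ∀ d : Module.Dual ℝ M, ∃ v, QuadraticMap.polarBilin Q v = d)
    {x y : CliffordAlgebra Q} (hx : involute x = x) (hy : involute y = y)
    (hx' : star x = -x) (hy' : star y = -y)
    (h : ∀ v, x * ι Q v - ι Q v * x = y * ι Q v - ι Q v * y) : x = y := by
  obtain ⟨r, hr⟩ := CliffordAlgebra.eq_algebraMap_of_commute hQ (x - y)
    (by rw [map_sub, hx, hy]) fun v => by
      rw [mul_sub, sub_mul]
      have := h v
      rw [sub_eq_sub_iff_add_eq_add] at this ⊢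
      rw [add_comm, ← this, add_comm]
  -- The difference is a scalar. It is negated by `star`, which fixes scalars, so it is zero.
  have h1 : star (x - y) = -(x - y) := by rw [star_sub, hx', hy']; abel
  have h2 : star (algebraMap ℝ (CliffordAlgebra Q) r) = algebraMap ℝ (CliffordAlgebra Q) r := by
    rw [star_algebraMap]
  rw [hr, h2, eq_neg_iff_add_eq_zero, ← two_smul ℝ, smul_eq_zero] at h1
  rw [← sub_eq_zero, hr]
  exact h1.resolve_left two_ne_zero

end CliffordDeriv

section LiftDeriv

variable {E : Type*} [NormedAddCommGroup E] [NormedSpace ℝ E] [FiniteDimensional ℝ E]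
  {G : Type*} [TopologicalSpace G] [ChartedSpace E G] [Group G] [LieGroup 𝓘(ℝ, E) ∞ G]
  {F : Type*} [NormedAddCommGroup F] [NormedSpace ℝ F]
  {H : Type*} [TopologicalSpace H] [ChartedSpace F H] [Group H]

/-- The differential at `1` of a map to a finite-dimensional vector space without a norm. -/
noncomputable def weakDifferential {V : Type*} [AddCommGroup V] [Module ℝ V] [FiniteDimensional ℝ V]
    (r : H → V) (X : F) : V :=
  let D : Fin (Module.finrank ℝ V) → F →L[ℝ] ℝ := fun i =>
    mfderiv 𝓘(ℝ, F) 𝓘(ℝ, ℝ) (fun h => (Module.finBasis ℝ V).coord i (r h)) 1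
  ∑ i, D i X • Module.finBasis ℝ V i

theorem hasWeakDeriv_weakDifferential {V : Type*} [AddCommGroup V] [Module ℝ V]
    [FiniteDimensional ℝ V] {r : H → V}
    (hr : ∀ f : V →ₗ[ℝ] ℝ, MDifferentiableAt 𝓘(ℝ, F) 𝓘(ℝ, ℝ) (fun h => f (r h)) 1) (X : F) :
    HasWeakDeriv (fun t => r (chartCurve 1 X t)) (weakDifferential r X) := by
  intro f
  have hexp : ∀ x : V, f x =
      ∑ i, (Module.finBasis ℝ V).coord i x * f (Module.finBasis ℝ V i) := by
    intro x
    conv_lhs => rw [← (Module.finBasis ℝ V).sum_repr x]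
    simp only [map_sum, map_smul, smul_eq_mul, Module.Basis.coord_apply]
  rw [weakDifferential, map_sum]
  simp only [hexp (r _), map_smul, smul_eq_mul]
  refine HasDerivAt.fun_sum fun i _ => ?_
  exact (hasDerivAt_comp_chartCurve (hr ((Module.finBasis ℝ V).coord i)) X).mul_const _

variable {θ : GroupLieAlgebra 𝓘(ℝ, E) G ≃ₗ⁅ℝ⁆ GroupLieAlgebra 𝓘(ℝ, E) G}

/-- The bracket with an element of `𝔥`, as an endomorphism of `𝔭`. -/
noncomputable def bracketOnMinus {L : Type*} [LieRing L] [LieAlgebra ℝ L] (θ : L ≃ₗ⁅ℝ⁆ L)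
    (X : fixedSubalgebra θ) : minusSubspace θ →ₗ[ℝ] minusSubspace θ :=
  (LieAlgebra.ad ℝ L X : L →ₗ[ℝ] L).restrict fun Y hY => by
    change θ ⁅(X : L), Y⁆ = -⁅(X : L), Y⁆
    rw [LieEquiv.map_lie, show θ X = X from X.2, show θ Y = -Y from hY, lie_neg]

theorem coe_bracketOnMinus {L : Type*} [LieRing L] [LieAlgebra ℝ L] (θ : L ≃ₗ⁅ℝ⁆ L)
    (X : fixedSubalgebra θ) (Y : minusSubspace θ) :
    (bracketOnMinus θ X Y : L) = ⁅(X : L), (Y : L)⁆ := rfl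

variable {j : H →* G} {ρ : H →* Spin (minusSubspace θ)}

section
open CliffordAlgebra

/-- Three identities on the group are differentiated at `1`: elements are even, `star` inverts them,
and conjugation by them on vectors is the adjoint action. -/
theorem weakDifferential_spinLift_properties
    (hj : MDifferentiableAt 𝓘(ℝ, F) 𝓘(ℝ, E) j 1)
    (hρ : IsSpinLift (E := E) (F := F) j (minusSubspace θ) ρ) (X : F) (Z : fixedSubalgebra θ)
    (hZ : homDifferential (E := E) (F := F) j X = Z) (z : Cl (minusSubspace θ))
    (hz : HasWeakDeriv (fun t => (ρ (chartCurve 1 X t) : Cl (minusSubspace θ))) z) :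
    involute z = z ∧ star z = -z ∧ ∀ v, z * ι _ v - ι _ v * z = ι _ (bracketOnMinus θ Z v) := by
  have : FiniteDimensional ℝ (GroupLieAlgebra 𝓘(ℝ, E) G) := inferInstanceAs (FiniteDimensional ℝ E)
  have h0 : (ρ (chartCurve 1 X 0) : Cl (minusSubspace θ)) = 1 := by
    rw [chartCurve_zero, map_one, OneMemClass.coe_one]
  refine ⟨?_, ?_, fun v => ?_⟩
  · refine HasWeakDeriv.unique ?_ hz
    have := hz.map (involute : Cl (minusSubspace θ) →ₐ[ℝ] _).toLinearMap
    simpa [spinGroup.involute_eq (ρ _).2] using this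
  · let T : Cl (minusSubspace θ) →ₗ[ℝ] Cl (minusSubspace θ) :=
      reverse ∘ₗ (involute : Cl (minusSubspace θ) →ₐ[ℝ] _).toLinearMap
    have hT : ∀ x, T x = star x := fun x => rfl
    have h1 := (hz.map T).bilin hz (LinearMap.mul ℝ _)
    have h2 := HasWeakDeriv.const (1 : Cl (minusSubspace θ))
    have h3 : (fun t => LinearMap.mul ℝ _ (T (ρ (chartCurve 1 X t) : Cl (minusSubspace θ)))
        (ρ (chartCurve 1 X t) : Cl (minusSubspace θ))) = fun _ => 1 := by
      funext t
      rw [LinearMap.mul_apply', hT]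
      exact spinGroup.star_mul_self_of_mem (ρ _).2
    rw [h3] at h1
    have h4 := h1.unique h2
    rw [LinearMap.mul_apply', LinearMap.mul_apply', hT, hT, h0, star_one, mul_one, one_mul] at h4
    exact eq_neg_of_add_eq_zero_left h4
  · choose A hA hA' using fun h => hρ.lifts h v
    have h1 : HasWeakDeriv (fun t => A (chartCurve 1 X t)) (bracketOnMinus θ Z v) := by
      refine HasWeakDeriv.of_subtype ?_
      rw [coe_bracketOnMinus, ← hZ]
      have := (hasDerivAt_adjointMap_comp_chartCurve j hj X (v : GroupLieAlgebra 𝓘(ℝ, E) G))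
      have h2 : (fun t => (A (chartCurve 1 X t) : GroupLieAlgebra 𝓘(ℝ, E) G)) =
          fun t => adjointMap E (j (chartCurve 1 X t)) (v : GroupLieAlgebra 𝓘(ℝ, E) G) := by
        funext t
        rw [← hA]
        exact Ad_eq_adjointMap _ _
      rw [h2]
      exact this.hasWeakDeriv
    have h2 := hz.map (LinearMap.mulRight ℝ (ι (-(normForm (minusSubspace θ))) v))
    have h3 := (h1.map (ι (-(normForm (minusSubspace θ))))).bilin hz (LinearMap.mul ℝ _)
    -- The lifting relation multiplied on the right by `ρ h`, so that no inverse has to be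
    -- differentiated.
    have h4 : (fun t => LinearMap.mulRight ℝ (ι (-(normForm (minusSubspace θ))) v)
        (ρ (chartCurve 1 X t) : Cl (minusSubspace θ))) =
        fun t => LinearMap.mul ℝ _ (ι (-(normForm (minusSubspace θ))) (A (chartCurve 1 X t)))
          (ρ (chartCurve 1 X t) : Cl (minusSubspace θ)) := by
      funext t
      rw [LinearMap.mul_apply', LinearMap.mulRight_apply, ← hA', mul_assoc, ← Submonoid.coe_mul,
        inv_mul_cancel, OneMemClass.coe_one, mul_one]
    rw [h4] at h2
    have h5 := h2.unique h3
    have h6 : A (chartCurve 1 X 0) = v := by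
      refine Subtype.ext ?_
      rw [← hA, chartCurve_zero, map_one]
      obtain ⟨-, -, h, -⟩ := hasFDerivAt_adjointMap (G := G) (E := E) (v : GroupLieAlgebra 𝓘(ℝ, E) G)
      exact (Ad_eq_adjointMap _ _).trans h
    rw [LinearMap.mul_apply', LinearMap.mul_apply', LinearMap.mulRight_apply, h6, h0, mul_one] at h5
    rw [h5, add_sub_cancel_right]

end

end LiftDeriv

end

/-! ### Differentials of representations, and the volume operator -/

section

open SymmetricSpin

section RepDifferential

variable {F : Type*} [NormedAddCommGroup F] [NormedSpace ℝ F]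
  {H : Type*} [TopologicalSpace H] [ChartedSpace F H] [Group H]
  {S : Type*} [NormedAddCommGroup S] [NormedSpace ℂ S] [FiniteDimensional ℂ S]
  {V : Type*} [AddCommGroup V] [Module ℝ V] [FiniteDimensional ℝ V]

/-- The differential of a representation that is linear in a weakly smooth map. -/
theorem repDifferential_eq_of_linear {r : H → V}
    (hr : ∀ f : V →ₗ[ℝ] ℝ, ContMDiff 𝓘(ℝ, F) 𝓘(ℝ, ℝ) ∞ fun h => f (r h))
    (χ : H →* (S →L[ℂ] S)) (T : V →ₗ[ℝ] (S →L[ℂ] S)) (hχ : ∀ h, χ h = T (r h)) (X : F) :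
    repDifferential (F := F) χ X = T (weakDifferential r X) := by
  let b := Module.finBasis ℝ V
  -- In coordinates on `V`, `χ` is a continuous linear map after smooth real functions, hence
  -- smooth.
  let φ : (Fin (Module.finrank ℝ V) → ℝ) →L[ℝ] (S →L[ℂ] S) :=
    LinearMap.toContinuousLinearMap (T ∘ₗ b.equivFun.symm.toLinearMap)
  have h1 : (χ : H → S →L[ℂ] S) = φ ∘ fun h i => b.coord i (r h) := by
    funext h
    rw [hχ]
    change T (r h) = T (b.equivFun.symm (b.equivFun (r h)))
    rw [LinearEquiv.symm_apply_apply]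
  have h2 : ContMDiff 𝓘(ℝ, F) 𝓘(ℝ, S →L[ℂ] S) ∞ χ := by
    rw [h1]
    exact φ.contMDiff.comp (contMDiff_pi_space.2 fun i => hr (b.coord i))
  have h3 := (hasDerivAt_comp_chartCurve
    ((h2.contMDiffAt (x := 1)).mdifferentiableAt (by simp)) X).hasWeakDeriv
  have h4 := (hasWeakDeriv_weakDifferential
    (fun f => ((hr f).contMDiffAt (x := 1)).mdifferentiableAt (by simp)) X).map T
  simp only [hχ] at h3
  exact h3.unique h4

end RepDifferential

section Eigen

variable {S : Type*} [AddCommGroup S] [Module ℂ S]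

theorem Module.End.isCompl_eigenspace_of_mul_self {T : Module.End ℂ S} (hT : T * T = 1) :
    IsCompl (Module.End.eigenspace T 1) (Module.End.eigenspace T (-1)) := by
  have hTT : ∀ x, T (T x) = x := fun x => DFunLike.congr_fun hT x
  constructor
  · rw [Submodule.disjoint_def]
    intro x h1 h2
    rw [Module.End.mem_eigenspace_iff] at h1 h2
    rw [h1, one_smul, neg_smul, one_smul, eq_neg_iff_add_eq_zero, ← two_smul ℂ, smul_eq_zero] at h2
    exact h2.resolve_left two_ne_zero
  · rw [codisjoint_iff, eq_top_iff]
    intro x _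
    have : x = (1 / 2 : ℂ) • (x + T x) + (1 / 2 : ℂ) • (x - T x) := by module
    rw [this]
    refine Submodule.add_mem_sup (Submodule.smul_mem _ _ ?_) (Submodule.smul_mem _ _ ?_)
    · rw [Module.End.mem_eigenspace_iff, map_add, hTT, one_smul, add_comm]
    · rw [Module.End.mem_eigenspace_iff, map_sub, hTT, neg_smul, one_smul, neg_sub]

theorem Module.End.prod_ofFn_apply {m : ℕ} (g : Fin m → Module.End ℂ S) (d : Fin m → ℂ) (x : S)
    (h : ∀ k, g k x = d k • x) : (List.ofFn g).prod x = (∏ k, d k) • x := by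
  induction m with
  | zero => simp
  | succ m ih =>
    rw [List.ofFn_succ, List.prod_cons, Module.End.mul_apply,
      ih (fun k => g k.succ) (fun k => d k.succ) fun k => h k.succ, map_smul, h,
      Fin.prod_univ_succ, smul_smul, mul_comm]

end Eigen

theorem prod_eq_one_iff_mem_evenSigns {m : ℕ} (ε : Fin m → ℤˣ) :
    ∏ k, ε k = 1 ↔ ε ∈ evenSigns m := by
  have h1 : ∀ k, ε k = if ε k = -1 then -1 else 1 := fun k => by
    rcases Int.units_eq_one_or (ε k) with h | h <;> rw [h] <;> rfl
  rw [Finset.prod_congr rfl fun k _ => h1 k, Finset.prod_ite, Finset.prod_const_one, mul_one,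
    Finset.prod_const, evenSigns, Set.mem_ofPred_eq]
  exact neg_one_pow_eq_one_iff_even (by decide)

namespace IsCliffordFamily

variable {S : Type*} [AddCommGroup S] [Module ℂ S] {m : ℕ} {a b : Fin m → Module.End ℂ S}

/-- The product of the operators `i a_k b_k`. -/
noncomputable def volume (a b : Fin m → Module.End ℂ S) : Module.End ℂ S :=
  Complex.I ^ m • (List.ofFn fun k => a k * b k).prod

/-- Each $a_kb_k$ is $-i$ times its involution, and $i^m(-i)^m=1$. -/
theorem volume_apply {x : S} {d : Fin m → ℂ} (hx : ∀ k, sign a b k x = d k • x) :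
    volume a b x = (∏ k, d k) • x := by
  have h1 : ∀ k, (a k * b k) x = (-Complex.I * d k) • x := by
    intro k
    rw [mul_smul, ← hx, sign, LinearMap.smul_apply, smul_smul, neg_mul, Complex.I_mul_I, neg_neg,
      one_smul]
  rw [volume, LinearMap.smul_apply, Module.End.prod_ofFn_apply _ _ _ h1, smul_smul,
    Finset.prod_mul_distrib, Finset.prod_const, Finset.card_univ, Fintype.card_fin, ← mul_assoc,
    ← mul_pow, mul_neg, Complex.I_mul_I, neg_neg, one_pow, one_mul]

theorem volume_apply_basis {s : Module.Basis (Fin m → ℤˣ) ℂ S}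
    (hs : ∀ ε k, sign a b k (s ε) = ((ε k : ℤ) : ℂ) • s ε) (ε : Fin m → ℤˣ) :
    volume a b (s ε) = (((∏ k, ε k : ℤˣ) : ℤ) : ℂ) • s ε := by
  rw [volume_apply (hs ε), Units.coe_prod, Int.cast_prod]

theorem volume_mul_self {s : Module.Basis (Fin m → ℤˣ) ℂ S}
    (hs : ∀ ε k, sign a b k (s ε) = ((ε k : ℤ) : ℂ) • s ε) : volume a b * volume a b = 1 := by
  refine s.ext fun ε => ?_
  rw [Module.End.mul_apply, volume_apply_basis hs, map_smul, volume_apply_basis hs, smul_smul,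
    ← Int.cast_mul, ← Units.val_mul, Int.units_mul_self, Units.val_one, Int.cast_one, one_smul,
    Module.End.one_apply]

/-- `T` reverses exactly one sign of a joint eigenvector, hence the product of all signs. This
applies to Clifford multiplication by a basis vector. -/
theorem volume_anticommute_of_flip {s : Module.Basis (Fin m → ℤˣ) ℂ S}
    (hs : ∀ ε k, sign a b k (s ε) = ((ε k : ℤ) : ℂ) • s ε) {T : Module.End ℂ S} (k : Fin m)
    (h1 : T * sign a b k = -(sign a b k * T))
    (h2 : ∀ l, k ≠ l → T * sign a b l = sign a b l * T) :
    volume a b * T = -(T * volume a b) := by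
  refine s.ext fun ε => ?_
  have h : ∀ l, sign a b l (T (s ε)) =
      ((if l = k then -1 else 1) * ((ε l : ℤ) : ℂ)) • T (s ε) := by
    intro l
    by_cases hl : l = k
    · subst hl
      have := DFunLike.congr_fun h1 (s ε)
      rw [Module.End.mul_apply, hs, map_smul, LinearMap.neg_apply, Module.End.mul_apply] at this
      rw [if_pos rfl, neg_one_mul, neg_smul, this, neg_neg]
    · have := DFunLike.congr_fun (h2 l (Ne.symm hl)) (s ε)
      rw [Module.End.mul_apply, hs, map_smul, Module.End.mul_apply] at this
      rw [if_neg hl, one_mul, this]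
  rw [Module.End.mul_apply, volume_apply h, LinearMap.neg_apply, Module.End.mul_apply,
    volume_apply (hs ε), map_smul, Finset.prod_mul_distrib, Finset.prod_ite_eq' Finset.univ k,
    if_pos (Finset.mem_univ k), neg_one_mul, neg_smul]

end IsCliffordFamily

end

/-! ### The Clifford action on spinors -/

namespace SymmetricSpin

section Form

variable {L : Type*} [LieRing L] [LieAlgebra ℝ L] {V : Submodule ℝ L}

open CliffordAlgebra

theorem neg_normForm_apply (v : V) : (-(normForm V)) v = killingForm ℝ L v v := by
  change -(innerForm V v v) = _
  rw [innerForm_apply, neg_neg]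

theorem polar_neg_normForm (u v : V) :
    QuadraticMap.polar (-(normForm V)) u v = 2 * killingForm ℝ L u v := by
  rw [QuadraticMap.polar, neg_normForm_apply, neg_normForm_apply, neg_normForm_apply,
    Submodule.coe_add, map_add, map_add, LinearMap.add_apply, LinearMap.add_apply,
    killingForm_symm (v : L) (u : L)]
  ring

theorem polarBilin_neg_normForm_surjective [FiniteDimensional ℝ L]
    (hneg : ∀ X : L, X ≠ 0 → killingForm ℝ L X X < 0) (d : Module.Dual ℝ V) :
    ∃ v, QuadraticMap.polarBilin (-(normForm V)) v = d := by
  have hinj : Function.Injective (QuadraticMap.polarBilin (-(normForm V))) := by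
    rw [injective_iff_map_eq_zero]
    intro v hv
    by_contra h0
    have h1 := DFunLike.congr_fun hv v
    rw [QuadraticMap.polarBilin_apply_apply, polar_neg_normForm, LinearMap.zero_apply] at h1
    have h2 := hneg v fun h => h0 (Subtype.ext h)
    linarith
  exact (LinearMap.injective_iff_surjective_of_finrank_eq_finrank
    (f := QuadraticMap.polarBilin (-(normForm V))) Subspace.dual_finrank_eq.symm).1 hinj d

theorem IsOrthonormal.polar_eq_zero {n : ℕ} {e : Module.Basis (Fin n) ℝ V} (he : IsOrthonormal e)
    {i j : Fin n} (hij : i ≠ j) : QuadraticMap.polar (-(normForm V)) (e i) (e j) = 0 := by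
  have := he i j
  rw [if_neg hij, innerForm_apply, neg_eq_zero] at this
  rw [polar_neg_normForm, this, mul_zero]

theorem IsOrthonormal.ι_mul_self {n : ℕ} {e : Module.Basis (Fin n) ℝ V} (he : IsOrthonormal e)
    (i : Fin n) : ι (-(normForm V)) (e i) * ι (-(normForm V)) (e i) = -1 := by
  have := he i i
  rw [if_pos rfl, innerForm_apply] at this
  rw [ι_sq_scalar, neg_normForm_apply, ← neg_eq_iff_eq_neg.2 this.symm, map_neg, map_one]

theorem IsOrthonormal.ι_mul_ι {n : ℕ} {e : Module.Basis (Fin n) ℝ V} (he : IsOrthonormal e)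
    {i j : Fin n} (hij : i ≠ j) : ι (-(normForm V)) (e i) * ι (-(normForm V)) (e j) =
      -(ι (-(normForm V)) (e j) * ι (-(normForm V)) (e i)) := by
  rw [eq_neg_iff_add_eq_zero, ι_mul_ι_add_swap, he.polar_eq_zero hij, map_zero]

/-- Both Gram matrices are the identity, so the transition matrix is orthogonal. -/
theorem IsOrthonormal.det_eq_one_or_neg_one {n : ℕ} {e f : Module.Basis (Fin n) ℝ V}
    (he : IsOrthonormal e) (hf : IsOrthonormal f) : e.det f = 1 ∨ e.det f = -1 := by
  have h1 : ∀ {b : Module.Basis (Fin n) ℝ V}, IsOrthonormal b →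
      LinearMap.BilinForm.toMatrix b (innerForm V) = 1 := by
    intro b hb
    ext i j
    rw [LinearMap.BilinForm.toMatrix_apply, hb, Matrix.one_apply]
  have h2 := congrArg Matrix.det (LinearMap.BilinForm.toMatrix_mul_basis_toMatrix e f (innerForm V))
  rw [h1 he, h1 hf, Matrix.mul_one, Matrix.det_mul, Matrix.det_transpose, Matrix.det_one] at h2
  rw [Module.Basis.det_apply]
  exact mul_self_eq_one_iff.1 h2

end Form

section CliffordRep

variable {L : Type*} [LieRing L] [LieAlgebra ℝ L] {V : Submodule ℝ L}
  {S : Type*} [NormedAddCommGroup S] [NormedSpace ℂ S]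

open CliffordAlgebra

/-- The action of the real Clifford algebra on a module over its complexification. -/
noncomputable def cliffordAction (σ : ComplexCl V →ₐ[ℂ] (S →L[ℂ] S)) :
    Cl V →ₐ[ℝ] Module.End ℂ S where
  toFun x := (σ ((1 : ℂ) ⊗ₜ[ℝ] x) : S →L[ℂ] S)
  map_one' := by
    rw [← Algebra.TensorProduct.one_def, map_one]; rfl
  map_mul' x y := by
    rw [← one_mul (1 : ℂ), ← Algebra.TensorProduct.tmul_mul_tmul, map_mul, one_mul]; rfl
  map_zero' := by rw [TensorProduct.tmul_zero, map_zero]; rfl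
  map_add' x y := by rw [TensorProduct.tmul_add, map_add]; rfl
  commutes' r := by
    have : (1 : ℂ) ⊗ₜ[ℝ] algebraMap ℝ (Cl V) r = (r : ℂ) • (1 : ComplexCl V) := by
      rw [Algebra.algebraMap_eq_smul_one, TensorProduct.tmul_smul, Algebra.TensorProduct.one_def]
      rfl
    rw [this, map_smul, map_one]
    rfl

theorem cliffordAction_apply (σ : ComplexCl V →ₐ[ℂ] (S →L[ℂ] S)) (x : Cl V) :
    cliffordAction σ x = (σ ((1 : ℂ) ⊗ₜ[ℝ] x) : S →L[ℂ] S) := rfl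

theorem apply_tmul_eq_smul (σ : ComplexCl V →ₐ[ℂ] (S →L[ℂ] S)) (z : ℂ) (x : Cl V) :
    ((σ (z ⊗ₜ[ℝ] x) : S →L[ℂ] S) : Module.End ℂ S) = z • cliffordAction σ x := by
  have : z ⊗ₜ[ℝ] x = z • ((1 : ℂ) ⊗ₜ[ℝ] x) := by
    rw [TensorProduct.smul_tmul', smul_eq_mul, mul_one]
  rw [this, map_smul, cliffordAction_apply]
  rfl

/-- A subspace that is invariant under the action of a basis of `V` is invariant under the complex
Clifford algebra. -/
theorem invariant_of_basis {n : ℕ} (e : Module.Basis (Fin n) ℝ V)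
    (σ : ComplexCl V →ₐ[ℂ] (S →L[ℂ] S)) (W : Submodule ℂ S)
    (hW : ∀ i, ∀ w ∈ W, cliffordAction σ (ι _ (e i)) w ∈ W) (a : ComplexCl V) :
    ∀ w ∈ W, σ a w ∈ W := by
  have hι : ∀ v : V, ∀ w ∈ W, cliffordAction σ (ι _ v) w ∈ W := by
    intro v w hw
    rw [← e.sum_repr v, map_sum, map_sum, LinearMap.sum_apply]
    refine Submodule.sum_mem _ fun i _ => ?_
    rw [map_smul, map_smul, LinearMap.smul_apply]
    exact (W.restrictScalars ℝ).smul_mem _ (hW i w hw)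
  have hx : ∀ x : Cl V, ∀ w ∈ W, cliffordAction σ x w ∈ W := by
    intro x
    induction x using CliffordAlgebra.induction with
    | algebraMap r =>
      intro w hw
      rw [AlgHom.commutes]
      exact (W.restrictScalars ℝ).smul_mem r hw
    | ι v => exact hι v
    | mul x y hx hy =>
      intro w hw
      rw [map_mul]
      exact hx _ (hy _ hw)
    | add x y hx hy =>
      intro w hw
      rw [map_add]
      exact W.add_mem (hx _ hw) (hy _ hw)
  intro w hw
  induction a using TensorProduct.induction_on with
  | zero => rw [map_zero]; exact W.zero_mem
  | tmul z x =>
    have := DFunLike.congr_fun (apply_tmul_eq_smul σ z x) w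
    exact this ▸ W.smul_mem z (hx x w hw)
  | add a b ha hb => rw [map_add]; exact W.add_mem ha hb

/-- The operators `σ(e_{2k})`. -/
noncomputable def evenAction {m : ℕ} (σ : ComplexCl V →ₐ[ℂ] (S →L[ℂ] S))
    (e : Module.Basis (Fin (2 * m)) ℝ V) (k : Fin m) : Module.End ℂ S :=
  cliffordAction σ (ι _ (e ⟨2 * k, by omega⟩))

/-- The operators `σ(e_{2k+1})`. -/
noncomputable def oddAction {m : ℕ} (σ : ComplexCl V →ₐ[ℂ] (S →L[ℂ] S))
    (e : Module.Basis (Fin (2 * m)) ℝ V) (k : Fin m) : Module.End ℂ S :=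
  cliffordAction σ (ι _ (e ⟨2 * k + 1, by omega⟩))

theorem IsOrthonormal.isCliffordFamily {m : ℕ} {e : Module.Basis (Fin (2 * m)) ℝ V}
    (he : IsOrthonormal e) (σ : ComplexCl V →ₐ[ℂ] (S →L[ℂ] S)) :
    IsCliffordFamily (evenAction σ e) (oddAction σ e) where
  sq_left k := by rw [evenAction, ← map_mul, he.ι_mul_self, map_neg, map_one]
  sq_right k := by rw [oddAction, ← map_mul, he.ι_mul_self, map_neg, map_one]
  anti_left k l hkl := by
    rw [evenAction, evenAction, ← map_mul, he.ι_mul_ι (by simpa [Fin.ext_iff] using hkl), map_neg,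
      map_mul]
  anti_right k l hkl := by
    rw [oddAction, oddAction, ← map_mul, he.ι_mul_ι (by simpa [Fin.ext_iff] using hkl), map_neg,
      map_mul]
  anti k l := by
    rw [evenAction, oddAction, ← map_mul, he.ι_mul_ι (by simp only [ne_eq, Fin.mk.injEq]; omega),
      map_neg, map_mul]

/-- A basis of the spinor space that diagonalizes the operators `i σ(e_{2k} e_{2k+1})`. -/
theorem IsOrthonormal.exists_spinorBasis {m : ℕ} {e : Module.Basis (Fin (2 * m)) ℝ V}
    (he : IsOrthonormal e) {σ : ComplexCl V →ₐ[ℂ] (S →L[ℂ] S)} (hσ : IsIrreducibleRep σ) :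
    ∃ s : Module.Basis (Fin m → ℤˣ) ℂ S, ∀ ε k,
      IsCliffordFamily.sign (evenAction σ e) (oddAction σ e) k (s ε) = ((ε k : ℤ) : ℂ) • s ε := by
  have := hσ.1
  refine (he.isCliffordFamily σ).exists_basis fun W hW => hσ.2 W (invariant_of_basis e σ W ?_)
  intro i w hw
  obtain ⟨k, rfl | rfl⟩ := fin_two_mul_cases i
  · exact (hW k w hw).1
  · exact (hW k w hw).2

/-- The product of `2 * m` vectors is grouped into consecutive pairs. -/
theorem apply_volumeElement {m : ℕ} (e : Module.Basis (Fin (2 * m)) ℝ V)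
    (σ : ComplexCl V →ₐ[ℂ] (S →L[ℂ] S)) :
    ((σ (volumeElement e) : S →L[ℂ] S) : Module.End ℂ S) =
      IsCliffordFamily.volume (evenAction σ e) (oddAction σ e) := by
  rw [volumeElement, apply_tmul_eq_smul, IsCliffordFamily.volume, List.ofFn_mul', List.prod_flatten,
    map_list_prod, List.map_ofFn, List.map_ofFn]
  congr 3
  funext k
  simp [evenAction, oddAction]

theorem IsOrthonormal.volumeElement_eq {m : ℕ} {e f : Module.Basis (Fin (2 * m)) ℝ V}
    (he : IsOrthonormal e) (hf : IsOrthonormal f) :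
    volumeElement f = (e.det f : ℂ) • volumeElement e := by
  rw [volumeElement, volumeElement, CliffordAlgebra.prod_ofFn_ι_eq_det_smul e f
    (fun i j => he.polar_eq_zero) (fun i j => hf.polar_eq_zero), TensorProduct.tmul_smul]
  rfl

/-- The volume element commutes with the even part of the Clifford algebra. -/
theorem IsOrthonormal.volume_commute {m : ℕ} {e : Module.Basis (Fin (2 * m)) ℝ V}
    (he : IsOrthonormal e) {σ : ComplexCl V →ₐ[ℂ] (S →L[ℂ] S)} (hσ : IsIrreducibleRep σ)
    {x : Cl V} (hx : x ∈ CliffordAlgebra.even (-(normForm V))) :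
    Commute (IsCliffordFamily.volume (evenAction σ e) (oddAction σ e)) (cliffordAction σ x) := by
  obtain ⟨s, hs⟩ := he.exists_spinorBasis hσ
  have hfam := he.isCliffordFamily σ
  -- The volume operator anticommutes with each vector, so it commutes with products of two, which
  -- generate the even part.
  have hι : ∀ v : V, IsCliffordFamily.volume (evenAction σ e) (oddAction σ e) *
      cliffordAction σ (ι _ v) = -(cliffordAction σ (ι _ v) *
        IsCliffordFamily.volume (evenAction σ e) (oddAction σ e)) := by
    intro v
    rw [← e.sum_repr v, map_sum, map_sum, Finset.mul_sum, Finset.sum_mul, ← Finset.sum_neg_distrib]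
    refine Finset.sum_congr rfl fun i _ => ?_
    rw [map_smul, map_smul, mul_smul_comm, smul_mul_assoc, ← smul_neg]
    congr 1
    obtain ⟨k, rfl | rfl⟩ := fin_two_mul_cases i
    · exact IsCliffordFamily.volume_anticommute_of_flip hs k (hfam.mul_sign_self k)
        fun l => hfam.mul_sign_of_ne
    · exact IsCliffordFamily.volume_anticommute_of_flip hs k (hfam.mul_sign_right_self k)
        fun l => hfam.mul_sign_right_of_ne
  change x ∈ evenOdd (-(normForm V)) 0 at hx
  induction x, hx using CliffordAlgebra.even_induction with
  | algebraMap r => rw [AlgHom.commutes]; exact Algebra.commute_algebraMap_right _ _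
  | add x y hx hy ihx ihy => rw [map_add]; exact ihx.add_right ihy
  | ι_mul_ι_mul u v x hx ih =>
    rw [map_mul, map_mul]
    refine Commute.mul_right ?_ ih
    rw [Commute, SemiconjBy, ← mul_assoc, hι, neg_mul, mul_assoc, hι, mul_neg, neg_neg, mul_assoc]

/-- The weight computation: $e_{2k}e_{2k+1}$ acts by $-i\varepsilon_k$, and
$i\operatorname{Im}\alpha_k(Y)=\alpha_k(Y)$, so
$-\frac12\operatorname{Im}\alpha_k(Y)\cdot(-i\varepsilon_k)=\frac12\varepsilon_k\alpha_k(Y)$. -/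
theorem cliffordAction_rotationElement {m : ℕ} (e : Module.Basis (Fin (2 * m)) ℝ V)
    (σ : ComplexCl V →ₐ[ℂ] (S →L[ℂ] S)) {𝔱 : LieSubalgebra ℝ L} (α : Fin m → (𝔱 →ₗ[ℝ] ℂ)) (Y : 𝔱)
    (hα : ∀ k, (α k Y).re = 0) {s : S} {ε : Fin m → ℤˣ}
    (hs : ∀ k, IsCliffordFamily.sign (evenAction σ e) (oddAction σ e) k s = ((ε k : ℤ) : ℂ) • s) :
    cliffordAction σ (rotationElement _ e fun k => (α k Y).im) s = signedHalfSum α ε Y • s := by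
  have h1 : ∀ k, (evenAction σ e k * oddAction σ e k) s = (-Complex.I * ((ε k : ℤ) : ℂ)) • s := by
    intro k
    rw [mul_smul, ← hs, IsCliffordFamily.sign, LinearMap.smul_apply, smul_smul, neg_mul,
      Complex.I_mul_I, neg_neg, one_smul]
  have h2 : ∀ (r : ℝ) (T : Module.End ℂ S), (r • T) s = (r : ℂ) • T s := fun r T => rfl
  rw [rotationElement, map_smul, map_sum, h2, LinearMap.sum_apply, signedHalfSum,
    LinearMap.smul_apply, LinearMap.sum_apply, Complex.real_smul, mul_smul, Finset.sum_smul,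
    Finset.smul_sum, Finset.smul_sum]
  refine Finset.sum_congr rfl fun k _ => ?_
  have h3 : α k Y = ((α k Y).im : ℂ) * Complex.I := by
    conv_lhs => rw [← Complex.re_add_im (α k Y), hα, Complex.ofReal_zero, zero_add]
  have h4 := h1 k
  rw [evenAction, oddAction, ← map_mul] at h4
  rw [map_smul, h2, h4, LinearMap.smul_apply, Complex.real_smul]
  conv_rhs => rw [h3]
  rw [smul_smul, smul_smul, smul_smul]
  congr 1
  push_cast
  ring

end CliffordRep

end SymmetricSpin

/-! ### The torus action on spinors -/

namespace SymmetricSpin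

open CliffordAlgebra

section Weights

variable {E : Type*} [NormedAddCommGroup E] [NormedSpace ℝ E] [FiniteDimensional ℝ E]
  {G : Type*} [TopologicalSpace G] [ChartedSpace E G] [Group G] [LieGroup 𝓘(ℝ, E) ∞ G]
  {F : Type*} [NormedAddCommGroup F] [NormedSpace ℝ F]
  {H : Type*} [TopologicalSpace H] [ChartedSpace F H] [Group H]
  {θ : GroupLieAlgebra 𝓘(ℝ, E) G ≃ₗ⁅ℝ⁆ GroupLieAlgebra 𝓘(ℝ, E) G}
  {j : H →* G} {ρ : H →* Spin (minusSubspace θ)}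
  {𝔱 : LieSubalgebra ℝ (GroupLieAlgebra 𝓘(ℝ, E) G)}

/-- The differential of a lift to the spin group, on the torus. -/
theorem weakDifferential_spinLift
    (hneg : ∀ X : GroupLieAlgebra 𝓘(ℝ, E) G, X ≠ 0 →
      killingForm ℝ (GroupLieAlgebra 𝓘(ℝ, E) G) X X < 0)
    (hj : MDifferentiableAt 𝓘(ℝ, F) 𝓘(ℝ, E) j 1)
    (hρ : IsSpinLift (E := E) (F := F) j (minusSubspace θ) ρ) (h𝔱_le : 𝔱 ≤ fixedSubalgebra θ)
    {m : ℕ} {α : Fin m → (𝔱 →ₗ[ℝ] ℂ)} (hroot : ∀ k, α k ∈ roots 𝔱)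
    {e : Module.Basis (Fin (2 * m)) ℝ (minusSubspace θ)} (he : IsOrthonormal e)
    (heα : IsRootBasis α e) (X : F) (Y : 𝔱)
    (hXY : homDifferential (E := E) (F := F) j X = (Y : GroupLieAlgebra 𝓘(ℝ, E) G))
    (z : Cl (minusSubspace θ))
    (hz : HasWeakDeriv (fun t => (ρ (chartCurve 1 X t) : Cl (minusSubspace θ))) z) :
    z = rotationElement _ e fun k => (α k Y).im := by
  have : FiniteDimensional ℝ (GroupLieAlgebra 𝓘(ℝ, E) G) := inferInstanceAs (FiniteDimensional ℝ E)
  obtain ⟨h1, h2, h3⟩ := weakDifferential_spinLift_properties hj hρ X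
    ⟨(Y : GroupLieAlgebra 𝓘(ℝ, E) G), h𝔱_le Y.2⟩ hXY z hz
  have hanti : ∀ i k, i ≠ k → ι (-(normForm (minusSubspace θ))) (e i) * ι _ (e k) =
      -(ι _ (e k) * ι _ (e i)) := fun i k => he.ι_mul_ι
  -- Both elements are even and skew, and both have $\operatorname{ad}Y$ on $\mathfrak p$ as their
  -- commutator with vectors.
  refine CliffordAlgebra.eq_of_commutator_eq (polarBilin_neg_normForm_surjective hneg) h1
    (involute_rotationElement _ _) h2 (star_rotationElement hanti _) fun v => ?_
  rw [h3, rotationElement_commutator e he.ι_mul_self hanti]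
  intro k
  obtain ⟨h4, h5⟩ := lie_of_mkT_mem_rootSpace hneg (hroot k) (heα k) Y
  exact ⟨Subtype.ext h4, Subtype.ext h5⟩

end Weights

section Weights

variable {E : Type*} [NormedAddCommGroup E] [NormedSpace ℝ E] [FiniteDimensional ℝ E]
  {G : Type*} [TopologicalSpace G] [ChartedSpace E G] [Group G] [LieGroup 𝓘(ℝ, E) ∞ G]
  {F : Type*} [NormedAddCommGroup F] [NormedSpace ℝ F]
  {H : Type*} [TopologicalSpace H] [ChartedSpace F H] [Group H]
  {j : H →* G} {𝔱 : LieSubalgebra ℝ (GroupLieAlgebra 𝓘(ℝ, E) G)}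
  {S : Type*} [NormedAddCommGroup S] [NormedSpace ℂ S]

/-- The weight space in terms of the operators by which the torus acts. -/
theorem mem_weightSpace_iff {χ : H →* (S →L[ℂ] S)} {D : 𝔱 → S → S}
    (hsurj : ∀ Y : 𝔱, ∃ X : GroupLieAlgebra 𝓘(ℝ, F) H,
      homDifferential (E := E) (F := F) j X = (Y : GroupLieAlgebra 𝓘(ℝ, E) G))
    (hD : ∀ (X : GroupLieAlgebra 𝓘(ℝ, F) H) (Y : 𝔱),
      homDifferential (E := E) (F := F) j X = (Y : GroupLieAlgebra 𝓘(ℝ, E) G) →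
      ∀ x, repDifferential (F := F) χ X x = D Y x) (μ : 𝔱 →ₗ[ℝ] ℂ) (x : S) :
    x ∈ weightSpace (F := F) j 𝔱 χ μ ↔ ∀ Y, D Y x = μ Y • x := by
  simp only [weightSpace, Submodule.mem_iInf, Module.End.mem_eigenspace_iff]
  constructor
  · intro h Y
    obtain ⟨X, hX⟩ := hsurj Y
    rw [← hD X Y hX]
    exact h X Y hX
  · intro h X Y hXY
    rw [← h Y, ← hD X Y hXY]
    rfl

end Weights

end SymmetricSpin

/-! ### Weights of the spinor and half spinor representations -/

namespace SymmetricSpin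

open CliffordAlgebra

theorem rotationElement_mem_even {M : Type*} [AddCommGroup M] [Module ℝ M] {Q : QuadraticForm ℝ M}
    {m : ℕ} (e : Fin (2 * m) → M) (a : Fin m → ℝ) : rotationElement Q e a ∈ even Q :=
  Submodule.smul_mem (evenOdd Q 0) _ <| Submodule.sum_mem _ fun _ _ =>
    Submodule.smul_mem _ _ (ι_mul_ι_mem_evenOdd_zero Q _ _)

theorem exists_eigenvector_iff_of_diagonal {ι T S : Type*} [AddCommGroup S] [Module ℂ S]
    (s : Module.Basis ι ℂ S) {D : T → Module.End ℂ S} {c : ι → T → ℂ}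
    (hD : ∀ t i, D t (s i) = c i t • s i) {A : Set ι} {W : Submodule ℂ S}
    (hW : ∀ x, x ∈ W ↔ ∀ i, s.repr x i ≠ 0 → i ∈ A) (μ : T → ℂ) :
    (∃ x ∈ W, x ≠ 0 ∧ ∀ t, D t x = μ t • x) ↔ ∃ i ∈ A, c i = μ := by
  constructor
  · rintro ⟨x, hxW, hx0, hx⟩
    obtain ⟨i, hi⟩ : ∃ i, s.repr x i ≠ 0 := by
      by_contra! h
      exact hx0 (s.repr.map_eq_zero_iff.1 (Finsupp.ext h))
    exact ⟨i, (hW x).1 hxW i hi, funext fun t =>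
      (s.apply_eq_smul_iff_of_diagonal (hD t) x (μ t)).1 (hx t) i hi⟩
  · rintro ⟨i, hi, rfl⟩
    refine ⟨s i, (hW _).2 fun k hk => ?_, s.ne_zero i, fun t => hD t i⟩
    classical
    rw [s.repr_self, Finsupp.single_apply] at hk
    have : i = k := by
      by_contra h
      exact hk (if_neg h)
    exact this ▸ hi

section Volume

variable {L : Type*} [LieRing L] [LieAlgebra ℝ L] {V : Submodule ℝ L}
  {S : Type*} [NormedAddCommGroup S] [NormedSpace ℂ S] {m : ℕ}
  {e e' : Module.Basis (Fin (2 * m)) ℝ V} {σ : ComplexCl V →ₐ[ℂ] (S →L[ℂ] S)}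

theorem IsOrthonormal.apply_volumeElement (he : IsOrthonormal e) (he' : IsOrthonormal e') {v : ℤˣ}
    (hv : e.det e' = ((v : ℤ) : ℝ)) :
    ((σ (volumeElement e') : S →L[ℂ] S) : Module.End ℂ S) =
      ((v : ℤ) : ℂ) • IsCliffordFamily.volume (evenAction σ e) (oddAction σ e) := by
  rw [he.volumeElement_eq he', map_smul, hv, ← SymmetricSpin.apply_volumeElement,
    Complex.ofReal_intCast]
  rfl

/-- The basis `s` diagonalizes the involutions of `e`, while the eigenspace belongs to `e'`. The
unit `v` compares the two orientations, so the volume element of `e'` acts on `s ε` by `v` times the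
product of signs. -/
theorem IsOrthonormal.mem_actionEigenspace_iff (he : IsOrthonormal e) (he' : IsOrthonormal e')
    {v : ℤˣ} (hv : e.det e' = ((v : ℤ) : ℝ)) {s : Module.Basis (Fin m → ℤˣ) ℂ S}
    (hs : ∀ ε k, IsCliffordFamily.sign (evenAction σ e) (oddAction σ e) k (s ε) =
      ((ε k : ℤ) : ℂ) • s ε) (u : ℤˣ) (x : S) :
    x ∈ actionEigenspace σ (volumeElement e') ((u : ℤ) : ℂ) ↔
      ∀ ε, s.repr x ε ≠ 0 → ε ∈ {ε : Fin m → ℤˣ | v * ∏ k, ε k = u} := by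
  rw [actionEigenspace, Module.End.mem_eigenspace_iff, he.apply_volumeElement he' hv,
    s.apply_eq_smul_iff_of_diagonal (c := fun ε => (((v * ∏ k, ε k : ℤˣ) : ℤ) : ℂ))]
  · simp only [Int.cast_inj, Units.val_inj, Set.mem_ofPred_eq]
  · intro ε
    rw [LinearMap.smul_apply, IsCliffordFamily.volume_apply_basis hs, smul_smul, Units.val_mul,
      Int.cast_mul]

theorem IsOrthonormal.isCompl_actionEigenspace (he : IsOrthonormal e) (hσ : IsIrreducibleRep σ) :
    IsCompl (actionEigenspace σ (volumeElement e) 1)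
      (actionEigenspace σ (volumeElement e) (-1)) := by
  obtain ⟨s, hs⟩ := he.exists_spinorBasis hσ
  refine Module.End.isCompl_eigenspace_of_mul_self ?_
  rw [SymmetricSpin.apply_volumeElement]
  exact IsCliffordFamily.volume_mul_self hs

theorem IsOrthonormal.cliffordAction_mem_actionEigenspace (he : IsOrthonormal e)
    (hσ : IsIrreducibleRep σ) {x : Cl V} (hx : x ∈ even (-(normForm V))) {c : ℂ} {w : S}
    (hw : w ∈ actionEigenspace σ (volumeElement e) c) :
    cliffordAction σ x w ∈ actionEigenspace σ (volumeElement e) c := by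
  rw [actionEigenspace, SymmetricSpin.apply_volumeElement, Module.End.mem_eigenspace_iff] at hw ⊢
  have := DFunLike.congr_fun (he.volume_commute hσ hx).eq w
  rw [Module.End.mul_apply, Module.End.mul_apply, hw, map_smul] at this
  exact this

theorem setOf_mul_prod_eq_self (u : ℤˣ) :
    {ε : Fin m → ℤˣ | u * ∏ k, ε k = u} = evenSigns m := by
  ext ε
  rw [Set.mem_ofPred_eq, ← prod_eq_one_iff_mem_evenSigns, mul_eq_left]

theorem setOf_mul_prod_eq_neg (u : ℤˣ) :
    {ε : Fin m → ℤˣ | u * ∏ k, ε k = -u} = (evenSigns m)ᶜ := by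
  ext ε
  rw [Set.mem_ofPred_eq, Set.mem_compl_iff, ← prod_eq_one_iff_mem_evenSigns, ← mul_neg_one u,
    mul_right_inj]
  exact Int.units_ne_iff_eq_neg.symm

end Volume

section Lift

variable {E : Type*} [NormedAddCommGroup E] [NormedSpace ℝ E] [FiniteDimensional ℝ E]
  {G : Type*} [TopologicalSpace G] [ChartedSpace E G] [Group G] [LieGroup 𝓘(ℝ, E) ∞ G]
  {F : Type*} [NormedAddCommGroup F] [NormedSpace ℝ F]
  {H : Type*} [TopologicalSpace H] [ChartedSpace F H] [Group H]
  {θ : GroupLieAlgebra 𝓘(ℝ, E) G ≃ₗ⁅ℝ⁆ GroupLieAlgebra 𝓘(ℝ, E) G}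
  {j : H →* G} {ρ : H →* Spin (minusSubspace θ)}
  {𝔱 : LieSubalgebra ℝ (GroupLieAlgebra 𝓘(ℝ, E) G)}
  {S : Type*} [NormedAddCommGroup S] [NormedSpace ℂ S] [FiniteDimensional ℂ S]
  {σ : ComplexCl (minusSubspace θ) →ₐ[ℂ] (S →L[ℂ] S)}

theorem repDifferential_spinorRep
    (hneg : ∀ X : GroupLieAlgebra 𝓘(ℝ, E) G, X ≠ 0 →
      killingForm ℝ (GroupLieAlgebra 𝓘(ℝ, E) G) X X < 0)
    (hj : MDifferentiableAt 𝓘(ℝ, F) 𝓘(ℝ, E) j 1)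
    (hρ : IsSpinLift (E := E) (F := F) j (minusSubspace θ) ρ) (h𝔱_le : 𝔱 ≤ fixedSubalgebra θ)
    {m : ℕ} {α : Fin m → (𝔱 →ₗ[ℝ] ℂ)} (hroot : ∀ k, α k ∈ roots 𝔱)
    {e : Module.Basis (Fin (2 * m)) ℝ (minusSubspace θ)} (he : IsOrthonormal e)
    (heα : IsRootBasis α e) (X : F) (Y : 𝔱)
    (hXY : homDifferential (E := E) (F := F) j X = (Y : GroupLieAlgebra 𝓘(ℝ, E) G)) (x : S) :
    repDifferential (F := F) (spinorRep σ ρ) X x =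
      cliffordAction σ (rotationElement _ e fun k => (α k Y).im) x := by
  have : FiniteDimensional ℝ (GroupLieAlgebra 𝓘(ℝ, E) G) := inferInstanceAs (FiniteDimensional ℝ E)
  let T : Cl (minusSubspace θ) →ₗ[ℝ] (S →L[ℂ] S) :=
    (σ.toLinearMap.restrictScalars ℝ) ∘ₗ (TensorProduct.mk ℝ ℂ _ 1)
  rw [repDifferential_eq_of_linear hρ.smooth (spinorRep σ ρ) T (fun h => rfl) X,
    weakDifferential_spinLift hneg hj hρ h𝔱_le hroot he heα X Y hXY _
      (hasWeakDeriv_weakDifferential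
        (fun f => ((hρ.smooth f).contMDiffAt (x := 1)).mdifferentiableAt (by simp)) X)]
  rfl

theorem repDifferential_restrictRep_spinorRep
    (hneg : ∀ X : GroupLieAlgebra 𝓘(ℝ, E) G, X ≠ 0 →
      killingForm ℝ (GroupLieAlgebra 𝓘(ℝ, E) G) X X < 0)
    (hj : MDifferentiableAt 𝓘(ℝ, F) 𝓘(ℝ, E) j 1)
    (hρ : IsSpinLift (E := E) (F := F) j (minusSubspace θ) ρ) (h𝔱_le : 𝔱 ≤ fixedSubalgebra θ)
    {m : ℕ} {α : Fin m → (𝔱 →ₗ[ℝ] ℂ)} (hroot : ∀ k, α k ∈ roots 𝔱)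
    {e : Module.Basis (Fin (2 * m)) ℝ (minusSubspace θ)} (he : IsOrthonormal e)
    (heα : IsRootBasis α e) (X : F) (Y : 𝔱)
    (hXY : homDifferential (E := E) (F := F) j X = (Y : GroupLieAlgebra 𝓘(ℝ, E) G))
    {W : Submodule ℂ S} (hW : ∀ h, ∀ w ∈ W, spinorRep σ ρ h w ∈ W)
    (hWe : ∀ x ∈ even (-(normForm (minusSubspace θ))), ∀ w ∈ W, cliffordAction σ x w ∈ W) (w : W) :
    repDifferential (F := F) (restrictRep (spinorRep σ ρ) W hW) X w =
      ⟨cliffordAction σ (rotationElement _ e fun k => (α k Y).im) w,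
        hWe _ (rotationElement_mem_even _ _) w w.2⟩ := by
  have : FiniteDimensional ℝ (GroupLieAlgebra 𝓘(ℝ, E) G) := inferInstanceAs (FiniteDimensional ℝ E)
  -- Only the even part of the Clifford algebra preserves `W`. Composing with a projection onto `W`
  -- gives a linear map on the whole algebra, as differentiation requires, which agrees with the
  -- restricted action on the even part.
  obtain ⟨π, hπ⟩ := LinearMap.exists_leftInverse_of_injective W.subtype W.ker_subtype
  have hπ' : ∀ w : W, π w = w := fun w => DFunLike.congr_fun hπ w
  let T : Cl (minusSubspace θ) →ₗ[ℝ] (S →L[ℂ] S) :=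
    (σ.toLinearMap.restrictScalars ℝ) ∘ₗ (TensorProduct.mk ℝ ℂ _ 1)
  let TW : Cl (minusSubspace θ) →ₗ[ℝ] (W →L[ℂ] W) :=
    { toFun := fun x => (LinearMap.toContinuousLinearMap π).comp ((T x).comp W.subtypeL)
      map_add' := fun x y => by ext w; simp
      map_smul' := fun r x => by
        ext w
        rw [map_smul]
        exact congrArg Subtype.val (map_smul π (r : ℂ) (T x w)) }
  have hTW : ∀ x ∈ even (-(normForm (minusSubspace θ))), ∀ w : W,
      TW x w = (cliffordAction σ x w : S) := fun x hx w =>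
    congrArg Subtype.val (hπ' ⟨cliffordAction σ x w, hWe x hx w w.2⟩)
  rw [repDifferential_eq_of_linear hρ.smooth (restrictRep (spinorRep σ ρ) W hW) TW
      (fun h => ContinuousLinearMap.ext fun w => Subtype.ext
        (hTW _ (spinGroup.mem_even (ρ h).2) w).symm) X,
    weakDifferential_spinLift hneg hj hρ h𝔱_le hroot he heα X Y hXY _
      (hasWeakDeriv_weakDifferential
        (fun f => ((hρ.smooth f).contMDiffAt (x := 1)).mdifferentiableAt (by simp)) X)]
  exact Subtype.ext (hTW _ (rotationElement_mem_even _ _) w)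

theorem finrank_weightSpace_spinorRep
    (hneg : ∀ X : GroupLieAlgebra 𝓘(ℝ, E) G, X ≠ 0 →
      killingForm ℝ (GroupLieAlgebra 𝓘(ℝ, E) G) X X < 0)
    (hj : MDifferentiableAt 𝓘(ℝ, F) 𝓘(ℝ, E) j 1)
    (hsurj : ∀ Y : 𝔱, ∃ X : GroupLieAlgebra 𝓘(ℝ, F) H,
      homDifferential (E := E) (F := F) j X = (Y : GroupLieAlgebra 𝓘(ℝ, E) G))
    (hρ : IsSpinLift (E := E) (F := F) j (minusSubspace θ) ρ) (h𝔱_le : 𝔱 ≤ fixedSubalgebra θ)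
    {m : ℕ} {α : Fin m → (𝔱 →ₗ[ℝ] ℂ)} (hroot : ∀ k, α k ∈ roots 𝔱)
    {e : Module.Basis (Fin (2 * m)) ℝ (minusSubspace θ)} (he : IsOrthonormal e)
    (heα : IsRootBasis α e)
    {s : Module.Basis (Fin m → ℤˣ) ℂ S} (hs : ∀ ε k,
      IsCliffordFamily.sign (evenAction σ e) (oddAction σ e) k (s ε) = ((ε k : ℤ) : ℂ) • s ε)
    (μ : 𝔱 →ₗ[ℝ] ℂ) :
    Module.finrank ℂ (weightSpace (F := F) j 𝔱 (spinorRep σ ρ) μ) =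
      Set.ncard {ε : Fin m → ℤˣ | signedHalfSum α ε = μ} := by
  have hD : ∀ (Y : 𝔱) ε, cliffordAction σ (rotationElement _ e fun k => (α k Y).im) (s ε) =
      signedHalfSum α ε Y • s ε := fun Y ε =>
    cliffordAction_rotationElement e σ α Y
      (fun k => re_eq_zero_of_rootSpace_ne_bot hneg (hroot k).2 Y) (hs ε)
  rw [s.finrank_of_simultaneous_eigenspace (c := fun ε Y => signedHalfSum α ε Y) hD μ]
  · simp only [DFunLike.coe_fn_eq]
  · intro x
    exact mem_weightSpace_iff hsurj
      (repDifferential_spinorRep hneg hj hρ h𝔱_le hroot he heα) μ x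

theorem weights_restrictRep_spinorRep
    (hneg : ∀ X : GroupLieAlgebra 𝓘(ℝ, E) G, X ≠ 0 →
      killingForm ℝ (GroupLieAlgebra 𝓘(ℝ, E) G) X X < 0)
    (hj : MDifferentiableAt 𝓘(ℝ, F) 𝓘(ℝ, E) j 1)
    (hsurj : ∀ Y : 𝔱, ∃ X : GroupLieAlgebra 𝓘(ℝ, F) H,
      homDifferential (E := E) (F := F) j X = (Y : GroupLieAlgebra 𝓘(ℝ, E) G))
    (hρ : IsSpinLift (E := E) (F := F) j (minusSubspace θ) ρ) (h𝔱_le : 𝔱 ≤ fixedSubalgebra θ)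
    {m : ℕ} {α : Fin m → (𝔱 →ₗ[ℝ] ℂ)} (hroot : ∀ k, α k ∈ roots 𝔱)
    {e : Module.Basis (Fin (2 * m)) ℝ (minusSubspace θ)} (he : IsOrthonormal e)
    (heα : IsRootBasis α e)
    {s : Module.Basis (Fin m → ℤˣ) ℂ S} (hs : ∀ ε k,
      IsCliffordFamily.sign (evenAction σ e) (oddAction σ e) k (s ε) = ((ε k : ℤ) : ℂ) • s ε)
    {W : Submodule ℂ S}
    (hW : ∀ h, ∀ w ∈ W, spinorRep σ ρ h w ∈ W)
    (hWe : ∀ x ∈ even (-(normForm (minusSubspace θ))), ∀ w ∈ W, cliffordAction σ x w ∈ W)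
    {A : Set (Fin m → ℤˣ)} (hA : ∀ x, x ∈ W ↔ ∀ ε, s.repr x ε ≠ 0 → ε ∈ A) :
    weights (F := F) j 𝔱 (restrictRep (spinorRep σ ρ) W hW) = signedHalfSum α '' A := by
  have hD : ∀ (Y : 𝔱) ε, cliffordAction σ (rotationElement _ e fun k => (α k Y).im) (s ε) =
      signedHalfSum α ε Y • s ε := fun Y ε =>
    cliffordAction_rotationElement e σ α Y
      (fun k => re_eq_zero_of_rootSpace_ne_bot hneg (hroot k).2 Y) (hs ε)
  ext μ
  have h1 := exists_eigenvector_iff_of_diagonal s (c := fun ε Y => signedHalfSum α ε Y) hD hA μ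
  simp only [DFunLike.coe_fn_eq] at h1
  rw [Set.mem_image, ← h1, weights, Set.mem_ofPred_eq, Submodule.ne_bot_iff]
  have h2 := fun w => mem_weightSpace_iff (F := F) (χ := restrictRep (spinorRep σ ρ) W hW) hsurj
    (fun X Y hXY => repDifferential_restrictRep_spinorRep hneg hj hρ h𝔱_le hroot he heα X Y hXY
      hW hWe) μ w
  constructor
  · rintro ⟨w, hw, hw0⟩
    exact ⟨w, w.2, fun h => hw0 (Subtype.ext h), fun Y => congrArg Subtype.val ((h2 w).1 hw Y)⟩
  · rintro ⟨x, hx, hx0, h⟩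
    exact ⟨⟨x, hx⟩, (h2 _).2 fun Y => Subtype.ext (h Y), fun h => hx0 (congrArg Subtype.val h)⟩

end Lift

end SymmetricSpin

/-! ### The theorem -/

theorem mainTheorem11
    {E : Type*} [NormedAddCommGroup E] [NormedSpace ℝ E] [FiniteDimensional ℝ E]
    {G : Type*} [TopologicalSpace G] [ChartedSpace E G] [Group G] [LieGroup 𝓘(ℝ, E) ∞ G]
    [T2Space G] [CompactSpace G] [ConnectedSpace G]
    [LieAlgebra.IsSemisimple ℝ (GroupLieAlgebra 𝓘(ℝ, E) G)]
    -- the involution, not the identity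
    (θ : GroupLieAlgebra 𝓘(ℝ, E) G ≃ₗ⁅ℝ⁆ GroupLieAlgebra 𝓘(ℝ, E) G)
    (hθ : ∀ X, θ (θ X) = X) (hθ_ne : ∃ X, θ X ≠ X)
    -- the analytic subgroup `H` of `G` with Lie algebra the fixed points of the involution
    {F : Type*} [NormedAddCommGroup F] [NormedSpace ℝ F] [FiniteDimensional ℝ F]
    {H : Type*} [TopologicalSpace H] [ChartedSpace F H] [Group H] [LieGroup 𝓘(ℝ, F) ∞ H]
    (j : H →* G)
    (hj : SymmetricSpin.IsAnalyticSubgroup (E := E) (F := F) j (SymmetricSpin.fixedSubalgebra θ))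
    -- equal rank: the Lie algebra of a common maximal torus
    (𝔱 : LieSubalgebra ℝ (GroupLieAlgebra 𝓘(ℝ, E) G))
    (h𝔱 : SymmetricSpin.IsMaximalAbelian 𝔱) (h𝔱_le : 𝔱 ≤ SymmetricSpin.fixedSubalgebra θ)
    -- the positive roots, and an enumeration of those in `𝔭`
    (P : Set (𝔱 →ₗ[ℝ] ℂ)) (hP : SymmetricSpin.IsPositiveSystem 𝔱 P)
    (m : ℕ) (α : Fin m → (𝔱 →ₗ[ℝ] ℂ)) (hα : Function.Injective α)
    (hα_range : Set.range α =
      SymmetricSpin.positiveRootsIn 𝔱 P (SymmetricSpin.minusSubspace θ))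
    -- the lift of the adjoint representation to the spin group
    (ρ : H →* SymmetricSpin.Spin (SymmetricSpin.minusSubspace θ))
    (hρ : SymmetricSpin.IsSpinLift (E := E) (F := F) j (SymmetricSpin.minusSubspace θ) ρ)
    -- an irreducible representation of the complexified Clifford algebra
    {S : Type*} [NormedAddCommGroup S] [NormedSpace ℂ S] [FiniteDimensional ℂ S]
    (σ : SymmetricSpin.ComplexCl (SymmetricSpin.minusSubspace θ) →ₐ[ℂ] (S →L[ℂ] S))
    (hσ : SymmetricSpin.IsIrreducibleRep σ) :
    Module.finrank ℝ (SymmetricSpin.minusSubspace θ) = 2 * m ∧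
    -- the weights of the spinor representation, with multiplicities
    SymmetricSpin.weights (F := F) j 𝔱 (SymmetricSpin.spinorRep σ ρ) =
      Set.range (SymmetricSpin.signedHalfSum α) ∧
    (∀ ε : Fin m → ℤˣ,
      Module.finrank ℂ (SymmetricSpin.weightSpace (F := F) j 𝔱 (SymmetricSpin.spinorRep σ ρ)
          (SymmetricSpin.signedHalfSum α ε)) =
        Set.ncard {ε' : Fin m → ℤˣ |
          SymmetricSpin.signedHalfSum α ε' = SymmetricSpin.signedHalfSum α ε}) ∧
    -- the half spinor representations, for either orientation of `𝔭`
    (∃ e : Module.Basis (Fin (2 * m)) ℝ (SymmetricSpin.minusSubspace θ),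
      SymmetricSpin.IsOrthonormal e ∧ SymmetricSpin.IsRootOriented α e) ∧
    ∀ e : Module.Basis (Fin (2 * m)) ℝ (SymmetricSpin.minusSubspace θ),
      SymmetricSpin.IsOrthonormal e →
      IsCompl (SymmetricSpin.actionEigenspace σ (SymmetricSpin.volumeElement e) 1)
        (SymmetricSpin.actionEigenspace σ (SymmetricSpin.volumeElement e) (-1)) ∧
      ∃ (hplus : ∀ h : H,
          ∀ s ∈ SymmetricSpin.actionEigenspace σ (SymmetricSpin.volumeElement e) 1,
            SymmetricSpin.spinorRep σ ρ h s ∈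
              SymmetricSpin.actionEigenspace σ (SymmetricSpin.volumeElement e) 1)
        (hminus : ∀ h : H,
          ∀ s ∈ SymmetricSpin.actionEigenspace σ (SymmetricSpin.volumeElement e) (-1),
            SymmetricSpin.spinorRep σ ρ h s ∈
              SymmetricSpin.actionEigenspace σ (SymmetricSpin.volumeElement e) (-1)),
        (SymmetricSpin.IsRootOriented α e →
          SymmetricSpin.weights (F := F) j 𝔱
              (SymmetricSpin.restrictRep (SymmetricSpin.spinorRep σ ρ) _ hplus) =
            SymmetricSpin.signedHalfSum α '' SymmetricSpin.evenSigns m ∧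
          SymmetricSpin.weights (F := F) j 𝔱
              (SymmetricSpin.restrictRep (SymmetricSpin.spinorRep σ ρ) _ hminus) =
            SymmetricSpin.signedHalfSum α '' (SymmetricSpin.evenSigns m)ᶜ) ∧
        (¬ SymmetricSpin.IsRootOriented α e →
          SymmetricSpin.weights (F := F) j 𝔱
              (SymmetricSpin.restrictRep (SymmetricSpin.spinorRep σ ρ) _ hplus) =
            SymmetricSpin.signedHalfSum α '' (SymmetricSpin.evenSigns m)ᶜ ∧
          SymmetricSpin.weights (F := F) j 𝔱
              (SymmetricSpin.restrictRep (SymmetricSpin.spinorRep σ ρ) _ hminus) =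
            SymmetricSpin.signedHalfSum α '' SymmetricSpin.evenSigns m) := by
  have hfd : FiniteDimensional ℝ (GroupLieAlgebra 𝓘(ℝ, E) G) :=
    inferInstanceAs (FiniteDimensional ℝ E)
  have hneg : ∀ X : GroupLieAlgebra 𝓘(ℝ, E) G, X ≠ 0 →
      killingForm ℝ (GroupLieAlgebra 𝓘(ℝ, E) G) X X < 0 := killingForm_groupLieAlgebra_neg
  have hαP : ∀ k, α k ∈ SymmetricSpin.positiveRootsIn 𝔱 P (SymmetricSpin.minusSubspace θ) :=
    fun k => hα_range ▸ Set.mem_range_self k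
  have hroot : ∀ k, α k ∈ SymmetricSpin.roots 𝔱 := fun k => hP.subset_roots (hαP k).1
  have hopp : ∀ k l, α k ≠ -α l := fun k l h => hP.not_both _ (hαP l).1 (h ▸ (hαP k).1)
  have hj1 : MDifferentiableAt 𝓘(ℝ, F) 𝓘(ℝ, E) j 1 :=
    (hj.smooth.contMDiffAt (x := 1)).mdifferentiableAt (by simp)
  have hsurj : ∀ Y : 𝔱, ∃ X : GroupLieAlgebra 𝓘(ℝ, F) H,
      SymmetricSpin.homDifferential (E := E) (F := F) j X = (Y : GroupLieAlgebra 𝓘(ℝ, E) G) := by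
    intro Y
    have : (Y : GroupLieAlgebra 𝓘(ℝ, E) G) ∈
        Set.range (SymmetricSpin.homDifferential (E := E) (F := F) j) := by
      rw [hj.range_eq]
      exact h𝔱_le Y.2
    exact this
  obtain ⟨f, hf⟩ := exists_isRootBasis hneg h𝔱 hθ h𝔱_le hP hα hα_range
  obtain ⟨e₀, he₀, he₀α, hfe₀⟩ := hf.exists_orthonormal hneg hroot hα hopp
  obtain ⟨s₀, hs₀⟩ := he₀.exists_spinorBasis hσ
  have hrank := SymmetricSpin.finrank_weightSpace_spinorRep hneg hj1 hsurj hρ h𝔱_le hroot he₀ he₀α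
    hs₀
  have := Module.Basis.finiteDimensional_of_finite s₀
  refine ⟨?_, ?_, fun ε => hrank _, ⟨e₀, he₀, f, hf, hfe₀⟩, fun e he => ⟨?_, ?_⟩⟩
  · rw [Module.finrank_eq_card_basis e₀, Fintype.card_fin]
  · ext μ
    -- A weight is a functional whose weight space has nonzero dimension, so the set of weights is
    -- read off from the multiplicity formula.
    rw [SymmetricSpin.weights, Set.mem_ofPred_eq, ← not_iff_not, not_not,
      ← Submodule.finrank_eq_zero, hrank, Set.ncard_eq_zero, Set.eq_empty_iff_forall_notMem]
    simp
  · exact he.isCompl_actionEigenspace hσ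
  · have hWe : ∀ c : ℂ, ∀ x ∈ CliffordAlgebra.even
        (-(SymmetricSpin.normForm (SymmetricSpin.minusSubspace θ))),
        ∀ w ∈ SymmetricSpin.actionEigenspace σ (SymmetricSpin.volumeElement e) c,
          SymmetricSpin.cliffordAction σ x w ∈
            SymmetricSpin.actionEigenspace σ (SymmetricSpin.volumeElement e) c :=
      fun _ _ hx _ hw => he.cliffordAction_mem_actionEigenspace hσ hx hw
    have hinv : ∀ c : ℂ, ∀ h : H,
        ∀ w ∈ SymmetricSpin.actionEigenspace σ (SymmetricSpin.volumeElement e) c,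
          SymmetricSpin.spinorRep σ ρ h w ∈
            SymmetricSpin.actionEigenspace σ (SymmetricSpin.volumeElement e) c :=
      fun c h w hw => hWe c _ (spinGroup.mem_even (ρ h).2) w hw
    refine ⟨hinv 1, hinv (-1), ?_⟩
    have hone : (1 : ℂ) = ((1 : ℤˣ) : ℤ) := by simp
    have hnegone : (-1 : ℂ) = ((-1 : ℤˣ) : ℤ) := by simp
    -- `v` is the orientation of `e` relative to a root basis and `u` the eigenvalue of the volume
    -- element; both half spinor representations and both orientations are instances.
    have key : ∀ {e₁ : Module.Basis (Fin (2 * m)) ℝ (SymmetricSpin.minusSubspace θ)},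
        SymmetricSpin.IsOrthonormal e₁ → IsRootBasis α e₁ → ∀ v : ℤˣ, e₁.det e = ((v : ℤ) : ℝ) →
        ∀ (c : ℂ) (u : ℤˣ), c = ((u : ℤ) : ℂ) →
        ∀ hW : ∀ h : H, ∀ w ∈ SymmetricSpin.actionEigenspace σ (SymmetricSpin.volumeElement e) c,
          SymmetricSpin.spinorRep σ ρ h w ∈
            SymmetricSpin.actionEigenspace σ (SymmetricSpin.volumeElement e) c,
        SymmetricSpin.weights (F := F) j 𝔱
            (SymmetricSpin.restrictRep (SymmetricSpin.spinorRep σ ρ) _ hW) =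
          SymmetricSpin.signedHalfSum α '' {ε | v * ∏ k, ε k = u} := by
      intro e₁ he₁ he₁α v hv c u hc hW
      obtain ⟨s, hs⟩ := he₁.exists_spinorBasis hσ
      refine SymmetricSpin.weights_restrictRep_spinorRep hneg hj1 hsurj hρ h𝔱_le hroot he₁ he₁α
        hs hW (hWe c) ?_
      rw [hc]
      exact he₁.mem_actionEigenspace_iff he hv hs u
    constructor
    · rintro ⟨f₁, hf₁, hfe⟩
      obtain ⟨e₁, he₁, he₁α, hfe₁⟩ := IsRootBasis.exists_orthonormal hneg hroot hα hopp hf₁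
      -- The root basis witnessing the orientation of `e` need not be `f`, so its own normalization
      -- `e₁` serves as reference.
      have hdet : e₁.det e = (((1 : ℤˣ) : ℤ) : ℝ) := by
        have h1 := (e₁.orientation_eq_iff_det_pos e).1 (hfe₁.symm.trans hfe)
        rcases he₁.det_eq_one_or_neg_one he with h | h
        · rw [h]; simp
        · rw [h] at h1; norm_num at h1
      constructor
      · rw [key he₁ he₁α 1 hdet 1 1 hone, SymmetricSpin.setOf_mul_prod_eq_self]
      · rw [key he₁ he₁α 1 hdet (-1) (-1) hnegone, SymmetricSpin.setOf_mul_prod_eq_neg]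
    · intro hnot
      -- Determinant `1` would make `f` a witness that `e` is root oriented.
      have hdet : e₀.det e = (((-1 : ℤˣ) : ℤ) : ℝ) := by
        rcases he₀.det_eq_one_or_neg_one he with h | h
        · exact absurd ⟨f, hf, hfe₀.trans ((e₀.orientation_eq_iff_det_pos e).2
            (by rw [h]; exact one_pos))⟩ hnot
        · rw [h]; simp
      constructor
      · have := SymmetricSpin.setOf_mul_prod_eq_neg (m := m) (-1)
        rw [neg_neg] at this
        rw [key he₀ he₀α (-1) hdet 1 1 hone, this]
      · rw [key he₀ he₀α (-1) hdet (-1) (-1) hnegone, SymmetricSpin.setOf_mul_prod_eq_self]
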